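/- Let $p$ be a prime number and let $U$ be a regular scheme (locally noetherian, with all local rings regular) with an action of the group $G=\mathbf Z/p=\langle\sigma:\sigma^p=1\rangle$, and let $\pi:U\to U/G$ be the quotient scheme (that is, $U/G$ is a scheme which is topologically the quotient of $U$ by the $G$-orbits, with $O_{U/G}=(\pi_*O_U)^G$). Suppose that $G$ fixes a closed point $P$ of $U$ (so that $G$ also acts trivially on the residue field $k_U$ at $P$), and that $k_U$ is perfect of characteristic $p$. Write $\mathfrak m$ for the maximal ideal of the local ring $O_{U,P}$, let $G$ act on functions by $g(f)=(g^{-1})^*(f)$, and let $I(f)=\sigma(f)-f$ for $f\in O_{U,P}$. Suppose that there are $e,s\in\mathfrak m-\{0\}$ and coordinates $x_1,\ldots,x_n$ at $P$ (elements of $\mathfrak m$ that map to a basis of the $k_U$-vector space $\mathfrak m/\mathfrak m^2$) such that $$I(s)=es\cdot(\text{unit}),\qquad I(x_i)\in(e)\ \text{ for } i=1,\ldots,n,\qquad p\in e^{p-1}\mathfrak m .$$ Then $U/G$ is regular near $\pi(P)$, or it has a $\mu_p$-quotient singularity of the form $\frac1p(b_1,\ldots,b_n)$ at $\pi(P)$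 for some $b_1,\ldots,b_n\in\mathbf F_p$. More precisely: (1) If $I(x_i)/e$ is a unit in $O_{U,P}$ for some $i$, then $U/G$ is regular near $\pi(P)$ (some open neighborhood of $\pi(P)$ is a regular scheme). (2) Otherwise, $I(\mathfrak m)\subset e\mathfrak m$, and $\varphi(y)=I(y)/e$ gives a well-defined $k_U$-linear map $\varphi:\mathfrak m/\mathfrak m^2\to\mathfrak m/\mathfrak m^2$. There is a nonzero scalar $c\in k_U$ such that $c\varphi$ is diagonalizable with all eigenvalues in $\mathbf F_p\subset k_U$. For every $c\in k_U-\{0\}$ such that $c\varphi$ is diagonalizable with eigenvalues $b_1,\ldots,b_n$ (listed with multiplicity) in $\mathbf F_p$, the scheme $U/G$ has a $\mu_p$-quotient singularity of the form $\frac1p(b_1,\ldots,b_n)$ at $\pi(P)$. Here $Y$ has a $\mu_p$-quotient singularity of the form $\frac1p(b_1,\ldots,b_n)$ at a point $y$ if there are an open neighborhood $N$ of $y$, a noetherian affine scheme $Q$ with an action of the group scheme $\mu_p$, and an isomorphism $Q/\mu_p\cong N$ such that $y$ is the image of a closed point $q$ of $Q$ that is fixed by $\mu_p$, $Q$ is regular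 at $q$, and there are coordinates $t_1,\ldots,t_n$ of $Q$ at $q$, regular functions on $Q$, on which $\mu_p$ acts by $\zeta(t_i)=\zeta^{b_i}t_i$; moreover it is required that $Q$ be a regular scheme if the set of regular points of $Q$ contains a neighborhood of $q$ (as always happens for excellent schemes). -/

import Mathlib

open AlgebraicGeometry CategoryTheory IsLocalRing TensorProduct

universe u

/-! ### Regular schemes and coordinates -/

/-- A regular scheme: locally noetherian, with all local rings regular. -/
structure IsRegularScheme (X : Scheme.{u}) : Prop where
  isLocallyNoetherian : IsLocallyNoetherian X
  isRegularLocalRing_stalk : ∀ x : X, IsRegularLocalRing (X.presheaf.stalk x)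

/-- `Y` is regular near `y`: some open neighborhood of `y` is a regular scheme. -/
def IsRegularNear (Y : Scheme.{u}) (y : Y) : Prop :=
  ∃ N : Y.Opens, y ∈ N ∧ IsRegularScheme (N : Scheme.{u})

/-- Coordinates of a local ring `R` with maximal ideal `m`: elements `x₁, …, xₙ` of `m` whose
classes form a basis of `m / m ^ 2` over the residue field. -/
def IsCoordinates (R : Type*) [CommRing R] [IsLocalRing R] {n : ℕ} (x : Fin n → R) : Prop :=
  ∃ (hx : ∀ i, x i ∈ maximalIdeal R) (v : Module.Basis (Fin n) (ResidueField R) (CotangentSpace R)),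
    ∀ i, v i = (maximalIdeal R).toCotangent ⟨x i, hx i⟩

/-! ### Actions of an abstract group on a scheme, and quotients -/

section GroupAction

variable {G : Type} [Group G] {U : Scheme.{u}}

/-- Given an action `ρ` of `G` on `U` with `g P = P` for all `g`, the action of `g` on the local
ring at `P` by `g(f) = (g⁻¹)^*(f)`. (The first map identifies the local ring at `P` with the one
at `g⁻¹ P = P`.) -/
noncomputable def stalkAction (ρ : G →* Aut U) (P : U) (hP : ∀ g, (ρ g).hom P = P) (g : G) :
    U.presheaf.stalk P →+* U.presheaf.stalk P :=
  (U.presheaf.stalkSpecializes (specializes_of_eq (hP g⁻¹)) ≫ (ρ g⁻¹).hom.stalkMap P).hom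

theorem le_preimage_of_invariant {Y : Scheme.{u}} {ρ : G →* Aut U} {π : U ⟶ Y}
    (h : ∀ g, (ρ g).hom ≫ π = π) (g : G) (V : Y.Opens) :
    π ⁻¹ᵁ V ≤ (ρ g).hom ⁻¹ᵁ (π ⁻¹ᵁ V) := by
  rw [← Scheme.Hom.comp_preimage, h g]

/-- `π : U ⟶ Y` is the quotient of `U` by the action `ρ` of the group `G` (that is, `Y = U/G`):
`π` is `G`-invariant, topologically it is the quotient by the orbits, and the sections of `O_Y`
over `V` are the `G`-invariant sections of `O_U` over `π⁻¹ V`. -/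
structure IsGroupQuotient (ρ : G →* Aut U) {Y : Scheme.{u}} (π : U ⟶ Y) : Prop where
  invariant : ∀ g, (ρ g).hom ≫ π = π
  isQuotientMap : Topology.IsQuotientMap π
  orbit : ∀ x x' : U, π x = π x' → ∃ g, (ρ g).hom x = x'
  injective_app : ∀ V : Y.Opens, Function.Injective (π.app V)
  mem_range_app : ∀ (V : Y.Opens) (f : Γ(U, π ⁻¹ᵁ V)),
    (∀ g, (ρ g).hom.appLE (π ⁻¹ᵁ V) (π ⁻¹ᵁ V) (le_preimage_of_invariant invariant g V) f = f) →
      ∃ f' : Γ(Y, V), π.app V f' = f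

end GroupAction

/-! ### Actions of the group scheme `μ_p` on affine schemes -/

/-- The coordinate ring `ℤ[T] / (T ^ p - 1) = ℤ[ℤ/p]` of the group scheme `μ_p`, with its
standard Hopf algebra structure, in which `T` is grouplike. -/
abbrev MuRing (p : ℕ) : Type := AddMonoidAlgebra ℤ (ZMod p)

/-- An action of the group scheme `μ_p` on the affine scheme `Spec B`: a coaction
`B → B ⊗ O(μ_p)` (a ring homomorphism) that is counital and coassociative. -/
structure MuAction (p : ℕ) (B : Type u) [CommRing B] where
  coact : B →ₐ[ℤ] B ⊗[ℤ] MuRing p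
  counital : (Algebra.TensorProduct.rid ℤ ℤ B).toAlgHom.comp
    ((Algebra.TensorProduct.map (AlgHom.id ℤ B) (Bialgebra.counitAlgHom ℤ (MuRing p))).comp coact)
      = AlgHom.id ℤ B
  coassoc : (Algebra.TensorProduct.assoc ℤ ℤ ℤ B (MuRing p) (MuRing p)).toAlgHom.comp
    ((Algebra.TensorProduct.map coact (AlgHom.id ℤ (MuRing p))).comp coact)
      = (Algebra.TensorProduct.map (AlgHom.id ℤ B)
          (Bialgebra.comulAlgHom ℤ (MuRing p))).comp coact

namespace MuAction

variable {p : ℕ} {B : Type u} [CommRing B] (α : MuAction p B)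

/-- The ring of `μ_p`-invariant functions. Its spectrum is the quotient `Spec B / μ_p`. -/
noncomputable def invariants : Subalgebra ℤ B :=
  AlgHom.equalizer α.coact Algebra.TensorProduct.includeLeft

/-- `h` is a `μ_p`-eigenfunction of weight `b`: `ζ(h) = ζ ^ b h`. -/
def IsEigenfunction (b : ZMod p) (h : B) : Prop :=
  α.coact h = h ⊗ₜ[ℤ] AddMonoidAlgebra.single b (1 : ℤ)

/-- `μ_p` fixes the point `q` of `Spec B`, scheme-theoretically: it preserves the prime ideal and
acts trivially on the quotient ring, that is, `ζ(h) ≡ h` modulo `q` for every function `h`. -/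
def Fixes (q : Ideal B) : Prop :=
  ∀ h : B, α.coact h - h ⊗ₜ[ℤ] (1 : MuRing p) ∈
    q.map (Algebra.TensorProduct.includeLeft : B →ₐ[ℤ] B ⊗[ℤ] MuRing p)

end MuAction

/-- `Y` has a singularity of the form `1/p (b₁, …, bₙ)` at `y`: an open neighborhood `N` of `y` is
the quotient `Q / μ_p` of a noetherian affine scheme `Q = Spec B` by an action of `μ_p`, where `y`
is the image of a closed point `q` of `Q` that is fixed by `μ_p`, `Q` is regular at `q`, and there
are coordinates of `Q` at `q` on which `μ_p` acts with weights `b₁, …, bₙ`.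
Being a statement about the germ of `Y` at `y`, this asks for regularity of `Q` at `q`. If the
regular points of `Q` contain a neighborhood of `q` (which is automatic for excellent schemes),
then all of `Q` is required to be regular. -/
def HasMuQuotientSingularity (p : ℕ) (Y : Scheme.{u}) (y : Y) {n : ℕ} (b : Fin n → ZMod p) :
    Prop :=
  ∃ (N : Y.Opens) (hy : y ∈ N) (B : Type u) (_ : CommRing B) (α : MuAction p B)
    (ι : Spec (CommRingCat.of α.invariants) ≅ (N : Scheme.{u}))
    (q : PrimeSpectrum B) (t : Fin n → B),
    IsNoetherianRing B ∧
    q.asIdeal.IsMaximal ∧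
    α.Fixes q.asIdeal ∧
    ι.hom (PrimeSpectrum.comap α.invariants.val.toRingHom q) = (⟨y, hy⟩ : N) ∧
    IsRegularLocalRing (Localization.AtPrime q.asIdeal) ∧
    (∀ i, α.IsEigenfunction (b i) (t i)) ∧
    IsCoordinates (Localization.AtPrime q.asIdeal) (fun i => algebraMap B _ (t i)) ∧
    ((∃ V : Set (PrimeSpectrum B), IsOpen V ∧ q ∈ V ∧
        ∀ x ∈ V, IsRegularLocalRing (Localization.AtPrime x.asIdeal)) → IsRegularRing B)

/-- The endomorphism `φ` of a finite-dimensional `k`-vector space is diagonalizable with eigenvalues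
(with multiplicities) the images of `b₁, …, bₙ ∈ 𝔽_p` in `k`. -/
def IsDiagonalizableWith (p : ℕ) {k M : Type*} [Field k] [AddCommGroup M] [Module k M]
    (φ : M →ₗ[k] M) {n : ℕ} (b : Fin n → ZMod p) : Prop :=
  ∃ v : Module.Basis (Fin n) k M, ∀ i, φ (v i) = ((b i).cast : k) • v i

/-! Let R be the local ring at P, σ the generator, and S the functions on a small invariant affine
neighborhood. As the residue field is perfect, every f ∈ R is g^p + r with r ∈ 𝔪, and I(g^p) lies in
𝔪·I(R)R; Nakayama then extends I(x_i) ∈ (e) to I(R) ⊆ (e) (`dvd_sub_of_dvd_generators`).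

The main tool is Newton's divided difference with nodes w, σw, …, σ^(p-1)w. The top one is a
weighted sum over the whole orbit, whose terms σ permutes cyclically. Hence it is invariant, and it
is linear over the invariants.

If I(x_i) = e·(unit), put y = x_i. All σ^j y - y with 0 < j < p are unit multiples of e, so divided
differences with nodes σ^j y stay in S, and Lagrange interpolation shows that 1, y, …, y^(p-1) is a
basis of S over S^σ (`free_and_adjoin_eq_top_of_dvd`). Since S is generated by one element, its
maximal ideals are locally principal modulo those of S^σ, and regularity descends
(`IsRegularLocalRing.of_flat_of_le_map_sup_span`).

Otherwise write σ(s) = θs with θ = 1 + e u₁, u₁ a unit. With the nodes σ^j(1/s), the top divided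
difference of c/s^(p-1) lies in the ring again, and c ↦ this element is a retraction onto the
invariants (`exists_invariant_splitting`). On 𝔪/𝔪² its steps are, up to nonzero scalars, the maps φ
+ i u₁ for i = 1, …, p-1. The result is invariant, so φ kills it: φ ∏ (φ + i u₁) = 0. The p roots
are distinct, so φ is diagonalizable with eigenvalues -k u₁, k ∈ 𝔽_p
(`aeval_prod_cotangent_endomorphism_eq_zero`).

For the presentation as a μ_p-quotient, take a unit μ with σμ = θ^p μ (`exists_kummer_unit`) and
extend σ to C = S[T]/(T^p - μ) by σT = θT. The ring B = C^σ is graded by the powers of T, and its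
degree zero part is S^σ. If φ(x) = -k u₁ x, the retraction of C onto B sends x T^k to y T^k with y ≡
±x modulo 𝔪² (`KummerDatum.exists_homogeneous_lift`). The elements y_i T^(k_i) so obtained generate
the maximal ideal of B at the point T = 1 over P: elements of that ideal lie in (y_1, …, y_n)C after
an invariant localization, and the retraction moves the coefficients into B. Comparing dimensions
through C shows that B is regular there (`KummerDatum.isRegularLocalRing_point`). Giving T a weight
r ≠ 0 yields the weights k_i r, which are all the tuples that rescaling φ can produce. -/

/-! ### Divided differences along an orbit of nodes. -/

section DividedDifference

variable {Q : Type*} [CommRing Q] (σ : Q →+* Q) (w : Q)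

/-- The `j`-th divided difference of the values `g, σ g, …, σ^j g` with respect to the nodes
`w, σ w, …, σ^j w`. -/
noncomputable def dividedDifference : ℕ → Q → Q
  | 0, g => g
  | j + 1, g => (σ (dividedDifference j g) - dividedDifference j g) *
      Ring.inverse ((σ ^ (j + 1)) w - w)

theorem dividedDifference_add (j : ℕ) (g g' : Q) :
    dividedDifference σ w j (g + g') = dividedDifference σ w j g + dividedDifference σ w j g' := by
  induction j with
  | zero => rfl
  | succ j ih => simp only [dividedDifference, ih, map_add]; ring

theorem dividedDifference_fixed_mul (j : ℕ) {a : Q} (ha : σ a = a) (g : Q) :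
    dividedDifference σ w j (a * g) = a * dividedDifference σ w j g := by
  induction j with
  | zero => rfl
  | succ j ih => simp only [dividedDifference, ih, map_mul, ha]; ring

theorem ringHom_pow_succ_apply (j : ℕ) (x : Q) : (σ ^ (j + 1)) x = σ ((σ ^ j) x) := by
  rw [pow_succ']; rfl

theorem ringHom_pow_succ_apply' (j : ℕ) (x : Q) : (σ ^ (j + 1)) x = (σ ^ j) (σ x) := by
  rw [pow_succ]; rfl

/-- The difference quotients times the differences. -/
theorem sub_mul_dividedDifference_succ {j : ℕ} (h : IsUnit ((σ ^ (j + 1)) w - w)) (g : Q) :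
    ((σ ^ (j + 1)) w - w) * dividedDifference σ w (j + 1) g =
      σ (dividedDifference σ w j g) - dividedDifference σ w j g := by
  rw [dividedDifference, mul_left_comm, Ring.mul_inverse_cancel _ h, mul_one]

/-- The Leibniz rule for the product with the node. -/
theorem dividedDifference_node_mul {j : ℕ}
    (h : ∀ i, 0 < i → i ≤ j + 1 → IsUnit ((σ ^ i) w - w)) (g : Q) :
    dividedDifference σ w (j + 1) (w * g) =
      w * dividedDifference σ w (j + 1) g + σ (dividedDifference σ w j g) := by
  induction j with
  | zero =>
    apply (h 1 one_pos le_rfl).mul_left_cancel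
    have h1 := sub_mul_dividedDifference_succ σ w (h 1 one_pos le_rfl)
    rw [mul_add, mul_left_comm, h1, h1]
    simp only [dividedDifference, map_mul, pow_one]
    ring
  | succ j ih =>
    have hj := ih fun i hi hij => h i hi (by omega)
    have h1 := sub_mul_dividedDifference_succ σ w (h (j + 1) (by omega) (by omega)) g
    have h2 := sub_mul_dividedDifference_succ σ w (h (j + 2) (by omega) le_rfl)
    apply (h (j + 2) (by omega) le_rfl).mul_left_cancel
    rw [mul_add, mul_left_comm, h2, h2, hj]
    have h3 := congrArg σ h1
    simp only [map_mul, map_sub, map_add, ← ringHom_pow_succ_apply] at h3 ⊢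
    linear_combination -h3

theorem dividedDifference_succ_one (j : ℕ) : dividedDifference σ w (j + 1) 1 = 0 := by
  induction j with
  | zero => simp [dividedDifference]
  | succ j ih => rw [dividedDifference, ih]; simp

/-- Polynomials in the node of degree below the order are killed, because the Leibniz rule lowers
the exponent and expresses the result by differences of order still above it. -/
theorem dividedDifference_pow_of_lt {j : ℕ}
    (h : ∀ i, 0 < i → i ≤ j → IsUnit ((σ ^ i) w - w)) {i : ℕ} (hi : i < j) :
    dividedDifference σ w j (w ^ i) = 0 := by
  induction i generalizing j with
  | zero =>
    obtain ⟨j, rfl⟩ := Nat.exists_eq_succ_of_ne_zero (by omega : j ≠ 0)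
    rw [pow_zero, dividedDifference_succ_one]
  | succ i ih =>
    obtain ⟨j, rfl⟩ := Nat.exists_eq_succ_of_ne_zero (by omega : j ≠ 0)
    rw [pow_succ', dividedDifference_node_mul σ w h, ih h (by omega),
      ih (fun i hi hij => h i hi (by omega)) (by omega)]
    simp

theorem dividedDifference_pow_self {j : ℕ}
    (h : ∀ i, 0 < i → i ≤ j → IsUnit ((σ ^ i) w - w)) :
    dividedDifference σ w j (w ^ j) = 1 := by
  induction j with
  | zero => simp [dividedDifference]
  | succ j ih =>
    rw [pow_succ', dividedDifference_node_mul σ w h,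
      ih (fun i hi hij => h i hi (by omega)), dividedDifference_pow_of_lt σ w h (Nat.lt_succ_self j)]
    simp

theorem ringHom_pow_mod {p : ℕ} (hσ : σ ^ p = 1) (i : ℕ) : σ ^ (i % p) = σ ^ i := by
  conv_rhs => rw [← Nat.div_add_mod i p, pow_add, pow_mul, hσ, one_pow, one_mul]

theorem isUnit_node_sub {p : ℕ} (h : ∀ i, 0 < i → i < p → IsUnit ((σ ^ i) w - w)) {i l : ℕ}
    (hi : i < p) (hl : l < p) (hil : i ≠ l) : IsUnit ((σ ^ i) w - (σ ^ l) w) := by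
  have key : ∀ i l : ℕ, i < l → l < p → IsUnit ((σ ^ l) w - (σ ^ i) w) := by
    intro i l hil hl
    have := (h (l - i) (by omega) (by omega)).map (σ ^ i)
    rw [map_sub, ← RingHom.comp_apply, ← RingHom.mul_def, ← pow_add] at this
    rwa [show i + (l - i) = l by omega] at this
  rcases lt_or_gt_of_ne hil with h' | h'
  · rw [← neg_sub]; exact (key i l h' hl).neg
  · exact key l i h' hi

/-- Lagrange's form of Newton's recursion. It is symmetric in the nodes, which the recursive
definition hides and which the invariance of the top difference needs. -/
theorem dividedDifference_eq_sum {p : ℕ} (h : ∀ i, 0 < i → i < p → IsUnit ((σ ^ i) w - w))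
    {j : ℕ} (hj : j < p) (g : Q) :
    dividedDifference σ w j g = ∑ i ∈ Finset.range (j + 1),
      (∏ l ∈ Finset.range (j + 1), if l = i then 1 else Ring.inverse ((σ ^ i) w - (σ ^ l) w)) *
        (σ ^ i) g := by
  induction j with
  | zero => simp [dividedDifference]
  | succ j ih =>
    have hu := h (j + 1) (by omega) hj
    apply hu.mul_left_cancel
    rw [sub_mul_dividedDifference_succ σ w hu, ih (by omega)]
    set F : ℕ → ℕ → Q := fun i l => if l = i then 1 else Ring.inverse ((σ ^ i) w - (σ ^ l) w)
    have hF : ∀ i l, i < j + 2 → l < j + 2 → i ≠ l → ((σ ^ i) w - (σ ^ l) w) * F i l = 1 := by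
      intro i l hi hl hil
      simp only [F, if_neg hil.symm]
      exact Ring.mul_inverse_cancel _ (isUnit_node_sub σ w h (by omega) (by omega) hil)
    have hσF : ∀ i l, i < j + 1 → l < j + 1 → σ (F i l) = F (i + 1) (l + 1) := by
      intro i l hi hl
      by_cases hil : l = i
      · simp [F, hil]
      · have h1 := congrArg σ (hF i l (by omega) (by omega) (Ne.symm hil))
        have h2 := hF (i + 1) (l + 1) (by omega) (by omega) (by omega)
        rw [map_mul, map_sub, map_one, ← ringHom_pow_succ_apply, ← ringHom_pow_succ_apply] at h1
        exact (isUnit_node_sub σ w h (by omega) (by omega) (by omega : i + 1 ≠ l + 1)).mul_left_cancel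
          (h1.trans h2.symm)
    change σ (∑ i ∈ Finset.range (j + 1), (∏ l ∈ Finset.range (j + 1), F i l) * (σ ^ i) g) -
      ∑ i ∈ Finset.range (j + 1), (∏ l ∈ Finset.range (j + 1), F i l) * (σ ^ i) g =
      _ * ∑ i ∈ Finset.range (j + 2), (∏ l ∈ Finset.range (j + 2), F i l) * (σ ^ i) g
    -- In a Lagrange coefficient of order j + 1, the multiplier σ^i w - w cancels the factor of the
    -- first node, and σ^i w - σ^(j+1) w that of the last. These give the two terms of the
    -- recursion, and the multipliers differ by σ^(j+1) w - w, which is independent of i.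
    have e1 : σ (∑ i ∈ Finset.range (j + 1), (∏ l ∈ Finset.range (j + 1), F i l) * (σ ^ i) g) =
        ∑ i ∈ Finset.range (j + 2), ((σ ^ i) w - w) * (∏ l ∈ Finset.range (j + 2), F i l) *
          (σ ^ i) g := by
      rw [Finset.sum_range_succ' _ (j + 1), map_sum]
      simp only [pow_zero, RingHom.one_def, RingHom.id_apply, sub_self, zero_mul, add_zero]
      refine Finset.sum_congr rfl fun i hi => ?_
      rw [Finset.mem_range] at hi
      rw [map_mul, map_prod, Finset.prod_range_succ' _ (j + 1), ← ringHom_pow_succ_apply,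
        Finset.prod_congr rfl fun l hl => hσF i l hi (Finset.mem_range.mp hl)]
      have := hF (i + 1) 0 (by omega) (by omega) (by omega)
      rw [pow_zero, RingHom.one_def, RingHom.id_apply] at this
      linear_combination (-(∏ l ∈ Finset.range (j + 1), F (i + 1) (l + 1)) * (σ ^ (i + 1)) g) * this
    have e2 : ∑ i ∈ Finset.range (j + 1), (∏ l ∈ Finset.range (j + 1), F i l) * (σ ^ i) g =
        ∑ i ∈ Finset.range (j + 2), ((σ ^ i) w - (σ ^ (j + 1)) w) *
          (∏ l ∈ Finset.range (j + 2), F i l) * (σ ^ i) g := by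
      rw [Finset.sum_range_succ _ (j + 1)]
      simp only [sub_self, zero_mul, add_zero]
      refine Finset.sum_congr rfl fun i hi => ?_
      rw [Finset.mem_range] at hi
      rw [Finset.prod_range_succ _ (j + 1)]
      have := hF i (j + 1) (by omega) (by omega) (by omega)
      linear_combination (-(∏ l ∈ Finset.range (j + 1), F i l) * (σ ^ i) g) * this
    rw [e1, e2, ← Finset.sum_sub_distrib, Finset.mul_sum]
    exact Finset.sum_congr rfl fun i _ => by ring

/-- The weight of the value `σ^i g` in the top divided difference over a full orbit. -/
noncomputable def orbitWeight (p i : ℕ) : Q :=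
  ∏ l ∈ Finset.range p, if l % p = i % p then 1 else Ring.inverse ((σ ^ i) w - (σ ^ l) w)

theorem dividedDifference_top_eq_sum {p : ℕ} (hp : 0 < p)
    (h : ∀ i, 0 < i → i < p → IsUnit ((σ ^ i) w - w)) (g : Q) :
    dividedDifference σ w (p - 1) g =
      ∑ i ∈ Finset.range p, orbitWeight σ w p i * (σ ^ i) g := by
  rw [dividedDifference_eq_sum σ w h (by omega), Nat.sub_add_cancel hp]
  refine Finset.sum_congr rfl fun i hi => ?_
  congr 1
  refine Finset.prod_congr rfl fun l hl => ?_
  rw [Nat.mod_eq_of_lt (Finset.mem_range.mp hl), Nat.mod_eq_of_lt (Finset.mem_range.mp hi)]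

theorem sum_range_succ_of_periodic {M : Type*} [AddCommMonoid M] {p : ℕ} (H : ℕ → M)
    (h : H p = H 0) : ∑ i ∈ Finset.range p, H (i + 1) = ∑ i ∈ Finset.range p, H i := by
  rcases Nat.eq_zero_or_pos p with rfl | hp
  · simp
  obtain ⟨p, rfl⟩ := Nat.exists_eq_succ_of_ne_zero hp.ne'
  rw [Finset.sum_range_succ, Finset.sum_range_succ', h]

theorem prod_range_succ_of_periodic {M : Type*} [CommMonoid M] {p : ℕ} (H : ℕ → M)
    (h : H p = H 0) : ∏ i ∈ Finset.range p, H (i + 1) = ∏ i ∈ Finset.range p, H i :=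
  sum_range_succ_of_periodic (M := Additive M) H h

/-- σ shifts both indices by one. Since `orbitWeight` compares indices modulo p and σ^p = 1, the
factors are periodic in the second index and the shift only permutes them. -/
theorem map_orbitWeight {p : ℕ} (hσ : σ ^ p = 1)
    (h : ∀ i, 0 < i → i < p → IsUnit ((σ ^ i) w - w)) (i : ℕ) :
    σ (orbitWeight σ w p i) = orbitWeight σ w p (i + 1) := by
  rcases Nat.eq_zero_or_pos p with rfl | hp
  · simp [orbitWeight]
  rw [orbitWeight, orbitWeight, map_prod, ← prod_range_succ_of_periodic (fun l =>
    if l % p = (i + 1) % p then 1 else Ring.inverse ((σ ^ (i + 1)) w - (σ ^ l) w)) (by simp [hσ])]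
  refine Finset.prod_congr rfl fun l _ => ?_
  have hil : (l + 1) % p = (i + 1) % p ↔ l % p = i % p :=
    ⟨fun h => Nat.ModEq.add_right_cancel' 1 h, fun h => Nat.ModEq.add_right 1 h⟩
  by_cases hl : l % p = i % p
  · rw [if_pos hl, if_pos (hil.mpr hl), map_one]
  · rw [if_neg hl, if_neg (hil.not.mpr hl)]
    have hu : IsUnit ((σ ^ i) w - (σ ^ l) w) := by
      rw [← ringHom_pow_mod σ hσ i, ← ringHom_pow_mod σ hσ l]
      exact isUnit_node_sub σ w h (Nat.mod_lt _ hp) (Nat.mod_lt _ hp) (Ne.symm hl)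
    have hu' : (σ ^ (i + 1)) w - (σ ^ (l + 1)) w = σ ((σ ^ i) w - (σ ^ l) w) := by
      rw [map_sub, ringHom_pow_succ_apply, ringHom_pow_succ_apply]
    rw [hu']
    apply (hu.map σ).mul_left_cancel
    rw [Ring.mul_inverse_cancel _ (hu.map σ), ← map_mul, Ring.mul_inverse_cancel _ hu, map_one]

theorem orbitWeight_eq {p : ℕ} (hσ : σ ^ p = 1)
    (h : ∀ i, 0 < i → i < p → IsUnit ((σ ^ i) w - w)) (i : ℕ) :
    orbitWeight σ w p i = (σ ^ i) (orbitWeight σ w p 0) := by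
  induction i with
  | zero => rfl
  | succ i ih => rw [← map_orbitWeight σ w hσ h, ih, ringHom_pow_succ_apply]

/-- The p nodes form a full orbit, so σ permutes the terms of the Lagrange sum cyclically. -/
theorem map_dividedDifference_top {p : ℕ} (hp : 0 < p) (hσ : σ ^ p = 1)
    (h : ∀ i, 0 < i → i < p → IsUnit ((σ ^ i) w - w)) (g : Q) :
    σ (dividedDifference σ w (p - 1) g) = dividedDifference σ w (p - 1) g := by
  rw [dividedDifference_top_eq_sum σ w hp h, map_sum]
  rw [← sum_range_succ_of_periodic (fun i => orbitWeight σ w p i * (σ ^ i) g)]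
  · refine Finset.sum_congr rfl fun i _ => ?_
    rw [map_mul, map_orbitWeight σ w hσ h, ringHom_pow_succ_apply]
  · rw [orbitWeight_eq σ w hσ h p, hσ, pow_zero]; rfl

end DividedDifference

/-! ### The retraction onto the invariants. -/

section Splitting

variable {C : Type*} [CommRing C]

/-- The extension of an endomorphism of finite order to the total ring of fractions. -/
theorem exists_extension_fractionRing {p : ℕ} (hp : 0 < p) (σ : C →+* C) (hσ : σ ^ p = 1) :
    ∃ τ : FractionRing C →+* FractionRing C, τ ^ p = 1 ∧
      ∀ c, τ (algebraMap C _ c) = algebraMap C _ (σ c) := by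
  obtain ⟨p, rfl⟩ := Nat.exists_eq_succ_of_ne_zero hp.ne'
  have hinv : ∀ x, (σ ^ p) (σ x) = x := fun x => by
    rw [← ringHom_pow_succ_apply', hσ]; rfl
  have hinv' : ∀ x, σ ((σ ^ p) x) = x := fun x => by
    rw [← ringHom_pow_succ_apply, hσ]; rfl
  -- A power of σ is inverse to σ, so σ preserves nonzero divisors.
  have hreg : nonZeroDivisors C ≤ (nonZeroDivisors C).comap σ := by
    intro x hx
    rw [Submonoid.mem_comap, mem_nonZeroDivisors_iff_right]
    intro y hy
    have := congrArg (σ ^ p) hy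
    rw [map_mul, hinv, map_zero] at this
    have h0 := (mem_nonZeroDivisors_iff_right.mp hx) _ this
    rw [← hinv' y, h0, map_zero]
  refine ⟨IsLocalization.map (FractionRing C) σ hreg, ?_, fun c => IsLocalization.map_eq _ c⟩
  have key : ∀ (j : ℕ) (c : C), ((IsLocalization.map (FractionRing C) σ hreg :
      FractionRing C →+* FractionRing C) ^ j) (algebraMap C _ c) = algebraMap C _ ((σ ^ j) c) := by
    intro j
    induction j with
    | zero => intro c; rfl
    | succ j ih =>
      intro c
      rw [ringHom_pow_succ_apply', ringHom_pow_succ_apply', ← ih, IsLocalization.map_eq]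
  apply IsLocalization.ringHom_ext (nonZeroDivisors C)
  ext c
  rw [RingHom.comp_apply, key, hσ]; rfl

theorem pow_apply_of_apply {D : Type*} [CommRing D] (f : C →+* D) (σ : C →+* C) (τ : D →+* D)
    (h : ∀ c, τ (f c) = f (σ c)) (j : ℕ) (c : C) : (τ ^ j) (f c) = f ((σ ^ j) c) := by
  induction j generalizing c with
  | zero => rfl
  | succ j ih => rw [ringHom_pow_succ_apply', ringHom_pow_succ_apply', h, ih]

/-- An automorphism `σ` of order `p` with principal augmentation ideal `(e)` and a
semi-invariant `s` with `σ s - s = e s u`, `u` a unit: the inclusion of the ring of invariants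
is split as a map of modules. The splitting is a divided difference with respect to `1 / s`;
it is computed by `p - 1` steps that are recorded in the last clause. -/
theorem exists_invariant_splitting {p : ℕ} (hp : 1 < p) (σ : C →+* C) (hσ : σ ^ p = 1)
    {e s θ : C} (he : e ∈ nonZeroDivisors C) (hs : s ∈ nonZeroDivisors C) (hθ : IsUnit θ)
    (hsθ : σ s = θ * s) (hdiv : ∀ c, e ∣ σ c - c)
    (hu : ∀ j, 0 < j → j < p → ∃ u, IsUnit u ∧ (σ ^ j) s - s = e * s * u) :
    ∃ P : C →+ C, (∀ c, σ (P c) = P c) ∧ (∀ b c, σ b = b → P (b * c) = b * P c) ∧ P 1 = 1 ∧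
      ∀ (R : ℕ → C → Prop) (c : C), R 0 c →
        (∀ j c c', j + 1 < p → R j c →
          (∀ u, (σ ^ (j + 1)) s - s = e * s * u →
            u * θ ^ (p - 1 - j) * (e * c') = -(1 + e * u) * (σ c - θ ^ (p - 1 - j) * c)) →
          R (j + 1) c') → R (p - 1) (P c) := by
  obtain ⟨τ, hτ, hτσ⟩ := exists_extension_fractionRing (by omega : 0 < p) σ hσ
  have hτj := pow_apply_of_apply (algebraMap C (FractionRing C)) σ τ hτσ
  set f := algebraMap C (FractionRing C) with hf
  have hinj : Function.Injective f := IsFractionRing.injective C (FractionRing C)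
  have heu : IsUnit (f e) := IsLocalization.map_units (FractionRing C) (⟨e, he⟩ : nonZeroDivisors C)
  have hsu : IsUnit (f s) := IsLocalization.map_units (FractionRing C) (⟨s, hs⟩ : nonZeroDivisors C)
  have hθu : IsUnit (f θ) := hθ.map f
  -- The node is w = 1/s.
  obtain ⟨w, hw⟩ := hsu.exists_right_inv
  have hwu : IsUnit w := IsUnit.of_mul_eq_one (f s) (by rw [mul_comm, hw])
  -- the nodes
  have hθw : f θ * τ w = w := by
    have := congrArg τ hw
    rw [map_mul, hτσ, hsθ, map_mul, map_one] at this
    calc f θ * τ w = (f θ * f s * τ w) * w := by linear_combination (-f θ * τ w) * hw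
      _ = w := by rw [this, one_mul]
  have hnode : ∀ j u, (σ ^ j) s - s = e * s * u →
      (1 + f e * f u) * (τ ^ j) w = w := by
    intro j u h
    have h1 := congrArg (τ ^ j) hw
    have h2 : (σ ^ j) s = s * (1 + e * u) := by linear_combination h
    rw [map_mul, hτj, map_one, h2] at h1
    simp only [map_mul, map_add, map_one] at h1
    linear_combination w * h1 - (1 + f e * f u) * (τ ^ j) w * hw
  -- The node difference is -e u w/(1 + e u): dividing by it means dividing by e and w, up to the
  -- factor -(1 + e u)/u.
  have hnode' : ∀ j u, (σ ^ j) s - s = e * s * u →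
      (1 + f e * f u) * ((τ ^ j) w - w) = -(f e * f u * w) := by
    intro j u h
    linear_combination hnode j u h
  have hδ : ∀ j, 0 < j → j < p → IsUnit ((τ ^ j) w - w) := by
    intro j h0 h1
    obtain ⟨u, huu, h⟩ := hu j h0 h1
    have : IsUnit ((1 + f e * f u) * ((τ ^ j) w - w)) := by
      rw [hnode' j u h]
      exact ((heu.mul (huu.map f)).mul hwu).neg
    exact isUnit_of_mul_isUnit_right this
  have hes : e * s ∈ nonZeroDivisors C := mul_mem he hs
  have hθe : ∀ a : ℕ, e ∣ θ ^ a - 1 := by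
    obtain ⟨u, -, h⟩ := hu 1 one_pos hp
    rw [pow_one, hsθ] at h
    have : θ - 1 = e * u := by
      apply (mem_nonZeroDivisors_iff_right.mp hs (θ - 1 - e * u) (by linear_combination h) |>
        sub_eq_zero.mp)
    intro a
    exact (Dvd.intro u this.symm).trans (sub_one_dvd_pow_sub_one θ a)
  -- The divided difference of order j of c/s^(p-1) is c_j/s^(p-1-j) with c_j ∈ C: as θ ≡ 1 modulo
  -- e, the numerator σ c_j - θ^(p-1-j) c_j is divisible by e. An arbitrary predicate `R` travels
  -- along, so that later uses can trace the c_j.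
  have hrec : ∀ (c : C) (j : ℕ), j < p → ∃ cj : C,
      f cj * w ^ (p - 1 - j) = dividedDifference τ w j (w ^ (p - 1) * f c) ∧
      ∀ (R : ℕ → C → Prop), R 0 c →
        (∀ j c c', j + 1 < p → R j c →
          (∀ u, (σ ^ (j + 1)) s - s = e * s * u →
            u * θ ^ (p - 1 - j) * (e * c') = -(1 + e * u) * (σ c - θ ^ (p - 1 - j) * c)) →
          R (j + 1) c') → R j cj := by
    intro c j
    induction j with
    | zero => intro _; exact ⟨c, by simp [dividedDifference, mul_comm], fun R h0 _ => h0⟩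
    | succ j ih =>
      intro hj
      obtain ⟨cj, h1, h2⟩ := ih (by omega)
      obtain ⟨a, ha⟩ : ∃ a, p - 1 - j = a + 1 := ⟨p - 2 - j, by omega⟩
      obtain ⟨u, huu, h⟩ := hu (j + 1) (by omega) hj
      obtain ⟨d, hd⟩ : e ∣ σ cj - θ ^ (a + 1) * cj := by
        have : σ cj - θ ^ (a + 1) * cj = (σ cj - cj) - (θ ^ (a + 1) - 1) * cj := by ring
        rw [this]
        exact dvd_sub (hdiv cj) (Dvd.dvd.mul_right (hθe _) _)
      -- With u' = 1/u, t = 1/θ^(a+1) and d the quotient by e, the step equation is solved by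
      -- c_(j+1) = -(1 + e u) u' t d.
      obtain ⟨u', hu'⟩ := huu.exists_right_inv
      obtain ⟨t, ht⟩ := (hθ.pow (a + 1)).exists_right_inv
      have hc' : u * θ ^ (a + 1) * (e * (-(1 + e * u) * u' * t * d)) =
          -(1 + e * u) * (σ cj - θ ^ (a + 1) * cj) := by
        rw [hd]
        linear_combination (-(1 + e * u) * e * d * u * u') * ht - (1 + e * u) * e * d * hu'
      refine ⟨-(1 + e * u) * u' * t * d, ?_, fun R h0 hR => hR j cj _ hj (h2 R h0 hR) ?_⟩
      · have hδj := hδ (j + 1) (by omega) hj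
        apply hδj.mul_left_cancel
        rw [sub_mul_dividedDifference_succ τ w hδj, ← h1, ha]
        have e1 : p - 1 - (j + 1) = a := by omega
        rw [e1]
        have hunit : IsUnit (f θ ^ (a + 1) * (1 + f e * f u)) := by
          refine (hθu.pow _).mul (isUnit_of_mul_isUnit_left (y := (τ ^ (j + 1)) w) ?_)
          rw [hnode (j + 1) u h]; exact hwu
        apply hunit.mul_left_cancel
        have h3 := congrArg f hc'
        have h4 := hnode' (j + 1) u h
        have h5 : f θ ^ (a + 1) * τ w ^ (a + 1) = w ^ (a + 1) := by rw [← mul_pow, hθw]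
        simp only [map_mul, map_pow, map_add, map_sub, map_neg, map_one, hτσ] at h3 h4 ⊢
        linear_combination (f θ ^ (a + 1) * w ^ a * (-(1 + f e * f u) * f u' * f t * f d)) * h4
          - w ^ (a + 1) * h3 - (1 + f e * f u) * f (σ cj) * h5
      · intro u₂ h₂
        have : u₂ = u := by
          have := mem_nonZeroDivisors_iff_right.mp hes (u₂ - u) (by linear_combination h - h₂)
          exact sub_eq_zero.mp this
        rw [this, ha]
        exact hc'
  have hP : ∀ c, ∃ y : C, f y = dividedDifference τ w (p - 1) (w ^ (p - 1) * f c) ∧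
      ∀ (R : ℕ → C → Prop), R 0 c →
        (∀ j c c', j + 1 < p → R j c →
          (∀ u, (σ ^ (j + 1)) s - s = e * s * u →
            u * θ ^ (p - 1 - j) * (e * c') = -(1 + e * u) * (σ c - θ ^ (p - 1 - j) * c)) →
          R (j + 1) c') → R (p - 1) y := by
    intro c
    obtain ⟨y, h1, h2⟩ := hrec c (p - 1) (by omega)
    exact ⟨y, by rw [← h1]; simp, h2⟩
  choose P hP1 hP2 using hP
  refine ⟨AddMonoidHom.mk' P fun a b => hinj ?_, fun c => hinj ?_, fun b c hb => hinj ?_, hinj ?_,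
    fun R c => hP2 c R⟩
  · rw [map_add, hP1, hP1, hP1, ← dividedDifference_add, map_add, mul_add]
  · change f (σ (P c)) = f (P c)
    rw [← hτσ, hP1, map_dividedDifference_top τ w (by omega) hτ hδ]
  · change f (P (b * c)) = f (b * P c)
    rw [map_mul, hP1, hP1, map_mul, mul_left_comm,
      dividedDifference_fixed_mul τ w _ (by rw [hτσ, hb])]
  · change f (P 1) = f 1
    rw [hP1, map_one, mul_one]
    -- The normalizing factor w^(p-1) has as exponent the order of the difference; hence 1 is fixed.
    exact dividedDifference_pow_self τ w fun i h0 h1 => hδ i h0 (by omega)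

end Splitting

/-! ### Extensions of the invariants generated by one element. -/

section Monogenic

open Polynomial

variable {S : Type*} [CommRing S] [IsDomain S]

/-- Lagrange interpolation on the orbit of y. The divisibility keeps the divided differences with
nodes σ^j y inside S, and the top one gives invariant coefficients; in the resulting sum all
conjugates of g other than g itself drop out. -/
theorem exists_fixed_coefficients {p : ℕ} (hp : 1 < p) (σ : S →+* S) (hσ : σ ^ p = 1) {y : S}
    (hy0 : ∀ j, 0 < j → j < p → (σ ^ j) y - y ≠ 0)
    (hy : ∀ j, 0 < j → j < p → ∀ f, (σ ^ j) y - y ∣ σ f - f) (g : S) :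
    ∃ a : ℕ → S, (∀ i, σ (a i) = a i) ∧ g = ∑ i ∈ Finset.range p, a i * y ^ i := by
  obtain ⟨τ, hτ, hτσ⟩ := exists_extension_fractionRing (by omega : 0 < p) σ hσ
  have hτj := pow_apply_of_apply (algebraMap S (FractionRing S)) σ τ hτσ
  set f := algebraMap S (FractionRing S) with hf
  have hinj : Function.Injective f := IsFractionRing.injective S (FractionRing S)
  have hδ : ∀ j, 0 < j → j < p → IsUnit ((τ ^ j) (f y) - f y) := by
    intro j h0 h1
    rw [hτj, ← map_sub]
    exact isUnit_iff_ne_zero.mpr ((map_ne_zero_iff f hinj).mpr (hy0 j h0 h1))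
  have hL : ∀ (h : S) (j : ℕ), j < p → ∃ h' : S, f h' = dividedDifference τ (f y) j (f h) := by
    intro h j
    induction j with
    | zero => intro _; exact ⟨h, rfl⟩
    | succ j ih =>
      intro hj
      obtain ⟨h', hh'⟩ := ih (by omega)
      obtain ⟨d, hd⟩ := hy (j + 1) (by omega) hj h'
      refine ⟨d, (hδ (j + 1) (by omega) hj).mul_left_cancel ?_⟩
      rw [sub_mul_dividedDifference_succ τ _ (hδ (j + 1) (by omega) hj), ← hh', hτσ, hτj,
        ← map_sub, ← map_sub, ← map_mul, hd]
  -- The minimal polynomial of y without its factor X - y. Its value at y is inverse to the orbit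
  -- weight of index 0, and the coefficient of y^i is the top divided difference of c_i g.
  let c : S[X] := ∏ l ∈ Finset.range (p - 1), (X - Polynomial.C ((σ ^ (l + 1)) y))
  have hcdeg : c.natDegree < p := by
    rw [natDegree_prod_of_monic _ _ fun l _ => monic_X_sub_C _]
    simp only [natDegree_X_sub_C, Finset.sum_const, Finset.card_range, smul_eq_mul, mul_one]
    omega
  choose L hL using fun h => hL h (p - 1) (by omega)
  refine ⟨fun i => L (c.coeff i * g), fun i => hinj ?_, hinj ?_⟩
  · rw [← hτσ, hL, map_dividedDifference_top τ _ (by omega) hτ hδ]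
  · rw [map_sum]
    simp only [map_mul, hL, map_pow]
    simp only [dividedDifference_top_eq_sum τ _ (by omega : 0 < p) hδ, Finset.sum_mul]
    rw [Finset.sum_comm]
    have key : ∀ l, ∑ i ∈ Finset.range p, orbitWeight τ (f y) p l *
        (τ ^ l) (f (c.coeff i) * f g) * f y ^ i =
        orbitWeight τ (f y) p l * (τ ^ l) (f g) * f ((c.map (σ ^ l)).eval y) := by
      intro l
      rw [eval_eq_sum_range' (lt_of_le_of_lt natDegree_map_le hcdeg), map_sum, Finset.mul_sum]
      refine Finset.sum_congr rfl fun i _ => ?_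
      rw [map_mul, map_mul, coeff_map, hτj, map_pow]
      ring
    rw [Finset.sum_congr rfl fun l _ => key l, ← Nat.sub_add_cancel (by omega : 1 ≤ p),
      Finset.sum_range_succ', Nat.sub_add_cancel (by omega : 1 ≤ p), Finset.sum_eq_zero, zero_add]
    · have h1 : (c.map (σ ^ 0)).eval y = ∏ l ∈ Finset.range (p - 1), (y - (σ ^ (l + 1)) y) := by
        rw [pow_zero, RingHom.one_def, Polynomial.map_id, eval_prod]
        simp
      have h2 : orbitWeight τ (f y) p 0 * f ((c.map (σ ^ 0)).eval y) = 1 := by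
        rw [h1, orbitWeight, ← Nat.sub_add_cancel (by omega : 1 ≤ p), Finset.prod_range_succ',
          Nat.sub_add_cancel (by omega : 1 ≤ p), if_pos rfl, mul_one, map_prod,
          ← Finset.prod_mul_distrib]
        refine Finset.prod_eq_one fun l hl => ?_
        rw [Finset.mem_range] at hl
        rw [Nat.mod_eq_of_lt (by omega : l + 1 < p), Nat.zero_mod, if_neg (by omega), map_sub,
          ← hτj, pow_zero, RingHom.one_def, RingHom.id_apply]
        refine Ring.inverse_mul_cancel _ ?_
        rw [← neg_sub]
        exact (hδ (l + 1) (by omega) (by omega)).neg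
      rw [mul_right_comm, h2, one_mul]; rfl
    -- For a nontrivial power of σ, y is a root of the conjugate of c.
    · intro l hl
      rw [Finset.mem_range] at hl
      have : (c.map (σ ^ (l + 1))).eval y = 0 := by
        rw [Polynomial.map_prod, eval_prod]
        refine Finset.prod_eq_zero (i := p - 1 - (l + 1)) (Finset.mem_range.mpr (by omega)) ?_
        have : (σ ^ (l + 1)) ((σ ^ (p - 1 - (l + 1) + 1)) y) = y := by
          rw [← RingHom.comp_apply, ← RingHom.mul_def, ← pow_add,
            show l + 1 + (p - 1 - (l + 1) + 1) = p by omega, hσ]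
          rfl
        simp only [Polynomial.map_sub, map_X, map_C, this, eval_sub, eval_X, eval_C, sub_self]
      rw [this, map_zero, mul_zero]

variable {A : Type*} [CommRing A] [Algebra A S]

/-- Independence of the powers of y: a relation with invariant coefficients gives a polynomial of
degree below p with the p distinct roots σ^l y in a domain. They span by interpolation. -/
theorem free_and_adjoin_eq_top_of_dvd {p : ℕ} (hp : 1 < p) (σ : S →+* S) (hσ : σ ^ p = 1) {y : S}
    (hy0 : ∀ j, 0 < j → j < p → (σ ^ j) y - y ≠ 0)
    (hy : ∀ j, 0 < j → j < p → ∀ f, (σ ^ j) y - y ∣ σ f - f)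
    (hinj : Function.Injective (algebraMap A S)) (hfix : ∀ a, σ (algebraMap A S a) = algebraMap A S a)
    (hA : ∀ f, σ f = f → ∃ a, algebraMap A S a = f) :
    Module.Free A S ∧ Module.Finite A S ∧ Algebra.adjoin A {y} = ⊤ := by
  have hdist : Function.Injective fun l : Fin p => (σ ^ (l : ℕ)) y := by
    have key : ∀ i l : ℕ, i < l → l < p → (σ ^ i) y ≠ (σ ^ l) y := by
      intro i l hil hl h
      apply hy0 (l - i) (by omega) (by omega)
      have h3 : Function.Injective (σ ^ i) := by
        apply Function.LeftInverse.injective (g := (σ ^ (p - i) : S →+* S))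
        intro x
        rw [← RingHom.comp_apply, ← RingHom.mul_def, ← pow_add, Nat.sub_add_cancel (by omega), hσ]
        rfl
      apply h3
      rw [map_sub, map_zero, ← RingHom.comp_apply, ← RingHom.mul_def, ← pow_add,
        show i + (l - i) = l by omega, h, sub_self]
    intro i l h
    rcases lt_trichotomy (i : ℕ) l with h' | h' | h'
    · exact absurd h (key _ _ h' l.2)
    · exact Fin.ext h'
    · exact absurd h.symm (key _ _ h' i.2)
  have hli : LinearIndependent A fun i : Fin p => y ^ (i : ℕ) := by
    rw [Fintype.linearIndependent_iff]
    intro a ha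
    let F : S[X] := ∑ i : Fin p, Polynomial.C (algebraMap A S (a i)) * X ^ (i : ℕ)
    have hF : F = 0 := by
      apply eq_zero_of_natDegree_lt_card_of_eval_eq_zero F hdist
      · intro l
        have := congrArg (σ ^ (l : ℕ)) ha
        rw [map_zero] at this
        rw [eval_finsetSum, ← this, map_sum]
        refine Finset.sum_congr rfl fun i _ => ?_
        have h1 : ∀ (j : ℕ) b, (σ ^ j) (algebraMap A S b) = algebraMap A S b := by
          intro j b
          induction j with
          | zero => rfl
          | succ j ih => rw [ringHom_pow_succ_apply, ih, hfix]
        rw [Algebra.smul_def, map_mul, map_pow, h1, eval_mul, eval_C, eval_pow, eval_X]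
      · rw [Fintype.card_fin]
        refine (natDegree_sum_le_of_forall_le (n := p - 1) _ _ fun i _ => ?_).trans_lt (by omega)
        exact (natDegree_C_mul_X_pow_le _ _).trans (by omega)
    intro i
    have := congrArg (fun G => coeff G (i : ℕ)) hF
    simp only [F, finsetSum_coeff, coeff_C_mul_X_pow, coeff_zero] at this
    rw [Finset.sum_eq_single i (fun j _ hj => if_neg fun h => hj (Fin.ext h.symm)) (by simp),
      if_pos rfl] at this
    exact (map_eq_zero_iff _ hinj).mp this
  have hrep : ∀ g : S, ∃ a : Fin p → A, g = ∑ i, a i • y ^ (i : ℕ) := by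
    intro g
    obtain ⟨a, ha, hg⟩ := exists_fixed_coefficients hp σ hσ hy0 hy g
    choose b hb using fun i => hA (a i) (ha i)
    refine ⟨fun i => b i, ?_⟩
    rw [hg, ← Fin.sum_univ_eq_sum_range (fun i => a i * y ^ i)]
    exact Finset.sum_congr rfl fun i _ => by rw [Algebra.smul_def, hb]
  have hspan : ⊤ ≤ Submodule.span A (Set.range fun i : Fin p => y ^ (i : ℕ)) := by
    intro g _
    obtain ⟨a, rfl⟩ := hrep g
    exact Submodule.sum_mem _ fun i _ => Submodule.smul_mem _ _ (Submodule.subset_span ⟨i, rfl⟩)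
  let v := Module.Basis.mk hli hspan
  refine ⟨Module.Free.of_basis v, Module.Finite.of_basis v, eq_top_iff.mpr fun g _ => ?_⟩
  obtain ⟨a, rfl⟩ := hrep g
  exact Subalgebra.sum_mem _ fun i _ => Subalgebra.smul_mem _
    (Subalgebra.pow_mem _ (Algebra.self_mem_adjoin_singleton A y) _) _

end Monogenic

/-! ### Regular local rings: domains, coordinates, heights. -/

section RegularLocal

/-- Lifts of a spanning set of the cotangent space generate the maximal ideal. -/
theorem span_image_eq_maximalIdeal_of_span_eq_top {R : Type*} [CommRing R] [IsLocalRing R]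
    [IsNoetherianRing R] (g : CotangentSpace R → maximalIdeal R)
    (V : Set (CotangentSpace R)) (hg : ∀ v ∈ V, (maximalIdeal R).toCotangent (g v) = v)
    (hV : Submodule.span (ResidueField R) V = ⊤) :
    Ideal.span ((fun v => (g v : R)) '' V) = maximalIdeal R := by
  have h1 : (maximalIdeal R).toCotangent '' (g '' V) = V := by
    rw [← Set.image_comp]
    conv_rhs => rw [← Set.image_id V]
    exact Set.image_congr fun v hv => hg v hv
  have h2 := (CotangentSpace.span_image_eq_top_iff (s := g '' V)).mp (by rw [h1, hV])
  have h3 := congrArg (Submodule.map (maximalIdeal R).subtype) h2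
  rw [Submodule.map_span, ← Set.image_comp, Submodule.map_top, Submodule.range_subtype] at h3
  exact h3

theorem exists_finite_spanning_subset (K : Type*) {V : Type*} [Field K] [AddCommGroup V]
    [Module K V] [FiniteDimensional K V] (s : Set V) : ∃ b ⊆ s, b.Finite ∧
      Submodule.span K b = Submodule.span K s ∧
      b.ncard = Module.finrank K (Submodule.span K s) := by
  obtain ⟨b, hbs, hspan, hli⟩ := exists_linearIndependent K s
  have hfin : b.Finite := LinearIndependent.setFinite hli
  have := hfin.fintype
  have h1 := finrank_span_set_eq_card hli
  rw [hspan] at h1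
  exact ⟨b, hbs, hfin, hspan, by rw [Set.ncard_eq_toFinset_card', h1]⟩

theorem exists_finite_spanning_set_of_mem (K : Type*) {V : Type*} [Field K] [AddCommGroup V]
    [Module K V] [FiniteDimensional K V] {v : V} (hv : v ≠ 0) : ∃ b : Set V, v ∈ b ∧ b.Finite ∧
      Submodule.span K b = ⊤ ∧ b.ncard = Module.finrank K V := by
  obtain ⟨b, -, hvb, hspan, hli⟩ := exists_linearIndepOn_id_extension
    (LinearIndepOn.singleton (R := K) (v := id) hv) (Set.subset_univ _)
  have hspan' : Submodule.span K b = ⊤ := eq_top_iff.mpr fun w _ => hspan (Set.mem_univ w)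
  have hfin : b.Finite := LinearIndependent.setFinite hli
  have := hfin.fintype
  have h1 := finrank_span_set_eq_card hli
  rw [hspan', finrank_top] at h1
  exact ⟨b, hvb rfl, hfin, hspan', by rw [Set.ncard_eq_toFinset_card', h1]⟩

/-- Induction on the dimension. Prime avoidance gives x ∈ 𝔪 outside 𝔪² and all minimal primes; R/x
is regular of smaller dimension, hence a domain, so (x) is prime, and a minimal prime below it must
vanish. -/
theorem IsRegularLocalRing.isDomain_of_spanFinrank_eq (n : ℕ) : ∀ (R : Type u) [CommRing R]
    [IsRegularLocalRing R], (maximalIdeal R).spanFinrank = n → IsDomain R := by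
  induction n with
  | zero =>
    intro R _ _ h
    rw [Submodule.spanFinrank_eq_zero_iff_eq_bot (IsNoetherian.noetherian _)] at h
    exact (isField_iff_maximalIdeal_eq.mpr h).isDomain
  | succ n ih =>
    intro R _ _ h
    have hdim : ringKrullDim R = (n + 1 : ℕ) := by
      rw [← h, (isRegularLocalRing_iff R).mp inferInstance]
    obtain ⟨x, hxm, hx⟩ : ∃ x ∈ maximalIdeal R, x ∉ maximalIdeal R ^ 2 ∧
        ∀ 𝔭 ∈ minimalPrimes R, x ∉ 𝔭 := by
      by_contra hcon
      push Not at hcon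
      let s : Finset (Ideal R) := by
        classical exact insert (maximalIdeal R ^ 2) (minimalPrimes.finite_of_isNoetherianRing R).toFinset
      have hs : ∀ i, i ∈ s ↔ i = maximalIdeal R ^ 2 ∨ i ∈ minimalPrimes R := by
        intro i; simp [s]
      have hsub : (maximalIdeal R : Set R) ⊆ ⋃ i ∈ (s : Set (Ideal R)), (id i : Ideal R) := by
        intro x hx
        by_cases h2 : x ∈ maximalIdeal R ^ 2
        · exact Set.mem_biUnion (x := maximalIdeal R ^ 2) ((hs _).mpr (Or.inl rfl)) h2
        · obtain ⟨𝔭, h𝔭, hx𝔭⟩ := hcon x hx h2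
          exact Set.mem_biUnion (x := 𝔭) ((hs _).mpr (Or.inr h𝔭)) hx𝔭
      -- Prime avoidance allows two ideals that need not be prime; 𝔪² takes both places.
      obtain ⟨i, hi, hle⟩ := (Ideal.subset_union_prime (f := id) (maximalIdeal R ^ 2)
        (maximalIdeal R ^ 2) (fun i hi h1 _ =>
          (((hs i).mp hi).resolve_left h1).1.1)).mp hsub
      rcases (hs i).mp hi with rfl | hi
      · exact (IsLocalRing.maximalIdeal_sq_lt_of_ringKrullDim_ne_zero (R := R)
          (by rw [hdim]; exact_mod_cast Nat.succ_ne_zero n)).not_ge hle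
      · have hprime : i.IsPrime := hi.1.1
        have : i = maximalIdeal R := le_antisymm (le_maximalIdeal hprime.ne_top) hle
        have h0 := Ideal.height_eq_zero_iff.mpr hi
        rw [this] at h0
        have := maximalIdeal_height_eq_ringKrullDim (R := R)
        rw [h0, hdim] at this
        exact absurd this (by norm_cast)
    -- the quotient by `x` is regular
    have hx0 : (maximalIdeal R).toCotangent ⟨x, hxm⟩ ≠ 0 := by
      rw [Ne, Ideal.toCotangent_eq_zero]; exact hx.1
    obtain ⟨b, hxb', hbfin, hbspan, hbcard⟩ := exists_finite_spanning_set_of_mem (ResidueField R) hx0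
    rw [← spanFinrank_maximalIdeal_eq_finrank_cotangentSpace, h] at hbcard
    obtain ⟨g, hg⟩ : ∃ g : CotangentSpace R → maximalIdeal R,
        ∀ v, (maximalIdeal R).toCotangent (g v) = v :=
      ⟨_, Function.surjInv_eq (maximalIdeal R).toCotangent_surjective⟩
    classical
    -- The class of x is lifted to x itself, so that one of the n + 1 generators dies in the
    -- quotient.
    let v₀ := (maximalIdeal R).toCotangent ⟨x, hxm⟩
    let g' := Function.update g v₀ ⟨x, hxm⟩
    have hg' : ∀ v, (maximalIdeal R).toCotangent (g' v) = v := by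
      intro v
      by_cases hv : v = v₀
      · subst hv; simp [g', v₀]
      · simp [g', hv, hg]
    have hgen := span_image_eq_maximalIdeal_of_span_eq_top g' b (fun v _ => hg' v) hbspan
    have hloc : IsLocalRing (R ⧸ Ideal.span {x}) := by
      have : Nontrivial (R ⧸ Ideal.span {x}) :=
        Ideal.Quotient.nontrivial_iff.mpr (((Ideal.span_singleton_le_iff_mem _).mpr hxm).trans_lt
          (maximalIdeal.isMaximal R).ne_top.lt_top).ne
      exact IsLocalRing.of_surjective' (Ideal.Quotient.mk _) Ideal.Quotient.mk_surjective
    have hmap : maximalIdeal (R ⧸ Ideal.span {x}) =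
        Ideal.span ((fun v => Ideal.Quotient.mk (Ideal.span {x}) (g' v : R)) '' (b \ {v₀})) := by
      have h1 := map_maximalIdeal_of_surjective (Ideal.Quotient.mk (Ideal.span {x}))
        Ideal.Quotient.mk_surjective
      have h2 := congrArg (Ideal.map (Ideal.Quotient.mk (Ideal.span {x}))) hgen
      rw [Ideal.map_span, ← Set.image_comp] at h2
      rw [← h1, ← h2]
      apply le_antisymm
      · rw [Ideal.span_le]
        rintro _ ⟨v, hv, rfl⟩
        by_cases hv0 : v = v₀
        · have : (Ideal.Quotient.mk (Ideal.span {x})) (g' v : R) = 0 := by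
            rw [Ideal.Quotient.eq_zero_iff_mem, hv0]
            simp [g']
          change (Ideal.Quotient.mk (Ideal.span {x})) (g' v : R) ∈ _
          rw [this]
          exact Ideal.zero_mem _
        · exact Ideal.subset_span ⟨v, ⟨hv, hv0⟩, rfl⟩
      · exact Ideal.span_mono (Set.image_mono Set.sdiff_subset)
    have hle : (maximalIdeal (R ⧸ Ideal.span {x})).spanFinrank ≤ n := by
      rw [hmap]
      refine (Submodule.spanFinrank_span_le_ncard_of_finite (hbfin.sdiff.image _)).trans ?_
      refine (Set.ncard_image_le hbfin.sdiff).trans ?_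
      rw [Set.ncard_sdiff_singleton_of_mem hxb', hbcard]; rfl
    have hdim' : (n : WithBot ℕ∞) ≤ ringKrullDim (R ⧸ Ideal.span {x}) := by
      have := ringKrullDim_le_ringKrullDim_quotient_add_card {x} (by
        rw [Finset.coe_singleton, Set.singleton_subset_iff, IsLocalRing.ringJacobson_eq_maximalIdeal]
        exact hxm)
      rw [hdim, Finset.coe_singleton, Finset.card_singleton] at this
      have h2 : ((n + 1 : ℕ) : WithBot ℕ∞) = (n : WithBot ℕ∞) + 1 := by norm_cast
      rw [h2] at this
      generalize ringKrullDim (R ⧸ Ideal.span {x}) = d at this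
      induction d with
      | bot => exact absurd this (by simp)
      | coe d =>
        have h3 : ((n + 1 : ℕ∞) : WithBot ℕ∞) ≤ ((d + 1 : ℕ∞) : WithBot ℕ∞) := by
          exact_mod_cast this
        have h4 := WithBot.coe_le_coe.mp h3
        rw [ENat.add_le_add_iff_right (by simp)] at h4
        exact_mod_cast WithBot.coe_le_coe.mpr h4
    have hreg : IsRegularLocalRing (R ⧸ Ideal.span {x}) :=
      IsRegularLocalRing.of_spanFinrank_maximalIdeal_le _ (le_trans (by exact_mod_cast hle) hdim')
    have hdom := ih (R ⧸ Ideal.span {x}) (by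
      apply le_antisymm hle
      rw [← (isRegularLocalRing_iff _).mp hreg] at hdim'
      exact_mod_cast hdim')
    have hprime : (Ideal.span {x}).IsPrime := (Ideal.Quotient.isDomain_iff_prime _).mp hdom
    obtain ⟨𝔭, h𝔭, hle𝔭⟩ := Ideal.exists_minimalPrimes_le (bot_le (a := Ideal.span {x}))
    have hxp : x ∉ 𝔭 := hx.2 𝔭 h𝔭
    have h𝔭p : 𝔭.IsPrime := h𝔭.1.1
    -- From 𝔭 ⊆ (x) and x ∉ 𝔭 follows 𝔭 = x𝔭, and Nakayama applies.
    have h𝔭0 : 𝔭 = ⊥ := by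
      apply Submodule.eq_bot_of_le_smul_of_le_jacobson_bot (Ideal.span {x}) 𝔭
        (IsNoetherian.noetherian _)
      · intro y hy
        obtain ⟨z, rfl⟩ := Ideal.mem_span_singleton.mp (hle𝔭 hy)
        exact Ideal.mul_mem_mul (Ideal.mem_span_singleton_self x)
          ((h𝔭p.mem_or_mem hy).resolve_left hxp)
      · rw [IsLocalRing.jacobson_eq_maximalIdeal _ bot_ne_top]
        exact (Ideal.span_singleton_le_iff_mem _).mpr hxm
    rw [h𝔭0] at h𝔭p
    exact IsDomain.of_bot_isPrime R

theorem IsRegularLocalRing.isDomain (R : Type u) [CommRing R] [IsRegularLocalRing R] :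
    IsDomain R :=
  IsRegularLocalRing.isDomain_of_spanFinrank_eq _ R rfl

/-- A noetherian local ring of dimension at least `n` whose maximal ideal is generated by `n`
elements is regular, with these elements as coordinates. -/
theorem isRegularLocalRing_and_isCoordinates {R : Type*} [CommRing R] [IsLocalRing R]
    [IsNoetherianRing R] {n : ℕ} (t : Fin n → R) (ht : Ideal.span (Set.range t) = maximalIdeal R)
    (hn : (n : WithBot ℕ∞) ≤ ringKrullDim R) : IsRegularLocalRing R ∧ IsCoordinates R t := by
  have hle : (maximalIdeal R).spanFinrank ≤ n := by
    rw [← ht]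
    refine (Submodule.spanFinrank_span_le_ncard_of_finite (Set.finite_range t)).trans ?_
    rw [← Set.image_univ]
    refine (Set.ncard_image_le Set.finite_univ).trans ?_
    rw [Set.ncard_univ, Nat.card_fin]
  have hreg := IsRegularLocalRing.of_spanFinrank_maximalIdeal_le R
    (le_trans (by exact_mod_cast hle) hn)
  refine ⟨hreg, ?_⟩
  have hm : ∀ i, t i ∈ maximalIdeal R := fun i => by
    rw [← ht]; exact Ideal.subset_span ⟨i, rfl⟩
  have hfin : Module.finrank (ResidueField R) (CotangentSpace R) = n := by
    rw [← spanFinrank_maximalIdeal_eq_finrank_cotangentSpace]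
    apply le_antisymm hle
    rw [← (isRegularLocalRing_iff R).mp hreg] at hn
    exact_mod_cast hn
  let v : Fin n → CotangentSpace R := fun i => (maximalIdeal R).toCotangent ⟨t i, hm i⟩
  have hspan : Submodule.span (ResidueField R) (Set.range v) = ⊤ := by
    have : Set.range v = (maximalIdeal R).toCotangent '' Set.range fun i => ⟨t i, hm i⟩ := by
      rw [← Set.range_comp]; rfl
    rw [this, CotangentSpace.span_image_eq_top_iff]
    apply Submodule.map_injective_of_injective (maximalIdeal R).injective_subtype
    rw [Submodule.map_span, ← Set.range_comp, Submodule.map_top, Submodule.range_subtype]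
    exact ht
  exact ⟨hm, basisOfTopLeSpanOfCardEqFinrank v hspan.ge (by rw [hfin, Fintype.card_fin]),
    fun i => by rw [coe_basisOfTopLeSpanOfCardEqFinrank]⟩

theorem IsCoordinates.span_eq {R : Type*} [CommRing R] [IsLocalRing R]
    [IsNoetherianRing R] {n : ℕ} {t : Fin n → R} (h : IsCoordinates R t) :
    Ideal.span (Set.range t) = maximalIdeal R := by
  obtain ⟨hm, v, hv⟩ := h
  have h2 : Submodule.span R (Set.range fun i => (⟨t i, hm i⟩ : maximalIdeal R)) = ⊤ := by
    rw [← CotangentSpace.span_image_eq_top_iff, ← Set.range_comp]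
    convert v.span_eq using 2
    congr 1
    ext i
    simp [hv]
  have h3 := congrArg (Submodule.map (maximalIdeal R).subtype) h2
  rw [Submodule.map_span, ← Set.range_comp, Submodule.map_top, Submodule.range_subtype] at h3
  exact h3

theorem IsCoordinates.natCast_eq_ringKrullDim {R : Type*} [CommRing R] [IsRegularLocalRing R]
    {n : ℕ} {t : Fin n → R} (h : IsCoordinates R t) : (n : WithBot ℕ∞) = ringKrullDim R := by
  obtain ⟨hm, v, hv⟩ := h
  rw [← (IsRegularLocalRing.iff_finrank_cotangentSpace R).mp inferInstance,
    Module.finrank_eq_card_basis v, Fintype.card_fin]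

/-- By incomparability, strict chains of primes contract to strict chains. -/
theorem height_le_height_comap_of_isIntegral {A B : Type*} [CommRing A] [CommRing B] [Algebra A B]
    [Algebra.IsIntegral A B] (q : Ideal B) [hq : q.IsPrime] :
    q.height ≤ (q.comap (algebraMap A B)).height := by
  have hmono : StrictMono (PrimeSpectrum.comap (algebraMap A B)) := by
    intro I J hIJ
    have hIJ' : I.asIdeal < J.asIdeal := hIJ
    obtain ⟨x, hx⟩ := Set.exists_of_ssubset (show (I.asIdeal : Set B) ⊂ J.asIdeal from hIJ')
    exact Ideal.comap_lt_comap_of_integral_mem_sdiff hIJ'.le hx (Algebra.IsIntegral.isIntegral x)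
  have := Order.height_le_height_apply_of_strictMono _ hmono (⟨q, hq⟩ : PrimeSpectrum B)
  rwa [← PrimeSpectrum.height_eq_orderHeight, ← PrimeSpectrum.height_eq_orderHeight] at this

/-- Flat extensions satisfy going down, so the height upstairs is the height downstairs plus that in
the fibre. -/
theorem height_comap_le_height_of_flat {A B : Type*} [CommRing A] [CommRing B] [Algebra A B]
    [IsNoetherianRing A] [IsNoetherianRing B] [Module.Flat A B] (q : Ideal B) [hq : q.IsPrime] :
    (q.comap (algebraMap A B)).height ≤ q.height := by
  have : q.LiesOver (q.comap (algebraMap A B)) := ⟨rfl⟩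
  rw [Ideal.height_eq_height_add_of_liesOver_of_hasGoingDown (q.comap (algebraMap A B)) q]
  exact le_self_add

end RegularLocal

/-! ### Descent of regularity along flat maps with principal special fibre. -/

section FlatDescent

/-- Modulo an ideal `𝔞` with `𝔪 = 𝔞 + (π)`, every element of a noetherian local ring is a power of
`π` up to units. -/
theorem exists_sup_span_eq_sup_span_pow {S : Type*} [CommRing S] [IsLocalRing S]
    [IsNoetherianRing S] {𝔞 : Ideal S} {π : S} (hπ : π ∈ maximalIdeal S)
    (h : maximalIdeal S ≤ 𝔞 ⊔ Ideal.span {π}) {f : S} (hf : f ∉ 𝔞) :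
    ∃ m : ℕ, 𝔞 ⊔ Ideal.span {f} = 𝔞 ⊔ Ideal.span {π ^ m} := by
  -- Krull's intersection theorem in S/𝔞.
  have hex : ∃ k, f ∉ 𝔞 ⊔ Ideal.span {π ^ k} := by
    by_contra hcon
    push Not at hcon
    have h0 := Ideal.iInf_pow_smul_eq_bot_of_isLocalRing (M := S ⧸ 𝔞) (maximalIdeal S)
      (maximalIdeal.isMaximal S).ne_top
    apply hf
    rw [← Ideal.Quotient.eq_zero_iff_mem, ← Submodule.mem_bot S, ← h0, Submodule.mem_iInf]
    intro k
    obtain ⟨a, ha, b, hb, hab⟩ := Submodule.mem_sup.mp (hcon k)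
    obtain ⟨z, rfl⟩ := Ideal.mem_span_singleton.mp hb
    have : Ideal.Quotient.mk 𝔞 f = (π ^ k * z) • (1 : S ⧸ 𝔞) := by
      rw [← hab, map_add, Ideal.Quotient.eq_zero_iff_mem.mpr ha, zero_add, Algebra.smul_def, mul_one]
      rfl
    rw [this]
    exact Submodule.smul_mem_smul (Ideal.mul_mem_right _ _ (Ideal.pow_mem_pow hπ k)) trivial
  classical
  obtain ⟨m, hm⟩ := Nat.exists_eq_succ_of_ne_zero (n := Nat.find hex) (by
    intro h0
    have := Nat.find_spec hex
    rw [h0, pow_zero, Ideal.span_singleton_one, sup_top_eq] at this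
    exact this trivial)
  have h1 : f ∉ 𝔞 ⊔ Ideal.span {π ^ (m + 1)} := by
    have := Nat.find_spec hex
    rwa [hm] at this
  have h2 : f ∈ 𝔞 ⊔ Ideal.span {π ^ m} := by
    by_contra hcon
    have := Nat.find_min' hex hcon
    omega
  obtain ⟨a, ha, b, hb, hab⟩ := Submodule.mem_sup.mp h2
  obtain ⟨z, rfl⟩ := Ideal.mem_span_singleton.mp hb
  -- m is the last exponent with f ∈ 𝔞 + (π^m). A cofactor z in 𝔪 ⊆ 𝔞 + (π) would allow one more
  -- factor π.
  have hz : IsUnit z := by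
    by_contra hz
    apply h1
    obtain ⟨a', ha', b', hb', hab'⟩ := Submodule.mem_sup.mp (h ((mem_maximalIdeal z).mpr hz))
    obtain ⟨z', rfl⟩ := Ideal.mem_span_singleton.mp hb'
    rw [← hab, ← hab', show a + π ^ m * (a' + π * z') = (a + π ^ m * a') + π ^ (m + 1) * z' by ring]
    exact Submodule.add_mem_sup (add_mem ha (Ideal.mul_mem_left _ _ ha'))
      (Ideal.mul_mem_right _ _ (Ideal.mem_span_singleton_self _))
  refine ⟨m, le_antisymm ?_ ?_⟩
  · exact sup_le le_sup_left ((Ideal.span_singleton_le_iff_mem _).mpr h2)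
  · refine sup_le le_sup_left ((Ideal.span_singleton_le_iff_mem _).mpr ?_)
    obtain ⟨z', hz'⟩ := hz.exists_right_inv
    rw [show π ^ m = -(a * z') + f * z' by
      rw [← hab]; linear_combination (-π ^ m) * hz']
    exact Submodule.add_mem_sup (neg_mem (Ideal.mul_mem_right _ _ ha))
      (Ideal.mul_mem_right _ _ (Ideal.mem_span_singleton_self _))

/-- Descent of regularity along a flat local homomorphism with principal special fibre. -/
theorem IsRegularLocalRing.of_flat_of_le_map_sup_span {A S : Type*} [CommRing A] [CommRing S]
    [Algebra A S] [IsLocalRing A] [IsNoetherianRing A] [IsRegularLocalRing S] [Module.Flat A S]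
    [IsLocalHom (algebraMap A S)] {π : S} (hπ : π ∈ maximalIdeal S)
    (h : maximalIdeal S ≤ (maximalIdeal A).map (algebraMap A S) ⊔ Ideal.span {π})
    (hdim : ringKrullDim S ≤ ringKrullDim A) : IsRegularLocalRing A := by
  have hff : Module.FaithfullyFlat A S := Module.FaithfullyFlat.of_flat_of_isLocalHom
  set f := algebraMap A S with hf
  have hmem : ∀ a ∈ maximalIdeal A, f a ∈ maximalIdeal S := fun a ha => by
    rw [mem_maximalIdeal] at ha ⊢
    exact (map_mem_nonunits_iff f a).mpr ha
  have hmap : (maximalIdeal A).map f ≤ maximalIdeal S := Ideal.map_le_iff_le_comap.mpr hmem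
  have hd : (maximalIdeal S).spanFinrank = Module.finrank (ResidueField S) (CotangentSpace S) :=
    spanFinrank_maximalIdeal_eq_finrank_cotangentSpace S
  set d := (maximalIdeal S).spanFinrank with hd'
  -- it suffices to find few generators of the extended maximal ideal
  have main : ∀ T : Set A, T.Finite → T.ncard ≤ d → T ⊆ maximalIdeal A →
      (maximalIdeal A).map f ≤ Ideal.span (f '' T) → IsRegularLocalRing A := by
    intro T hT hTd hTm hle
    have hgen : maximalIdeal A = Ideal.span T := by
      apply le_antisymm _ (Ideal.span_le.mpr hTm)
      rw [← Ideal.map_span] at hle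
      have := Ideal.comap_mono (f := f) hle
      rwa [Ideal.comap_map_eq_self_of_faithfullyFlat,
        Ideal.comap_map_eq_self_of_faithfullyFlat] at this
    apply IsRegularLocalRing.of_spanFinrank_maximalIdeal_le
    refine le_trans ?_ hdim
    rw [← (isRegularLocalRing_iff S).mp inferInstance]
    have : (maximalIdeal A).spanFinrank ≤ d := by
      rw [hgen]
      exact (Submodule.spanFinrank_span_le_ncard_of_finite hT).trans hTd
    exact_mod_cast this
  -- The image of 𝔪_A in the cotangent space of S. The elements of T are lifts to 𝔪_A of a basis of
  -- its span.
  let W : Set (CotangentSpace S) :=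
    Set.range fun a : maximalIdeal A => (maximalIdeal S).toCotangent ⟨f a, hmem a a.2⟩
  obtain ⟨b, hbW, hbfin, hbspan, hbcard⟩ := exists_finite_spanning_subset (ResidueField S) W
  have hlift : ∀ v ∈ b, ∃ a : maximalIdeal A,
      (maximalIdeal S).toCotangent ⟨f a, hmem a a.2⟩ = v := fun v hv => hbW hv
  choose! g hg using hlift
  let T : Set A := (fun v => (g v : A)) '' b
  have hTfin : T.Finite := hbfin.image _
  have hTm : T ⊆ maximalIdeal A := by
    rintro _ ⟨v, -, rfl⟩; exact (g v).2
  have hTcard : T.ncard ≤ b.ncard := Set.ncard_image_le hbfin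
  have hbd : b.ncard ≤ d := by rw [hbcard, hd]; exact Submodule.finrank_le _
  by_cases hW : Submodule.span (ResidueField S) W = ⊤
  · refine main T hTfin (hTcard.trans hbd) hTm (hmap.trans ?_)
    have := span_image_eq_maximalIdeal_of_span_eq_top
      (fun v => ⟨f (g v), hmem _ (g v).2⟩) b hg (hbspan.trans hW)
    rw [← this, ← Set.image_comp]
    rfl
  -- If the image does not span, there is room for one more generator. Modulo 𝔞 = T·S the maximal
  -- ideal of S is generated by π, so the nonzero principal ideals there are powers of (π).
  · have hlt : b.ncard + 1 ≤ d := by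
      rw [hbcard, hd]; exact Submodule.finrank_lt hW
    set 𝔞 := Ideal.span (f '' T) with h𝔞
    have h𝔞m : 𝔞 ≤ (maximalIdeal A).map f := by
      rw [h𝔞, ← Ideal.map_span]; exact Ideal.map_mono (Ideal.span_le.mpr hTm)
    have hsup : maximalIdeal S ≤ 𝔞 ⊔ Ideal.span {π} := by
      refine Submodule.le_of_le_smul_of_le_jacobson_bot (I := maximalIdeal S)
        (IsNoetherian.noetherian _) (IsLocalRing.maximalIdeal_le_jacobson _) ?_
      refine h.trans (sup_le ?_ (le_sup_right.trans le_sup_left))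
      rw [Ideal.map_le_iff_le_comap]
      intro a ha
      rw [Ideal.mem_comap]
      have h1 : (maximalIdeal S).toCotangent ⟨f a, hmem a ha⟩ ∈
          Submodule.span (ResidueField S) b := by
        rw [hbspan]; exact Submodule.subset_span ⟨⟨a, ha⟩, rfl⟩
      have h2 : ∀ v ∈ Submodule.span (ResidueField S) b,
          ∃ y : maximalIdeal S, (y : S) ∈ 𝔞 ∧ (maximalIdeal S).toCotangent y = v := by
        intro v hv
        induction hv using Submodule.span_induction with
        | mem v hv =>
          exact ⟨⟨f (g v), hmem _ (g v).2⟩, Ideal.subset_span ⟨g v, ⟨v, hv, rfl⟩, rfl⟩, hg v hv⟩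
        | zero => exact ⟨0, Ideal.zero_mem _, map_zero _⟩
        | add v w _ _ hv hw =>
          obtain ⟨y, hy, rfl⟩ := hv
          obtain ⟨z, hz, rfl⟩ := hw
          exact ⟨y + z, add_mem hy hz, map_add _ _ _⟩
        | smul c v _ hv =>
          obtain ⟨y, hy, rfl⟩ := hv
          obtain ⟨r, rfl⟩ := IsLocalRing.residue_surjective c
          exact ⟨r • y, Ideal.mul_mem_left _ _ hy, map_smul _ _ _⟩
      obtain ⟨y, hy, hyv⟩ := h2 _ h1
      rw [Ideal.toCotangent_eq] at hyv
      rw [← sub_sub_cancel (y : S) (f a)]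
      refine sub_mem (Ideal.mem_sup_left (Ideal.mem_sup_left hy)) (Ideal.mem_sup_right ?_)
      rw [smul_eq_mul, ← pow_two]
      exact hyv
    by_cases hle : (maximalIdeal A).map f ≤ 𝔞
    · exact main T hTfin (hTcard.trans hbd) hTm hle
    · have hex : ∃ m, ∃ a ∈ maximalIdeal A, f a ∉ 𝔞 ∧
          𝔞 ⊔ Ideal.span {f a} = 𝔞 ⊔ Ideal.span {π ^ m} := by
        by_contra hcon
        push Not at hcon
        apply hle
        rw [Ideal.map_le_iff_le_comap]
        intro a ha
        by_contra hfa
        obtain ⟨m, hm⟩ := exists_sup_span_eq_sup_span_pow hπ hsup hfa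
        exact hcon m a ha hfa hm
      classical
      -- An element a ∈ 𝔪_A whose image modulo 𝔞 has the least exponent of π: with T it generates
      -- the extension of 𝔪_A.
      obtain ⟨a, ha, -, hae⟩ := Nat.find_spec hex
      refine main (insert a T) (hTfin.insert a) ?_ (Set.insert_subset ha hTm) ?_
      · exact (Set.ncard_insert_le _ _).trans (by omega)
      · rw [Set.image_insert_eq, Ideal.span_insert, ← h𝔞, sup_comm, hae, Ideal.map_le_iff_le_comap]
        intro a' ha'
        rw [Ideal.mem_comap]
        by_cases hfa' : f a' ∈ 𝔞
        · exact Ideal.mem_sup_left hfa'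
        · obtain ⟨m, hm⟩ := exists_sup_span_eq_sup_span_pow hπ hsup hfa'
          have hmin := Nat.find_min' hex ⟨a', ha', hfa', hm⟩
          have h3 : f a' ∈ 𝔞 ⊔ Ideal.span {π ^ m} := by
            rw [← hm]; exact Ideal.mem_sup_right (Ideal.mem_span_singleton_self _)
          refine sup_le_sup_left ?_ 𝔞 h3
          rw [Ideal.span_singleton_le_span_singleton]
          exact pow_dvd_pow π hmin

end FlatDescent

/-! ### Descent of regularity along monogenic extensions. -/

section MonogenicDescent

theorem isNoetherianRing_of_faithfullyFlat (A S : Type*) [CommRing A] [CommRing S] [Algebra A S]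
    [IsNoetherianRing S] [Module.FaithfullyFlat A S] : IsNoetherianRing A := by
  rw [isNoetherianRing_iff, isNoetherian_iff']
  have hmono : StrictMono (Ideal.map (algebraMap A S)) := by
    apply Monotone.strictMono_of_injective
    · exact fun I J h => Ideal.map_mono h
    · intro I J h
      have := congrArg (Ideal.comap (algebraMap A S)) h
      rwa [Ideal.comap_map_eq_self_of_faithfullyFlat,
        Ideal.comap_map_eq_self_of_faithfullyFlat] at this
  exact hmono.wellFoundedGT

/-- Regularity descends along finite faithfully flat extensions generated by one element. -/
theorem isRegularRing_of_adjoin_singleton_eq_top {A S : Type*} [CommRing A] [CommRing S]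
    [Algebra A S] [IsRegularRing S] [Module.FaithfullyFlat A S] [Module.Finite A S] {y : S}
    (hy : Algebra.adjoin A {y} = ⊤) : IsRegularRing A := by
  have := isNoetherianRing_of_faithfullyFlat A S
  rw [isRegularRing_iff]
  intro 𝔮 h𝔮
  obtain ⟨⟨Q, hQ⟩, hQ𝔮⟩ := PrimeSpectrum.comap_surjective_of_faithfullyFlat (A := A) (B := S) ⟨𝔮, h𝔮⟩
  have hover : Q.LiesOver 𝔮 := ⟨(congrArg PrimeSpectrum.asIdeal hQ𝔮).symm⟩
  let := Localization.AtPrime.algebraOfLiesOver 𝔮 Q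
  let A' := Localization.AtPrime 𝔮
  let S' := Localization.AtPrime Q
  have hloc : IsLocalHom (algebraMap A' S') := by
    rw [RingHom.algebraMap_toAlgebra]
    exact Localization.isLocalHom_localRingHom 𝔮 Q (algebraMap A S) Ideal.LiesOver.over
  have hmapA : ∀ a : A, algebraMap A' S' (algebraMap A A' a) = algebraMap S S' (algebraMap A S a) := by
    intro a
    rw [← IsScalarTower.algebraMap_apply A A' S', ← IsScalarTower.algebraMap_apply A S S']
  have hflat : Module.Flat A' S' := inferInstance
  let ev : Polynomial A' →+* S' := Polynomial.eval₂RingHom (algebraMap A' S') (algebraMap S S' y)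
  -- Primes of a polynomial ring over a maximal ideal need only one further generator; its value at
  -- y generates the maximal ideal of S' modulo that of A'.
  let 𝔓 : Ideal (Polynomial A') := (maximalIdeal S').comap ev
  have h𝔓 : 𝔓.comap Polynomial.C = maximalIdeal A' := by
    ext a
    rw [Ideal.mem_comap, Ideal.mem_comap]
    have : ev (Polynomial.C a) = algebraMap A' S' a := Polynomial.eval₂_C _ _
    rw [this, mem_maximalIdeal, mem_maximalIdeal, map_mem_nonunits_iff]
  obtain ⟨g, hg⟩ : ∃ g, 𝔓 = (maximalIdeal A').map Polynomial.C ⊔ Ideal.span {g} := by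
    by_cases hne : 𝔓 = (𝔓.comap Polynomial.C).map Polynomial.C
    · exact ⟨0, by rw [Ideal.span_singleton_zero, sup_bot_eq]; rw [← h𝔓]; exact hne⟩
    · obtain ⟨g, -, hg⟩ := Polynomial.exists_monic_span_sup_map_eq A' 𝔓
        (by rw [h𝔓]; exact maximalIdeal.isMaximal A') hne
      exact ⟨g, by rw [← h𝔓]; exact hg⟩
  have hgen : ∀ f : S, ∃ F : Polynomial A', ev F = algebraMap S S' f := by
    intro f
    have hf : f ∈ Algebra.adjoin A {y} := by rw [hy]; trivial
    rw [Algebra.adjoin_singleton_eq_range_aeval] at hf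
    obtain ⟨F, rfl⟩ := hf
    refine ⟨F.map (algebraMap A A'), ?_⟩
    change Polynomial.eval₂ _ _ _ = _
    rw [Polynomial.eval₂_map]
    change _ = (algebraMap S S') (Polynomial.aeval y F)
    rw [Polynomial.aeval_def, Polynomial.hom_eval₂]
    congr 1
    ext a
    exact hmapA a
  have hgm : ev g ∈ maximalIdeal S' := by
    have : g ∈ 𝔓 := by rw [hg]; exact Ideal.mem_sup_right (Ideal.mem_span_singleton_self g)
    exact this
  refine IsRegularLocalRing.of_flat_of_le_map_sup_span (S := S') hgm ?_ ?_
  · rw [← Localization.AtPrime.map_eq_maximalIdeal, Ideal.map_le_iff_le_comap]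
    intro f hf
    rw [Ideal.mem_comap]
    obtain ⟨F, hF⟩ := hgen f
    have hF𝔓 : F ∈ 𝔓 := by
      rw [Ideal.mem_comap, hF, mem_maximalIdeal, mem_nonunits_iff,
        IsLocalization.AtPrime.isUnit_to_map_iff S' Q f]
      exact not_not.mpr hf
    have h1 : Ideal.map ev 𝔓 ≤ (maximalIdeal A').map (algebraMap A' S') ⊔ Ideal.span {ev g} := by
      rw [hg, Ideal.map_sup, Ideal.map_map, Ideal.map_span, Set.image_singleton]
      have : ev.comp Polynomial.C = algebraMap A' S' := by
        ext a; exact Polynomial.eval₂_C _ _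
      rw [this]
    rw [← hF]
    exact h1 (Ideal.mem_map_of_mem ev hF𝔓)
  · rw [IsLocalization.AtPrime.ringKrullDim_eq_height Q S',
      IsLocalization.AtPrime.ringKrullDim_eq_height 𝔮 A']
    have := height_le_height_comap_of_isIntegral (A := A) Q
    have h2 : Q.comap (algebraMap A S) = 𝔮 := hover.over.symm
    rw [h2] at this
    exact WithBot.coe_le_coe.mpr this

theorem isRegularRing_of_dvd {A S : Type*} [CommRing A] [CommRing S] [Algebra A S] [IsDomain S]
    [IsRegularRing S] {p : ℕ} (hp : 1 < p) (σ : S →+* S) (hσ : σ ^ p = 1) {y : S}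
    (hy0 : ∀ j, 0 < j → j < p → (σ ^ j) y - y ≠ 0)
    (hy : ∀ j, 0 < j → j < p → ∀ f, (σ ^ j) y - y ∣ σ f - f)
    (hinj : Function.Injective (algebraMap A S)) (hfix : ∀ a, σ (algebraMap A S a) = algebraMap A S a)
    (hA : ∀ f, σ f = f → ∃ a, algebraMap A S a = f) : IsRegularRing A := by
  obtain ⟨h1, h2, h3⟩ := free_and_adjoin_eq_top_of_dvd hp σ hσ hy0 hy hinj hfix hA
  have : Nontrivial A := (algebraMap A S).domain_nontrivial
  exact isRegularRing_of_adjoin_singleton_eq_top h3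

end MonogenicDescent

/-! ### The action on the local ring and on its cotangent space. -/

section LocalAction

variable {R : Type*} [CommRing R] [IsLocalRing R] {p : ℕ} (σ : R →+* R)

theorem prime_mem_maximalIdeal [CharP (ResidueField R) p] : (p : R) ∈ maximalIdeal R := by
  rw [← residue_eq_zero_iff, map_natCast, CharP.cast_eq_zero]

/-- Over a perfect residue field, the augmentation ideal is generated by `I(x)` for `x` in a
generating set of the maximal ideal. -/
theorem dvd_sub_of_dvd_generators [IsNoetherianRing R] (hp : p.Prime) [CharP (ResidueField R) p]
    [PerfectField (ResidueField R)] (hres : ∀ f, σ f - f ∈ maximalIdeal R) {n : ℕ} {x : Fin n → R}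
    (hx : Ideal.span (Set.range x) = maximalIdeal R) {e : R} (hxe : ∀ i, e ∣ σ (x i) - x i) (f : R) :
    e ∣ σ f - f := by
  have : Fact p.Prime := ⟨hp⟩
  have : PerfectRing (ResidueField R) p := PerfectField.toPerfectRing p
  let J : Ideal R := Ideal.span (Set.range fun f => σ f - f)
  have hJ : ∀ f, σ f - f ∈ J := fun f => Ideal.subset_span ⟨f, rfl⟩
  have hle : J ≤ Ideal.span {e} ⊔ maximalIdeal R • J := by
    rw [Ideal.span_le]
    rintro _ ⟨f, rfl⟩
    -- Perfectness: f is a p-th power g^p up to an element of the maximal ideal.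
    obtain ⟨g₀, hg₀⟩ := surjective_frobenius (ResidueField R) p (residue R f)
    obtain ⟨g, rfl⟩ := residue_surjective g₀
    have hr : f - g ^ p ∈ maximalIdeal R := by
      rw [← residue_eq_zero_iff, map_sub, map_pow, ← hg₀, frobenius_def, sub_self]
    have hm : ∀ r ∈ maximalIdeal R, σ r - r ∈ Ideal.span {e} ⊔ maximalIdeal R • J := by
      intro r hr
      rw [← hx] at hr
      induction hr using Submodule.span_induction with
      | mem r hr =>
        obtain ⟨i, rfl⟩ := hr
        exact Ideal.mem_sup_left (Ideal.mem_span_singleton.mpr (hxe i))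
      | zero => simp
      | add r r' _ _ h h' =>
        rw [map_add, add_sub_add_comm]; exact add_mem h h'
      | smul a r hr h =>
        change σ (a * r) - a * r ∈ _
        rw [map_mul, show σ a * σ r - a * r = (σ a - a) * r + σ a * (σ r - r) by ring]
        refine add_mem (Ideal.mem_sup_right ?_) (Ideal.mul_mem_left _ _ h)
        rw [mul_comm]
        exact Ideal.mul_mem_mul (by rw [← hx]; exact hr) (hJ a)
    -- Expanding (g + I(g))^p, both I(g)^p and the terms with factor p are I(g) times an element of
    -- 𝔪.
    have hgp : σ (g ^ p) - g ^ p ∈ maximalIdeal R • J := by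
      obtain ⟨t, ht⟩ := exists_add_pow_prime_eq hp g (σ g - g)
      rw [add_sub_cancel] at ht
      obtain ⟨k, hk⟩ := Nat.exists_eq_add_of_le' hp.two_le
      rw [map_pow, ht, show g ^ p + (σ g - g) ^ p + p * g * (σ g - g) * t - g ^ p =
        (σ g - g) ^ p + (p * g * t) * (σ g - g) by ring]
      refine add_mem ?_ ?_
      · rw [hk, show k + 2 = (k + 1) + 1 by rfl, pow_succ]
        exact Ideal.mul_mem_mul (Ideal.pow_mem_of_mem _ (hres g) _ (by omega)) (hJ g)
      · exact Ideal.mul_mem_mul (Ideal.mul_mem_right _ _ (Ideal.mul_mem_right _ _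
          prime_mem_maximalIdeal)) (hJ g)
    have : σ f - f = (σ (g ^ p) - g ^ p) + (σ (f - g ^ p) - (f - g ^ p)) := by
      rw [map_sub]; ring
    change σ f - f ∈ _
    rw [this]
    exact add_mem (Ideal.mem_sup_right hgp) (hm _ hr)
  have := Submodule.le_of_le_smul_of_le_jacobson_bot (IsNoetherian.noetherian J)
    (IsLocalRing.maximalIdeal_le_jacobson _) hle (hJ f)
  exact Ideal.mem_span_singleton.mp this

/-- If moreover `I(x) ∈ e 𝔪` for the generators, then `I(R) ⊆ e 𝔪`. -/
theorem exists_mem_sub_eq_mul [IsDomain R] (hp : p.Prime)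
    [CharP (ResidueField R) p] [PerfectField (ResidueField R)] {n : ℕ} {x : Fin n → R}
    (hx : Ideal.span (Set.range x) = maximalIdeal R) {e : R} (he : e ∈ maximalIdeal R)
    (hdvd : ∀ f, e ∣ σ f - f)
    (hxe : ∀ i, ∃ z ∈ maximalIdeal R, σ (x i) - x i = e * z) (f : R) :
    ∃ z ∈ maximalIdeal R, σ f - f = e * z := by
  have : Fact p.Prime := ⟨hp⟩
  have : PerfectRing (ResidueField R) p := PerfectField.toPerfectRing p
  obtain ⟨g₀, hg₀⟩ := surjective_frobenius (ResidueField R) p (residue R f)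
  obtain ⟨g, rfl⟩ := residue_surjective g₀
  have hr : f - g ^ p ∈ maximalIdeal R := by
    rw [← residue_eq_zero_iff, map_sub, map_pow, ← hg₀, frobenius_def, sub_self]
  have hm : ∀ r ∈ maximalIdeal R, ∃ z ∈ maximalIdeal R, σ r - r = e * z := by
    intro r hr
    rw [← hx] at hr
    induction hr using Submodule.span_induction with
    | mem r hr =>
      obtain ⟨i, rfl⟩ := hr
      exact hxe i
    | zero => exact ⟨0, Ideal.zero_mem _, by simp⟩
    | add r r' _ _ h h' =>
      obtain ⟨z, hz, h⟩ := h
      obtain ⟨z', hz', h'⟩ := h'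
      exact ⟨z + z', add_mem hz hz', by rw [map_add, mul_add, ← h, ← h']; ring⟩
    | smul a r hr h =>
      obtain ⟨z, hz, h⟩ := h
      obtain ⟨y, hy⟩ := hdvd a
      refine ⟨y * r + σ a * z, add_mem (Ideal.mul_mem_left _ _ (by rw [← hx]; exact hr))
        (Ideal.mul_mem_left _ _ hz), ?_⟩
      rw [smul_eq_mul, map_mul]
      linear_combination hy * r + σ a * h
  obtain ⟨z, hz, hz'⟩ := hm _ hr
  obtain ⟨t, ht⟩ := exists_add_pow_prime_eq hp g (σ g - g)
  rw [add_sub_cancel] at ht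
  obtain ⟨y, hy⟩ := hdvd g
  obtain ⟨k, hk⟩ := Nat.exists_eq_add_of_le' hp.two_le
  -- With I(g) = e y, the quotient I(g^p)/e is e^(p-1) y^p + p g y t, which lies in 𝔪 because e and
  -- p do and p - 1 = k + 1 is positive.
  refine ⟨z + (e ^ (k + 1) * y ^ p + p * (g * y * t)), add_mem hz (add_mem (Ideal.mul_mem_right _ _
    (Ideal.pow_mem_of_mem _ he _ (by omega))) (Ideal.mul_mem_right _ _ prime_mem_maximalIdeal)), ?_⟩
  have h1 : e * (e ^ (k + 1) * y ^ p) = (σ g - g) ^ p := by rw [hy, mul_pow, hk]; ring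
  rw [map_sub, map_pow] at hz'
  linear_combination hz' + ht - h1 + (p * g * t) * hy

/-- A factor `θ` with `σ e = θ e` is congruent to `1`. -/
theorem exists_map_eq_mul_one_add [IsDomain R] (hp : p.Prime) [CharP (ResidueField R) p]
    (hσ : σ ^ p = 1) (hres : ∀ f, σ f - f ∈ maximalIdeal R) {e : R} (he0 : e ≠ 0)
    (hdvd : e ∣ σ e - e) : ∃ ε ∈ maximalIdeal R, σ e = e * (1 + ε) := by
  have : Fact p.Prime := ⟨hp⟩
  obtain ⟨ε, hε⟩ := hdvd
  have hθ : σ e = e * (1 + ε) := by linear_combination hε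
  refine ⟨ε, ?_, hθ⟩
  -- As σ is trivial modulo 𝔪, the iterates of e behave like powers of 1 + ε. For j = p this gives
  -- (1 + ε)^p ≡ 1, that is, ε^p ≡ 0 in characteristic p.
  have key : ∀ j : ℕ, ∃ z ∈ maximalIdeal R, (σ ^ j) e = e * ((1 + ε) ^ j + z) := by
    intro j
    induction j with
    | zero => exact ⟨0, Ideal.zero_mem _, by simp⟩
    | succ j ih =>
      obtain ⟨z, hz, h⟩ := ih
      refine ⟨(1 + ε) * (σ ((1 + ε) ^ j + z) - (1 + ε) ^ j), Ideal.mul_mem_left _ _ ?_, ?_⟩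
      · rw [show σ ((1 + ε) ^ j + z) - (1 + ε) ^ j =
          (σ ((1 + ε) ^ j + z) - ((1 + ε) ^ j + z)) + z by ring]
        exact add_mem (hres _) hz
      · rw [ringHom_pow_succ_apply, h, map_mul, hθ]; ring
  obtain ⟨z, hz, h⟩ := key p
  rw [hσ] at h
  have h1 : (1 + ε) ^ p + z = 1 := by
    apply mul_left_cancel₀ he0
    rw [← h, mul_one]; rfl
  rw [← residue_eq_zero_iff] at hz ⊢
  have h2 := congrArg (residue R) h1
  rw [map_add, map_pow, hz, add_zero, map_add, map_one, add_pow_char, one_pow] at h2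
  exact pow_eq_zero_iff hp.ne_zero |>.mp (by linear_combination h2)

/-- The difference telescopes into the sum of σ^i(c) for i < j, and each summand is c times a unit
congruent to 1. Hence it is c times a unit as long as p does not divide j. -/
theorem exists_pow_sub_eq {c y : R} (hres : ∀ f, σ f - f ∈ maximalIdeal R)
    (hc : ∃ ε ∈ maximalIdeal R, σ c = c * (1 + ε)) (hy : σ y - y = c) (j : ℕ) :
    ∃ z ∈ maximalIdeal R, (σ ^ j) y - y = c * (j + z) := by
  obtain ⟨ε, hε, hc⟩ := hc
  induction j with
  | zero => exact ⟨0, Ideal.zero_mem _, by simp⟩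
  | succ j ih =>
    obtain ⟨z, hz, h⟩ := ih
    refine ⟨σ z + ε * (j + σ z), add_mem ?_ (Ideal.mul_mem_right _ _ hε), ?_⟩
    · rw [← sub_add_cancel (σ z) z]; exact add_mem (hres z) hz
    · have h' := congrArg σ h
      rw [map_sub, map_mul, map_add, map_natCast, ← ringHom_pow_succ_apply] at h'
      rw [Nat.cast_succ]
      linear_combination h' + hy + (j + σ z) * hc

theorem isUnit_natCast_add [CharP (ResidueField R) p] {j : ℕ} (h0 : 0 < j) (hj : j < p) {z : R}
    (hz : z ∈ maximalIdeal R) : IsUnit ((j : R) + z) := by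
  by_contra h
  rw [← mem_nonunits_iff, ← mem_maximalIdeal, ← residue_eq_zero_iff, map_add, map_natCast,
    residue_eq_zero_iff _ |>.mpr hz, add_zero, CharP.cast_eq_zero_iff _ p] at h
  exact absurd (Nat.le_of_dvd h0 h) (by omega)

theorem exists_isUnit_map_eq_mul {u : R} (hu : IsUnit u) (hres : ∀ f, σ f - f ∈ maximalIdeal R) :
    ∃ ε ∈ maximalIdeal R, σ u = u * (1 + ε) := by
  obtain ⟨v, hv⟩ := hu.exists_right_inv
  exact ⟨v * (σ u - u), Ideal.mul_mem_left _ _ (hres u), by linear_combination (-σ u + u) * hv⟩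

theorem exists_map_mul_eq {a b : R} (ha : ∃ ε ∈ maximalIdeal R, σ a = a * (1 + ε))
    (hb : ∃ ε ∈ maximalIdeal R, σ b = b * (1 + ε)) :
    ∃ ε ∈ maximalIdeal R, σ (a * b) = a * b * (1 + ε) := by
  obtain ⟨ε, hε, ha⟩ := ha
  obtain ⟨ε', hε', hb⟩ := hb
  exact ⟨ε + ε' + ε * ε', add_mem (add_mem hε hε') (Ideal.mul_mem_right _ _ hε), by
    rw [map_mul, ha, hb]; ring⟩

/-- The linear map induced on the cotangent space by `I / e`. -/
theorem exists_cotangent_endomorphism [IsDomain R] {e : R} (he0 : e ≠ 0)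
    (hres : ∀ f, σ f - f ∈ maximalIdeal R)
    (hdvd : ∀ f, ∃ z ∈ maximalIdeal R, σ f - f = e * z) :
    ∃ φ : CotangentSpace R →ₗ[ResidueField R] CotangentSpace R,
      ∀ y z : maximalIdeal R, σ y - y = e * z →
        φ ((maximalIdeal R).toCotangent y) = (maximalIdeal R).toCotangent z := by
  choose D hDm hD using hdvd
  have hadd : ∀ a b, D (a + b) = D a + D b := fun a b => mul_left_cancel₀ he0 (by
    rw [← hD, mul_add, ← hD, ← hD, map_add]; ring)
  -- I/e is a twisted derivation. As its values and those of I lie in 𝔪, it becomes linear modulo 𝔪²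
  -- and kills 𝔪².
  have hmul : ∀ a b, D (a * b) = D a * b + σ a * D b := fun a b => mul_left_cancel₀ he0 (by
    rw [← hD, map_mul]; linear_combination b * hD a + σ a * hD b)
  let ψ : maximalIdeal R →ₗ[R] (maximalIdeal R).Cotangent :=
    { toFun := fun y => (maximalIdeal R).toCotangent ⟨D y, hDm y⟩
      map_add' := fun a b => by
        rw [← map_add]
        congr 1
        exact Subtype.ext (hadd a b)
      map_smul' := fun r y => by
        rw [RingHom.id_apply, ← map_smul, Ideal.toCotangent_eq]
        change D (r * y) - r * D y ∈ _
        rw [hmul, show D r * y + σ r * D y - r * D y = D r * y + (σ r - r) * D y by ring, pow_two]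
        exact add_mem (Ideal.mul_mem_mul (hDm r) y.2) (Ideal.mul_mem_mul (hres r) (hDm y)) }
  have hψ : ∀ x y : maximalIdeal R, ψ (x * y) = 0 := by
    intro x y
    change (maximalIdeal R).toCotangent ⟨D (x * y), _⟩ = 0
    rw [Ideal.toCotangent_eq_zero]
    change D (x * y) ∈ _
    rw [hmul, show D (x : R) * y + σ x * D y = D (x : R) * y + ((σ x - x) + x) * D y by ring,
      pow_two]
    exact add_mem (Ideal.mul_mem_mul (hDm _) y.2) (Ideal.mul_mem_mul (add_mem (hres _) x.2) (hDm _))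
  refine ⟨LinearMap.extendScalarsOfSurjective (S := ResidueField R) residue_surjective
    (Ideal.Cotangent.lift ψ hψ), fun y z h => ?_⟩
  change Ideal.Cotangent.lift ψ hψ _ = _
  rw [Ideal.Cotangent.lift_toCotangent]
  change (maximalIdeal R).toCotangent ⟨D y, _⟩ = _
  congr 1
  exact Subtype.ext (mul_left_cancel₀ he0 (by rw [← hD, h]))

end LocalAction

section LocalAction

variable {R : Type*} [CommRing R] [IsLocalRing R] {p : ℕ} (σ : R →+* R)

/-- The effect on the cotangent space of one step in the construction of the invariant splitting. -/
theorem toCotangent_splitting_step [IsDomain R] {e θ u₁ : R} (he : e ∈ maximalIdeal R) (he0 : e ≠ 0)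
    (hθ : θ = 1 + e * u₁) (hdvd : ∀ f, ∃ z ∈ maximalIdeal R, σ f - f = e * z)
    {φ : CotangentSpace R →ₗ[ResidueField R] CotangentSpace R}
    (hφ : ∀ y z : maximalIdeal R, σ y - y = e * z →
      φ ((maximalIdeal R).toCotangent y) = (maximalIdeal R).toCotangent z)
    {a k : ℕ} {u x' : R} (hu : IsUnit u) (x : maximalIdeal R)
    (h : u * θ ^ a * (e * x') = -(1 + e * u) * (θ ^ k * σ x - θ ^ a * x)) :
    ∃ hx' : x' ∈ maximalIdeal R, u • (maximalIdeal R).toCotangent ⟨x', hx'⟩ =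
      -(φ ((maximalIdeal R).toCotangent x) +
        (((k : R) - a) * u₁) • (maximalIdeal R).toCotangent x) := by
  obtain ⟨z, hz, hxz⟩ := hdvd x
  -- To first order in e, θ^m is 1 + m e u₁. This produces the scalar (k - a) u₁ in the conclusion.
  have hpow : ∀ m : ℕ, ∃ t, θ ^ m = 1 + e * (m * u₁ + e * t) := by
    intro m
    induction m with
    | zero => exact ⟨0, by simp⟩
    | succ m ih =>
      obtain ⟨t, ht⟩ := ih
      refine ⟨t + u₁ * (m * u₁ + e * t), ?_⟩
      rw [pow_succ, ht, hθ, Nat.cast_succ]; ring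
  obtain ⟨t, ht⟩ := hpow a
  obtain ⟨t', ht'⟩ := hpow k
  have hθu : IsUnit (θ ^ a) := by
    have : IsUnit θ := by
      rw [hθ]
      by_contra hcon
      have h1 := (mem_maximalIdeal _).mpr (mem_nonunits_iff.mpr hcon)
      have h2 := sub_mem h1 (Ideal.mul_mem_right u₁ _ he)
      rw [add_sub_cancel_right] at h2
      exact (Ideal.ne_top_iff_one _).mp (maximalIdeal.isMaximal R).ne_top h2
    exact this.pow a
  have h1 : u * θ ^ a * x' =
      -(1 + e * u) * (θ ^ k * z + (((k : R) - a) * u₁ + e * (t' - t)) * x) := by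
    apply mul_left_cancel₀ he0
    linear_combination h + (-(1 + e * u) * θ ^ k) * hxz + (-(1 + e * u) * x) * (ht' - ht)
  have hx' : x' ∈ maximalIdeal R := by
    obtain ⟨v, hv⟩ := (hu.mul hθu).exists_right_inv
    rw [show x' = v * (u * θ ^ a * x') by linear_combination (-x') * hv, h1]
    exact Ideal.mul_mem_left _ _ (Ideal.mul_mem_left _ _ (add_mem (Ideal.mul_mem_left _ _ hz)
      (Ideal.mul_mem_left _ _ x.2)))
  refine ⟨hx', ?_⟩
  rw [hφ x ⟨z, hz⟩ hxz, ← map_smul, ← map_smul, ← map_add, ← map_neg, Ideal.toCotangent_eq]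
  change u * x' - -(z + (((k : R) - a) * u₁) * x) ∈ _
  -- Every correction term is e times x', z or x, hence lies in 𝔪².
  have h2 : u * x' - -(z + (((k : R) - a) * u₁) * x) =
      e * (-(u * (a * u₁ + e * t)) * x') +
      e * (-(u * θ ^ k + (k * u₁ + e * t')) * z) +
      e * (-(u * (((k : R) - a) * u₁ + e * (t' - t)) + (t' - t)) * x) := by
    linear_combination h1 - (u * x') * ht + (-z) * ht'
  rw [h2, pow_two]
  exact add_mem (add_mem (Ideal.mul_mem_mul he (Ideal.mul_mem_left _ _ hx'))
    (Ideal.mul_mem_mul he (Ideal.mul_mem_left _ _ hz)))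
    (Ideal.mul_mem_mul he (Ideal.mul_mem_left _ _ x.2))

end LocalAction

/-! ### Diagonalization by a polynomial with distinct roots. -/

section Eigenvectors

open Polynomial

variable {K V : Type*} [Field K] [AddCommGroup V] [Module K V]

/-- The linear factors are pairwise coprime, so the kernel of the product is the sum of the kernels
of the factors. -/
theorem ker_aeval_prod_le_span_eigenvectors (φ : Module.End K V) (s : Finset K) :
    LinearMap.ker (aeval φ (∏ a ∈ s, (X - C a))) ≤
      Submodule.span K {v | ∃ a ∈ s, φ v = a • v} := by
  classical
  induction s using Finset.induction_on with
  | empty =>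
    intro v hv
    have : v = 0 := by simpa using hv
    rw [this]; exact zero_mem _
  | insert a s ha ih =>
    rw [Finset.prod_insert ha, ← sup_ker_aeval_eq_ker_aeval_mul_of_coprime]
    · refine sup_le ?_ (ih.trans (Submodule.span_mono ?_))
      · intro v hv
        refine Submodule.subset_span ⟨a, Finset.mem_insert_self _ _, ?_⟩
        have : φ v - a • v = 0 := by simpa [Module.algebraMap_end_apply] using hv
        exact sub_eq_zero.mp this
      · rintro v ⟨b, hb, h⟩
        exact ⟨b, Finset.mem_insert_of_mem hb, h⟩
    · refine IsCoprime.prod_right fun b hb => ?_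
      exact isCoprime_X_sub_C_of_isUnit_sub
        (sub_ne_zero.mpr (by rintro rfl; exact ha hb)).isUnit

/-- An endomorphism killed by `∏ (X - a)` with distinct `a` has a basis of eigenvectors. -/
theorem exists_eigenbasis [FiniteDimensional K V] {n : ℕ} (hn : Module.finrank K V = n)
    (φ : Module.End K V) (s : Finset K) (h : aeval φ (∏ a ∈ s, (X - C a)) = 0) :
    ∃ v : Module.Basis (Fin n) K V, ∀ i, ∃ a ∈ s, φ (v i) = a • v i := by
  obtain ⟨b, hb, hspan, hli⟩ := exists_linearIndependent K {v | ∃ a ∈ s, φ v = a • v}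
  have htop : ⊤ ≤ Submodule.span K (Set.range (Subtype.val : b → V)) := by
    rw [Subtype.range_coe, hspan]
    refine le_trans ?_ (ker_aeval_prod_le_span_eigenvectors φ s)
    rw [h, LinearMap.ker_zero]
  let B := Module.Basis.mk hli htop
  have : Fintype b := hli.setFinite.fintype
  have hcard : Fintype.card b = n := by rw [← Module.finrank_eq_card_basis B, hn]
  let f : b ≃ Fin n := Fintype.equivFinOfCardEq hcard
  refine ⟨B.reindex f, fun i => ?_⟩
  rw [Module.Basis.reindex_apply, Module.Basis.mk_apply]
  exact hb (f.symm i).2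

theorem exists_root_of_apply_eq_smul (φ : Module.End K V) (s : Finset K)
    (h : aeval φ (∏ a ∈ s, (X - C a)) = 0) {v : V} (hv : v ≠ 0) {μ : K} (hμ : φ v = μ • v) :
    μ ∈ s := by
  have h1 : aeval φ (∏ a ∈ s, (X - C a)) v = (∏ a ∈ s, (X - C a)).eval μ • v :=
    Module.End.aeval_apply_of_hasEigenvector ⟨Module.End.mem_eigenspace_iff.mpr hμ, hv⟩
  rw [h, LinearMap.zero_apply] at h1
  have h2 := (smul_eq_zero.mp h1.symm).resolve_right hv
  rw [eval_prod, Finset.prod_eq_zero_iff] at h2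
  obtain ⟨a, ha, h3⟩ := h2
  rw [eval_sub, eval_X, eval_C, sub_eq_zero] at h3
  rwa [h3]

end Eigenvectors

/-! ### The equation satisfied by the cotangent endomorphism. -/

section LocalEigenvalues

open Polynomial

variable {R : Type*} [CommRing R] [IsLocalRing R] {p : ℕ} (σ : R →+* R)

theorem natCast_residue_eq [CharP (ResidueField R) p] {j a : ℕ} (h : j + 1 + a = p) :
    (a : ResidueField R) = -((j : ResidueField R) + 1) := by
  have : ((j + 1 + a : ℕ) : ResidueField R) = 0 := by rw [h, CharP.cast_eq_zero]
  push_cast at this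
  linear_combination this

theorem exists_pow_map_sub_eq [IsDomain R] [CharP (ResidueField R) p] (hp : p.Prime)
    (hσ : σ ^ p = 1) {e s u₁ : R}
    (he0 : e ≠ 0) (hu₁ : IsUnit u₁) (hs : σ s - s = e * s * u₁)
    (hres : ∀ f, σ f - f ∈ maximalIdeal R) (he : e ∈ maximalIdeal R)
    (hdvd : ∀ f, e ∣ σ f - f) (j : ℕ) :
    ∃ z ∈ maximalIdeal R, (σ ^ j) s - s = e * s * (u₁ * (j + z)) := by
  obtain ⟨z, hz, h⟩ := exists_pow_sub_eq σ (c := e * s * u₁) hres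
    (exists_map_mul_eq σ (exists_map_mul_eq σ (exists_map_eq_mul_one_add σ hp hσ hres he0 (hdvd e))
      ⟨e * u₁, Ideal.mul_mem_right _ _ he, by linear_combination hs⟩)
      (exists_isUnit_map_eq_mul σ hu₁ hres)) hs j
  exact ⟨z, hz, by rw [h]; ring⟩

/-- Applied to R itself, the retraction takes x ∈ 𝔪 to an invariant, whose class φ kills. Tracing
the p - 1 steps shows that, up to a nonzero scalar, this class is the product of the φ + i u₁ with i
= 1, …, p-1, applied to the class of x; the factor i = 0 is φ. -/
theorem aeval_prod_cotangent_endomorphism_eq_zero [IsDomain R] [CharP (ResidueField R) p]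
    (hp : p.Prime) (hσ : σ ^ p = 1) {e s u₁ : R} (he : e ∈ maximalIdeal R) (he0 : e ≠ 0)
    (hs0 : s ≠ 0) (hu₁ : IsUnit u₁) (hs : σ s - s = e * s * u₁)
    (hdvd : ∀ f, ∃ z ∈ maximalIdeal R, σ f - f = e * z)
    {φ : CotangentSpace R →ₗ[ResidueField R] CotangentSpace R}
    (hφ : ∀ y z : maximalIdeal R, σ y - y = e * z →
      φ ((maximalIdeal R).toCotangent y) = (maximalIdeal R).toCotangent z) :
    aeval φ (∏ i ∈ Finset.range p, (X + C ((i : ResidueField R) * residue R u₁))) = 0 := by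
  have hres : ∀ f, σ f - f ∈ maximalIdeal R := fun f => by
    obtain ⟨z, hz, h⟩ := hdvd f
    rw [h]; exact Ideal.mul_mem_left _ _ hz
  have hdvd' : ∀ f, e ∣ σ f - f := fun f => by
    obtain ⟨z, hz, h⟩ := hdvd f
    exact ⟨z, h⟩
  have hpow := exists_pow_map_sub_eq σ hp hσ he0 hu₁ hs hres he hdvd'
  have hθ : IsUnit (1 + e * u₁) := by
    by_contra hcon
    have h1 := (mem_maximalIdeal _).mpr (mem_nonunits_iff.mpr hcon)
    have h2 := sub_mem h1 (Ideal.mul_mem_right u₁ _ he)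
    rw [add_sub_cancel_right] at h2
    exact (Ideal.ne_top_iff_one _).mp (maximalIdeal.isMaximal R).ne_top h2
  obtain ⟨P, hP1, -, -, hP⟩ := exists_invariant_splitting hp.one_lt σ hσ
    (mem_nonZeroDivisors_of_ne_zero he0) (mem_nonZeroDivisors_of_ne_zero hs0) hθ
    (by linear_combination hs) hdvd' (fun j h0 hj => by
      obtain ⟨z, hz, h⟩ := hpow j
      exact ⟨_, hu₁.mul (isUnit_natCast_add h0 hj hz), h⟩)
  let G : ℕ → (ResidueField R)[X] := fun j =>
    ∏ i ∈ Finset.range j, (X + C (((i + 1 : ℕ) : ResidueField R) * residue R u₁))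
  have hsmul : ∀ (r : R) (w : CotangentSpace R), r • w = residue R r • w := fun r w => rfl
  have hprod : (∏ i ∈ Finset.range p, (X + C ((i : ResidueField R) * residue R u₁))) =
      X * G (p - 1) := by
    conv_lhs => rw [← Nat.sub_add_cancel hp.one_le]
    rw [Finset.prod_range_succ', mul_comm]
    simp [G]
  rw [hprod]
  refine LinearMap.ext fun v => ?_
  obtain ⟨x, rfl⟩ := (maximalIdeal R).toCotangent_surjective v
  rw [map_mul, aeval_X, LinearMap.zero_apply, Module.End.mul_apply]
  -- Step j divides by the unit congruent to (j + 1) u₁ and applies -(φ + (j + 1) u₁). The factors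
  -- divided by accumulate to j! u₁^j.
  have key := hP (fun j c => ∃ hc : c ∈ maximalIdeal R,
    ((j.factorial : ResidueField R) * residue R u₁ ^ j) • (maximalIdeal R).toCotangent ⟨c, hc⟩ =
      (-1 : ResidueField R) ^ j • aeval φ (G j) ((maximalIdeal R).toCotangent x)) x
    ⟨x.2, by simp [G]⟩ ?_
  · obtain ⟨hc, h⟩ := key
    have h0 : φ ((maximalIdeal R).toCotangent ⟨P x, hc⟩) = 0 := by
      rw [hφ ⟨P x, hc⟩ 0 (by simp [hP1]), map_zero]
    have h1 := congrArg φ h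
    rw [map_smul, h0, smul_zero, map_smul] at h1
    exact (smul_eq_zero.mp h1.symm).resolve_left (pow_ne_zero _ (neg_ne_zero.mpr one_ne_zero))
  · rintro j c c' hj ⟨hc, h⟩ hstep
    obtain ⟨z, hz, hju⟩ := hpow (j + 1)
    have hunit := hu₁.mul (isUnit_natCast_add (p := p) (Nat.succ_pos j) hj hz)
    obtain ⟨hc', h'⟩ := toCotangent_splitting_step σ he he0 rfl hdvd hφ (k := 0) hunit ⟨c, hc⟩
      (by rw [hstep _ hju]; simp)
    refine ⟨hc', ?_⟩
    rw [hsmul, hsmul] at h'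
    have hz0 := (residue_eq_zero_iff z).mpr hz
    -- The exponent p - 1 - j of 1/s is -(j + 1) in characteristic p.
    have ha := natCast_residue_eq (R := R) (p := p) (j := j) (a := p - 1 - j) (by omega)
    simp only [map_mul, map_add, map_sub, map_natCast, hz0, ha, add_zero] at h'
    have hG : G (j + 1) = (X + C (((j + 1 : ℕ) : ResidueField R) * residue R u₁)) * G j := by
      simp only [G]
      rw [Finset.prod_range_succ, mul_comm]
    rw [hG, map_mul, Module.End.mul_apply, Nat.factorial_succ]
    set w := (maximalIdeal R).toCotangent ⟨c, hc⟩
    set w' := (maximalIdeal R).toCotangent ⟨c', hc'⟩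
    have e1 : ((((j + 1) * j.factorial : ℕ) : ResidueField R) * residue R u₁ ^ (j + 1)) • w' =
        ((j.factorial : ResidueField R) * residue R u₁ ^ j) •
          ((residue R u₁ * ((j + 1 : ℕ) : ResidueField R)) • w') := by
      rw [smul_smul]; congr 1; push_cast; ring
    have e2 : ∀ y, aeval φ (X + C (((j + 1 : ℕ) : ResidueField R) * residue R u₁)) y =
        φ y + (((j + 1 : ℕ) : ResidueField R) * residue R u₁) • y := by
      intro y
      rw [map_add, aeval_X, aeval_C, LinearMap.add_apply, Module.algebraMap_end_apply]
    rw [e1, h', e2, smul_neg, smul_add, ← map_smul, smul_comm _ _ w, h, map_smul, pow_succ]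
    rw [smul_comm _ ((-1 : ResidueField R) ^ j), ← smul_add, mul_neg_one, neg_smul]
    congr 4
    push_cast
    ring

theorem prod_X_add_eq_prod_image {K : Type*} [Field K] [CharP K p] [DecidableEq K] {c : K}
    (hc : c ≠ 0) :
    (∏ i ∈ Finset.range p, (X + C ((i : K) * c))) =
      ∏ a ∈ (Finset.range p).image (fun i : ℕ => -((i : K) * c)), (X - C a) := by
  rw [Finset.prod_image]
  · exact Finset.prod_congr rfl fun i _ => by rw [C_neg, sub_neg_eq_add]
  · intro i hi j hj h
    have h1 : (i : K) = j := mul_right_cancel₀ hc (neg_injective h)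
    exact CharP.natCast_injOn_Iio K p (Finset.mem_range.mp hi) (Finset.mem_range.mp hj) h1

end LocalEigenvalues

/-! ### Gradings by ℤ/p as actions of μ_p. -/

section WeightDecomposition

/-- The coefficient of the character `k`. -/
noncomputable def muCoefficient (p : ℕ) (B : Type u) [CommRing B] (k : ZMod p) :
    B ⊗[ℤ] MuRing p →+ B :=
  (TensorProduct.rid ℤ B).toLinearMap.toAddMonoidHom.comp
    (LinearMap.lTensor B ((Finsupp.lapply k).comp
      (AddMonoidAlgebra.coeffLinearEquiv (M := ZMod p) ℤ).toLinearMap)).toAddMonoidHom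

theorem muCoefficient_tmul {p : ℕ} {B : Type u} [CommRing B] (k l : ZMod p) (b : B) :
    muCoefficient p B k (b ⊗ₜ[ℤ] AddMonoidAlgebra.single l (1 : ℤ)) = if l = k then b else 0 := by
  classical
  change (TensorProduct.rid ℤ B) (b ⊗ₜ[ℤ] (Finsupp.single l (1 : ℤ)) k) = _
  rw [TensorProduct.rid_tmul, Finsupp.single_apply]
  split_ifs <;> simp

/-- A grading of the ring `B` by `ℤ/p`, given by its projections. -/
structure WeightDecomposition (p : ℕ) [NeZero p] (B : Type*) [CommRing B] where
  proj : ZMod p → B →+ B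
  sum_proj : ∀ b, ∑ k, proj k b = b
  proj_proj : ∀ k l b, proj l (proj k b) = if l = k then proj k b else 0
  proj_mul : ∀ k l a b, proj k a = a → proj l b = b → proj (k + l) (a * b) = a * b
  proj_one : proj 0 1 = 1

namespace WeightDecomposition

variable {p : ℕ} [NeZero p] {B : Type u} [CommRing B] (w : WeightDecomposition p B)

theorem proj_of_ne {k l : ZMod p} {b : B} (hb : w.proj k b = b) (h : l ≠ k) : w.proj l b = 0 := by
  rw [← hb, w.proj_proj, if_neg h]

theorem proj_self (k : ZMod p) (b : B) : w.proj k (w.proj k b) = w.proj k b := by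
  rw [w.proj_proj, if_pos rfl]

/-- The coaction as an additive map. -/
noncomputable def coactAddHom : B →+ B ⊗[ℤ] MuRing p where
  toFun b := ∑ k, w.proj k b ⊗ₜ[ℤ] AddMonoidAlgebra.single k (1 : ℤ)
  map_zero' := by simp
  map_add' a b := by simp only [map_add, TensorProduct.add_tmul, Finset.sum_add_distrib]

theorem coactAddHom_apply (b : B) :
    w.coactAddHom b = ∑ k, w.proj k b ⊗ₜ[ℤ] AddMonoidAlgebra.single k (1 : ℤ) := rfl

theorem coactAddHom_of_homogeneous {k : ZMod p} {b : B} (hb : w.proj k b = b) :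
    w.coactAddHom b = b ⊗ₜ[ℤ] AddMonoidAlgebra.single k (1 : ℤ) := by
  rw [coactAddHom_apply, Finset.sum_eq_single k, hb]
  · intro l _ hl
    rw [w.proj_of_ne hb hl, TensorProduct.zero_tmul]
  · simp

theorem coactAddHom_mul (a b : B) :
    w.coactAddHom (a * b) = w.coactAddHom a * w.coactAddHom b := by
  conv_lhs => rw [← w.sum_proj a, ← w.sum_proj b]
  rw [Finset.sum_mul_sum, map_sum, coactAddHom_apply, coactAddHom_apply, Finset.sum_mul_sum]
  refine Finset.sum_congr rfl fun i _ => ?_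
  rw [map_sum]
  refine Finset.sum_congr rfl fun j _ => ?_
  rw [w.coactAddHom_of_homogeneous (w.proj_mul i j _ _ (w.proj_self i a) (w.proj_self j b)),
    Algebra.TensorProduct.tmul_mul_tmul, AddMonoidAlgebra.single_mul_single, mul_one]

/-- The coaction of `O(μ_p)` as a ring homomorphism. -/
noncomputable def coactHom : B →ₐ[ℤ] B ⊗[ℤ] MuRing p :=
  RingHom.toIntAlgHom
    { w.coactAddHom with
      map_one' := w.coactAddHom_of_homogeneous w.proj_one
      map_mul' := w.coactAddHom_mul }

theorem coactHom_apply (b : B) :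
    w.coactHom b = ∑ k, w.proj k b ⊗ₜ[ℤ] AddMonoidAlgebra.single k (1 : ℤ) := rfl

theorem coactHom_of_homogeneous {k : ZMod p} {b : B} (hb : w.proj k b = b) :
    w.coactHom b = b ⊗ₜ[ℤ] AddMonoidAlgebra.single k (1 : ℤ) :=
  w.coactAddHom_of_homogeneous hb

/-- The action of `μ_p` on `Spec B` defined by a `ℤ/p`-grading of `B`. -/
noncomputable def toMuAction : MuAction p B where
  coact := w.coactHom
  counital := by
    ext b
    change (Algebra.TensorProduct.rid ℤ ℤ B) (Algebra.TensorProduct.map (AlgHom.id ℤ B)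
      (Bialgebra.counitAlgHom ℤ (MuRing p)) (w.coactHom b)) = b
    rw [coactHom_apply, map_sum, map_sum]
    conv_rhs => rw [← w.sum_proj b]
    refine Finset.sum_congr rfl fun k _ => ?_
    simp
  coassoc := by
    ext b
    change (Algebra.TensorProduct.assoc ℤ ℤ ℤ B (MuRing p) (MuRing p))
      (Algebra.TensorProduct.map w.coactHom (AlgHom.id ℤ (MuRing p)) (w.coactHom b)) =
      Algebra.TensorProduct.map (AlgHom.id ℤ B) (Bialgebra.comulAlgHom ℤ (MuRing p)) (w.coactHom b)
    conv_lhs => rw [coactHom_apply]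
    conv_rhs => rw [coactHom_apply]
    rw [map_sum, map_sum, map_sum]
    refine Finset.sum_congr rfl fun k _ => ?_
    rw [Algebra.TensorProduct.map_tmul, w.coactHom_of_homogeneous (w.proj_self k b),
      Algebra.TensorProduct.map_tmul]
    simp

theorem isEigenfunction_toMuAction {k : ZMod p} {b : B} (hb : w.proj k b = b) :
    w.toMuAction.IsEigenfunction k b :=
  w.coactHom_of_homogeneous hb

theorem mem_invariants_toMuAction {b : B} :
    b ∈ w.toMuAction.invariants ↔ w.proj 0 b = b := by
  change w.coactHom b = b ⊗ₜ[ℤ] 1 ↔ _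
  constructor
  · intro h
    have := congrArg (muCoefficient p B 0) h
    rw [coactHom_apply, map_sum, AddMonoidAlgebra.one_def, muCoefficient_tmul, if_pos rfl] at this
    simp only [muCoefficient_tmul] at this
    simpa using this
  · intro h
    rw [w.coactHom_of_homogeneous h, AddMonoidAlgebra.one_def]

theorem fixes_toMuAction {q : Ideal B} (h : ∀ k, k ≠ 0 → ∀ b, w.proj k b ∈ q) :
    w.toMuAction.Fixes q := by
  intro b
  change w.coactHom b - b ⊗ₜ[ℤ] 1 ∈ _
  have hb := w.sum_proj b
  rw [← hb, map_sum, TensorProduct.sum_tmul, ← Finset.sum_sub_distrib]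
  refine Ideal.sum_mem _ fun k _ => ?_
  rw [w.coactHom_of_homogeneous (w.proj_self k b)]
  by_cases hk : k = 0
  · rw [hk, ← AddMonoidAlgebra.one_def, sub_self]; exact Ideal.zero_mem _
  · have : ∀ x : MuRing p, w.proj k b ⊗ₜ[ℤ] x =
        (Algebra.TensorProduct.includeLeft : B →ₐ[ℤ] B ⊗[ℤ] MuRing p) (w.proj k b) *
          ((1 : B) ⊗ₜ[ℤ] x) := by
      intro x
      rw [Algebra.TensorProduct.includeLeft_apply, Algebra.TensorProduct.tmul_mul_tmul, mul_one,
        one_mul]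
    have hmem := fun x => Ideal.mul_mem_right ((1 : B) ⊗ₜ[ℤ] x) _ (Ideal.mem_map_of_mem
      (Algebra.TensorProduct.includeLeft : B →ₐ[ℤ] B ⊗[ℤ] MuRing p) (h k hk b))
    rw [this, this 1]
    exact sub_mem (hmem _) (hmem _)

end WeightDecomposition

end WeightDecomposition

/-! ### The Kummer cover and its grading. -/

section KummerCover

open Polynomial

/-- The `μ_p`-torsor `S[T] / (T ^ p - μ)`. -/
abbrev KummerCover {S : Type u} [CommRing S] (p : ℕ) (μ : S) : Type u :=
  AdjoinRoot (X ^ p - C μ : S[X])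

namespace KummerCover

variable {S : Type u} [CommRing S] {p : ℕ} {μ : S}

theorem root_pow : AdjoinRoot.root (X ^ p - C μ : S[X]) ^ p = AdjoinRoot.of _ μ := by
  have h := AdjoinRoot.eval₂_root (X ^ p - C μ : S[X])
  rw [eval₂_sub, eval₂_X_pow, eval₂_C, sub_eq_zero] at h
  exact h

theorem induction {motive : KummerCover p μ → Prop}
    (h : ∀ (f : S) (i : ℕ), motive (AdjoinRoot.of _ f * AdjoinRoot.root _ ^ i))
    (hadd : ∀ c d, motive c → motive d → motive (c + d)) (c : KummerCover p μ) : motive c := by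
  induction c using AdjoinRoot.induction_on with
  | ih F =>
    induction F using Polynomial.induction_on' with
    | add F G hF hG => rw [map_add]; exact hadd _ _ hF hG
    | monomial i f =>
      rw [← C_mul_X_pow_eq_monomial, map_mul, map_pow]
      exact h f i

theorem free (hp : p ≠ 0) : Module.Free S (KummerCover p μ) :=
  (monic_X_pow_sub_C μ hp).free_adjoinRoot

theorem finite (hp : p ≠ 0) : Module.Finite S (KummerCover p μ) :=
  (monic_X_pow_sub_C μ hp).finite_adjoinRoot

theorem eq_zero_of_sum_eq_zero (hp : p ≠ 0) {f : ℕ → S}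
    (h : ∑ i ∈ Finset.range p, AdjoinRoot.of _ (f i) * AdjoinRoot.root (X ^ p - C μ : S[X]) ^ i = 0)
    {i : ℕ} (hi : i < p) : f i = 0 := by
  nontriviality S
  let F : S[X] := ∑ i ∈ Finset.range p, C (f i) * X ^ i
  have h1 : AdjoinRoot.mk (X ^ p - C μ : S[X]) F = 0 := by
    rw [← h, map_sum]
    exact Finset.sum_congr rfl fun i _ => by rw [map_mul, map_pow]; rfl
  have h2 : F = 0 := by
    by_contra hF
    rw [AdjoinRoot.mk_eq_zero] at h1
    refine (monic_X_pow_sub_C μ hp).not_dvd_of_natDegree_lt hF ?_ h1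
    rw [natDegree_X_pow_sub_C]
    refine (natDegree_sum_le_of_forall_le (n := p - 1) _ _ fun i hi => ?_).trans_lt (by omega)
    rw [Finset.mem_range] at hi
    exact (natDegree_C_mul_X_pow_le _ _).trans (by omega)
  have h3 := congrArg (fun G => coeff G i) h2
  simp only [F, finsetSum_coeff, coeff_C_mul_X_pow, coeff_zero] at h3
  rwa [Finset.sum_eq_single i (fun j _ hj => if_neg fun h => hj h.symm) (by simp [hi]),
    if_pos rfl] at h3

theorem exists_eq_sum (hp : p ≠ 0) (c : KummerCover p μ) :
    ∃ f : ℕ → S, c = ∑ i ∈ Finset.range p, AdjoinRoot.of _ (f i) * AdjoinRoot.root _ ^ i := by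
  rcases subsingleton_or_nontrivial S with hS | hS
  · have := (AdjoinRoot.of (X ^ p - C μ : S[X])).codomain_trivial
    exact ⟨0, Subsingleton.elim _ _⟩
  obtain ⟨F, rfl⟩ := AdjoinRoot.mk_surjective c
  have hm := monic_X_pow_sub_C μ hp
  refine ⟨(F %ₘ (X ^ p - C μ)).coeff, ?_⟩
  have h1 : AdjoinRoot.mk (X ^ p - C μ) F = AdjoinRoot.mk (X ^ p - C μ) (F %ₘ (X ^ p - C μ)) := by
    rw [AdjoinRoot.mk_eq_mk]
    exact ⟨F /ₘ (X ^ p - C μ), by linear_combination - modByMonic_add_div F (X ^ p - C μ)⟩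
  rw [h1]
  have h2 : (F %ₘ (X ^ p - C μ)).natDegree < p := by
    have := natDegree_modByMonic_lt F hm (by
      intro h
      have := congrArg natDegree h
      rw [natDegree_X_pow_sub_C, natDegree_one] at this
      exact hp this)
    rwa [natDegree_X_pow_sub_C] at this
  conv_lhs => rw [as_sum_range' (F %ₘ (X ^ p - C μ)) p h2]
  rw [map_sum]
  refine Finset.sum_congr rfl fun i _ => ?_
  rw [← C_mul_X_pow_eq_monomial, map_mul, map_pow]
  rfl

theorem isUnit_root (hp : p ≠ 0) (hμ : IsUnit μ) :
    IsUnit (AdjoinRoot.root (X ^ p - C μ : S[X])) := by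
  have := hμ.map (AdjoinRoot.of (X ^ p - C μ : S[X]))
  rw [← root_pow] at this
  exact (isUnit_pow_iff hp).mp this

theorem of_mem_nonZeroDivisors (hp : p ≠ 0) {e : S} (he : e ∈ nonZeroDivisors S) :
    AdjoinRoot.of (X ^ p - C μ : S[X]) e ∈ nonZeroDivisors (KummerCover p μ) := by
  rw [mem_nonZeroDivisors_iff_right]
  intro c hc
  obtain ⟨f, rfl⟩ := exists_eq_sum hp c
  rw [Finset.sum_mul] at hc
  have h1 := fun i hi => eq_zero_of_sum_eq_zero (μ := μ) (f := fun i => f i * e) hp (by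
    rw [← hc]
    exact Finset.sum_congr rfl fun i _ => by rw [map_mul]; ring) (i := i) hi
  refine Finset.sum_eq_zero fun i hi => ?_
  rw [mem_nonZeroDivisors_iff_right.mp he _ (h1 i (Finset.mem_range.mp hi)), map_zero, zero_mul]

/-- The grading of `S[T] / (T ^ p - μ)` in which `T` has weight `r`. -/
noncomputable def toAddMonoidAlgebra (p : ℕ) (μ : S) (r : ZMod p) :
    KummerCover p μ →+* AddMonoidAlgebra (KummerCover p μ) (ZMod p) :=
  AdjoinRoot.lift (AddMonoidAlgebra.singleZeroRingHom.comp (AdjoinRoot.of _))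
    (AddMonoidAlgebra.single r (AdjoinRoot.root _)) (by
      -- T^p has weight p r = 0, as does μ.
      rw [eval₂_sub, eval₂_X_pow, eval₂_C, AddMonoidAlgebra.single_pow, root_pow, nsmul_eq_mul,
        CharP.cast_eq_zero, zero_mul]
      exact sub_self _)

theorem toAddMonoidAlgebra_of_mul_root_pow (r : ZMod p) (f : S) (i : ℕ) :
    toAddMonoidAlgebra p μ r (AdjoinRoot.of _ f * AdjoinRoot.root _ ^ i) =
      AddMonoidAlgebra.single (i * r) (AdjoinRoot.of _ f * AdjoinRoot.root _ ^ i) := by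
  rw [map_mul, map_pow, toAddMonoidAlgebra, AdjoinRoot.lift_of, AdjoinRoot.lift_root,
    AddMonoidAlgebra.single_pow, RingHom.comp_apply, nsmul_eq_mul]
  change AddMonoidAlgebra.single 0 _ * _ = _
  rw [AddMonoidAlgebra.single_mul_single, zero_add]

/-- The component of weight `k`. -/
noncomputable def proj (r k : ZMod p) : KummerCover p μ →+ KummerCover p μ :=
  ((Finsupp.applyAddHom k).comp AddMonoidAlgebra.coeffAddEquiv.toAddMonoidHom).comp
    (toAddMonoidAlgebra p μ r).toAddMonoidHom

theorem proj_apply (r k : ZMod p) (c : KummerCover p μ) :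
    proj r k c = (toAddMonoidAlgebra p μ r c).coeff k := rfl

theorem proj_of_mul_root_pow (r k : ZMod p) (f : S) (i : ℕ) :
    proj r k (AdjoinRoot.of _ f * AdjoinRoot.root (X ^ p - C μ : S[X]) ^ i) =
      if i * r = k then AdjoinRoot.of _ f * AdjoinRoot.root _ ^ i else 0 := by
  classical
  rw [proj_apply, toAddMonoidAlgebra_of_mul_root_pow]
  change Finsupp.single _ _ k = _
  rw [Finsupp.single_apply]

theorem proj_proj (r k l : ZMod p) (c : KummerCover p μ) :
    proj r l (proj r k c) = if l = k then proj r k c else 0 := by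
  induction c using induction with
  | h f i =>
    rw [proj_of_mul_root_pow]
    by_cases hi : i * r = k
    · rw [if_pos hi, proj_of_mul_root_pow, hi]
      simp only [eq_comm]
    · rw [if_neg hi, map_zero, ite_self]
  | hadd c d hc hd =>
    rw [map_add, map_add, hc, hd]
    split_ifs <;> simp

theorem sum_proj [NeZero p] (r : ZMod p) (c : KummerCover p μ) : ∑ k, proj r k c = c := by
  induction c using induction with
  | h f i =>
    simp only [proj_of_mul_root_pow]
    rw [Finset.sum_ite_eq Finset.univ, if_pos (Finset.mem_univ _)]
  | hadd c d hc hd =>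
    simp only [map_add]
    rw [Finset.sum_add_distrib, hc, hd]

theorem toAddMonoidAlgebra_of_proj_eq (r k : ZMod p) {c : KummerCover p μ} (hc : proj r k c = c) :
    toAddMonoidAlgebra p μ r c = AddMonoidAlgebra.single k c := by
  classical
  ext l
  change proj r l c = Finsupp.single k c l
  rw [← hc, proj_proj, hc, Finsupp.single_apply]
  simp only [eq_comm]

theorem proj_mul (r k l : ZMod p) {c d : KummerCover p μ} (hc : proj r k c = c)
    (hd : proj r l d = d) : proj r (k + l) (c * d) = c * d := by
  classical
  rw [proj_apply, map_mul, toAddMonoidAlgebra_of_proj_eq r k hc, toAddMonoidAlgebra_of_proj_eq r l hd,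
    AddMonoidAlgebra.single_mul_single]
  change Finsupp.single _ _ _ = _
  rw [Finsupp.single_apply, if_pos rfl]

theorem proj_of (r : ZMod p) (f : S) :
    proj r 0 (AdjoinRoot.of (X ^ p - C μ : S[X]) f) = AdjoinRoot.of _ f := by
  have := proj_of_mul_root_pow (μ := μ) r 0 f 0
  simpa using this

/-- As r is invertible, T^i has weight 0 only if p divides i, and then T^i is a power of μ. -/
theorem proj_zero_mem_range (hp : p.Prime) {r : ZMod p} (hr : r ≠ 0) (c : KummerCover p μ) :
    ∃ f : S, proj r 0 c = AdjoinRoot.of _ f := by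
  have : Fact p.Prime := ⟨hp⟩
  induction c using induction with
  | h f i =>
    rw [proj_of_mul_root_pow]
    split_ifs with hi
    · have h1 := (mul_eq_zero.mp hi).resolve_right hr
      rw [ZMod.natCast_eq_zero_iff] at h1
      obtain ⟨m, rfl⟩ := h1
      exact ⟨f * μ ^ m, by rw [pow_mul, root_pow, map_mul, map_pow]⟩
    · exact ⟨0, by rw [map_zero]⟩
  | hadd c d hc hd =>
    obtain ⟨f, hf⟩ := hc
    obtain ⟨g, hg⟩ := hd
    exact ⟨f + g, by rw [map_add, hf, hg, map_add]⟩

end KummerCover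

end KummerCover

/-! ### The extension of σ to the Kummer cover. -/

section KummerTwist

open Polynomial

namespace KummerCover

variable {S : Type u} [CommRing S] {p : ℕ} {μ : S}

/-- The extension of an endomorphism `σ` of `S` to `S[T] / (T ^ p - μ)` with `σ(T) = θ T`. -/
noncomputable def twist (σ : S →+* S) (θ : S) (hμ : σ μ = θ ^ p * μ) :
    KummerCover p μ →+* KummerCover p μ :=
  AdjoinRoot.lift ((AdjoinRoot.of _).comp σ) (AdjoinRoot.of _ θ * AdjoinRoot.root _) (by
    rw [eval₂_sub, eval₂_X_pow, eval₂_C, mul_pow, root_pow, RingHom.comp_apply, hμ, map_mul,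
      map_pow, sub_self])

variable {σ : S →+* S} {θ : S} {hμ : σ μ = θ ^ p * μ}

theorem twist_of (f : S) : twist σ θ hμ (AdjoinRoot.of _ f) = AdjoinRoot.of _ (σ f) := by
  rw [twist, AdjoinRoot.lift_of, RingHom.comp_apply]

theorem twist_root : twist σ θ hμ (AdjoinRoot.root _) = AdjoinRoot.of _ θ * AdjoinRoot.root _ := by
  rw [twist, AdjoinRoot.lift_root]

theorem twist_of_mul_root_pow (f : S) (i : ℕ) :
    twist σ θ hμ (AdjoinRoot.of _ f * AdjoinRoot.root _ ^ i) =
      AdjoinRoot.of _ (σ f * θ ^ i) * AdjoinRoot.root _ ^ i := by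
  rw [map_mul, map_pow, twist_of, twist_root, mul_pow, map_mul, map_pow]
  ring

theorem twist_sum (f : ℕ → S) :
    twist σ θ hμ (∑ i ∈ Finset.range p, AdjoinRoot.of _ (f i) * AdjoinRoot.root _ ^ i) =
      ∑ i ∈ Finset.range p, AdjoinRoot.of _ (σ (f i) * θ ^ i) * AdjoinRoot.root _ ^ i := by
  rw [map_sum]
  exact Finset.sum_congr rfl fun i _ => twist_of_mul_root_pow _ _

theorem pow_twist_root (j : ℕ) : (twist σ θ hμ ^ j) (AdjoinRoot.root _) =
    AdjoinRoot.of _ (∏ i ∈ Finset.range j, (σ ^ i) θ) * AdjoinRoot.root _ := by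
  induction j with
  | zero => simp
  | succ j ih =>
    rw [ringHom_pow_succ_apply', twist_root, map_mul, ih,
      pow_apply_of_apply (AdjoinRoot.of _) σ (twist σ θ hμ) twist_of, Finset.prod_range_succ,
      map_mul]
    ring

theorem twist_pow_eq_one (hσ : σ ^ p = 1) (hθ : ∏ i ∈ Finset.range p, (σ ^ i) θ = 1) :
    twist σ θ hμ ^ p = 1 := by
  refine RingHom.ext fun c => ?_
  induction c using induction with
  | h f i =>
    rw [map_mul, map_pow, pow_twist_root, hθ,
      pow_apply_of_apply (AdjoinRoot.of _) σ (twist σ θ hμ) twist_of, hσ, map_one, one_mul]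
    rfl
  | hadd c d hc hd => rw [map_add, map_add, hc, hd]

theorem dvd_twist_sub {e : S} (he : ∀ f, e ∣ σ f - f) (hθ : e ∣ θ - 1) (c : KummerCover p μ) :
    AdjoinRoot.of _ e ∣ twist σ θ hμ c - c := by
  induction c using induction with
  | h f i =>
    rw [twist_of_mul_root_pow, ← sub_mul, ← map_sub]
    refine Dvd.dvd.mul_right (_root_.map_dvd _ ?_) _
    have h1 : e ∣ θ ^ i - 1 := hθ.trans (by simpa using sub_dvd_pow_sub_pow θ 1 i)
    have h2 : σ f * θ ^ i - f = (σ f - f) * θ ^ i + f * (θ ^ i - 1) := by ring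
    rw [h2]
    exact dvd_add ((he f).mul_right _) (h1.mul_left _)
  | hadd c d hc hd =>
    have : twist σ θ hμ (c + d) - (c + d) = (twist σ θ hμ c - c) + (twist σ θ hμ d - d) := by
      rw [map_add]; ring
    rw [this]
    exact dvd_add hc hd

/-- Both maps preserve each S T^i. Thus the action of ℤ/p commutes with that of μ_p, and the
invariants inherit the grading. -/
theorem twist_proj (r k : ZMod p) (c : KummerCover p μ) :
    twist σ θ hμ (proj r k c) = proj r k (twist σ θ hμ c) := by
  induction c using induction with
  | h f i =>
    rw [twist_of_mul_root_pow, proj_of_mul_root_pow, proj_of_mul_root_pow]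
    split_ifs
    · rw [twist_of_mul_root_pow]
    · rw [map_zero]
  | hadd c d hc hd => simp only [map_add, hc, hd]

theorem coeff_unique (hp : p ≠ 0) {f g : ℕ → S}
    (h : ∑ i ∈ Finset.range p, AdjoinRoot.of _ (f i) * AdjoinRoot.root (X ^ p - C μ : S[X]) ^ i =
      ∑ i ∈ Finset.range p, AdjoinRoot.of _ (g i) * AdjoinRoot.root (X ^ p - C μ : S[X]) ^ i)
    {i : ℕ} (hi : i < p) : f i = g i := by
  refine sub_eq_zero.mp (eq_zero_of_sum_eq_zero (μ := μ) (f := fun i => f i - g i) hp ?_ hi)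
  rw [← sub_eq_zero, ← Finset.sum_sub_distrib] at h
  rw [← h]
  exact Finset.sum_congr rfl fun i _ => by rw [map_sub, sub_mul]

theorem of_injective (hp : p ≠ 0) :
    Function.Injective (AdjoinRoot.of (X ^ p - C μ : S[X])) := by
  rw [injective_iff_map_eq_zero]
  intro f hf
  refine eq_zero_of_sum_eq_zero (μ := μ) (f := fun i => if i = 0 then f else 0) hp ?_
    (Nat.pos_of_ne_zero hp)
  rw [Finset.sum_eq_single 0]
  · simpa using hf
  · intro i _ hi
    rw [if_neg hi, map_zero, zero_mul]
  · simp [hp]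

/-- An element with a nonzero divisor multiple in `S T ^ k` lies in `S T ^ k`. -/
theorem exists_eq_of_mul_root_pow (hp : p ≠ 0) {d g : S} (hd : d ∈ nonZeroDivisors S) {k : ℕ}
    (hk : k < p) {c : KummerCover p μ}
    (h : AdjoinRoot.of _ d * c = AdjoinRoot.of _ g * AdjoinRoot.root _ ^ k) :
    ∃ f, c = AdjoinRoot.of _ f * AdjoinRoot.root _ ^ k ∧ d * f = g := by
  obtain ⟨f, rfl⟩ := exists_eq_sum hp c
  have h0 := fun i hi => coeff_unique (μ := μ) (f := fun i => d * f i)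
    (g := fun i => if i = k then g else 0) hp (by
      rw [Finset.sum_eq_single (s := Finset.range p)
        (f := fun i => AdjoinRoot.of _ (if i = k then g else 0) * _) k, if_pos rfl, ← h,
        Finset.mul_sum]
      · exact Finset.sum_congr rfl fun i _ => by rw [map_mul, mul_assoc]
      · intro i _ hi
        rw [if_neg hi, map_zero, zero_mul]
      · simp [hk]) (i := i) hi
  refine ⟨f k, Finset.sum_eq_single k (fun i hi hik => ?_) (by simp [hk]), by simpa using h0 k hk⟩
  have h1 := h0 i (Finset.mem_range.mp hi)
  rw [if_neg hik, mul_comm] at h1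
  rw [mem_nonZeroDivisors_iff_right.mp hd _ h1, map_zero, zero_mul]

/-- The invariants of the twisted action on the Kummer cover. -/
noncomputable abbrev fixed (σ : S →+* S) (θ : S) (hμ : σ μ = θ ^ p * μ) :
    Subring (KummerCover p μ) :=
  (twist σ θ hμ).eqLocus (RingHom.id _)

theorem mem_fixed {c : KummerCover p μ} : c ∈ fixed σ θ hμ ↔ twist σ θ hμ c = c := Iff.rfl

/-- The weight decomposition of the invariants in which `T` has weight `r`. -/
noncomputable def fixedWeights [NeZero p] (r : ZMod p) :
    WeightDecomposition p (fixed σ θ hμ) where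
  proj k :=
    { toFun b := ⟨proj r k b, by rw [mem_fixed, twist_proj, mem_fixed.mp b.2]⟩
      map_zero' := Subtype.ext (map_zero _)
      map_add' a b := Subtype.ext (map_add _ _ _) }
  sum_proj b := Subtype.ext (by
    rw [AddSubmonoidClass.coe_finsetSum]
    exact sum_proj r b.1)
  proj_proj k l b := Subtype.ext (by
    have := proj_proj r k l b.1
    split_ifs at this ⊢ <;> exact this)
  proj_mul k l a b ha hb := Subtype.ext (proj_mul r k l (congrArg Subtype.val ha)
    (congrArg Subtype.val hb))
  proj_one := Subtype.ext (by
    have := proj_of (μ := μ) r 1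
    rwa [map_one] at this)

theorem coe_fixedWeights_proj [NeZero p] (r k : ZMod p) (b : fixed σ θ hμ) :
    (((fixedWeights r).proj k b : fixed σ θ hμ) : KummerCover p μ) = proj r k b := rfl

/-- The point of the Kummer cover with `T = 1` over the point `m` of `S`. -/
noncomputable def residueHom (m : Ideal S) (hμ1 : μ - 1 ∈ m) : KummerCover p μ →+* S ⧸ m :=
  AdjoinRoot.lift (Ideal.Quotient.mk m) 1 (by
    rw [eval₂_sub, eval₂_X_pow, eval₂_C, one_pow, sub_eq_zero, ← map_one (Ideal.Quotient.mk m)]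
    exact (Ideal.Quotient.eq.mpr hμ1).symm)

theorem residueHom_of_mul_root_pow {m : Ideal S} {hμ1 : μ - 1 ∈ m} (f : S) (i : ℕ) :
    residueHom m hμ1 (AdjoinRoot.of (X ^ p - C μ : S[X]) f * AdjoinRoot.root _ ^ i) =
      Ideal.Quotient.mk m f := by
  rw [residueHom, map_mul, map_pow, AdjoinRoot.lift_of, AdjoinRoot.lift_root, one_pow, mul_one]

theorem residueHom_of {m : Ideal S} {hμ1 : μ - 1 ∈ m} (f : S) :
    residueHom m hμ1 (AdjoinRoot.of (X ^ p - C μ : S[X]) f) = Ideal.Quotient.mk m f := by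
  rw [residueHom, AdjoinRoot.lift_of]

end KummerCover

end KummerTwist

/-! ### Norms, integrality and noetherian invariants. -/

section FixedSubring

open Polynomial

variable {C : Type*} [CommRing C]

/-- The fixed points of a ring endomorphism. -/
abbrev fixedSubring (σ : C →+* C) : Subring C := σ.eqLocus (RingHom.id _)

/-- The product of the first `p` translates. -/
def orbitProd (σ : C →+* C) (p : ℕ) (c : C) : C := ∏ j ∈ Finset.range p, (σ ^ j) c

theorem map_orbitProd {σ : C →+* C} {p : ℕ} (hσ : σ ^ p = 1) (c : C) :
    σ (orbitProd σ p c) = orbitProd σ p c := by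
  rcases p with _ | p
  · rw [orbitProd, Finset.range_zero, Finset.prod_empty, map_one]
  rw [orbitProd, map_prod]
  simp only [← ringHom_pow_succ_apply]
  rw [Finset.prod_range_succ, Finset.prod_range_succ', hσ]
  rfl

theorem dvd_orbitProd (σ : C →+* C) {p : ℕ} (hp : 0 < p) (c : C) : c ∣ orbitProd σ p c :=
  Finset.dvd_prod_of_mem (fun j => (σ ^ j) c) (Finset.mem_range.mpr hp)

/-- All conjugates of c are congruent to c modulo the prime. Norms therefore turn functions nonzero
at the fixed point into invariant ones. -/
theorem orbitProd_notMem {σ : C →+* C} {p : ℕ} {m : Ideal C} [hm : m.IsPrime]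
    (hmσ : ∀ c, σ c - c ∈ m) {c : C} (hc : c ∉ m) : orbitProd σ p c ∉ m := by
  rw [orbitProd, hm.prod_mem_iff]
  rintro ⟨j, -, hj⟩
  refine hc ?_
  clear * - hj hmσ
  induction j with
  | zero => exact hj
  | succ j ih =>
    refine ih ?_
    rw [ringHom_pow_succ_apply] at hj
    have := sub_mem hj (hmσ ((σ ^ j) c))
    rwa [sub_sub_cancel] at this

/-- c is a root of the norm of X - c, whose coefficients are invariant. -/
theorem isIntegral_fixedSubring {σ : C →+* C} {p : ℕ} (hp : 0 < p) (hσ : σ ^ p = 1) :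
    Algebra.IsIntegral (fixedSubring σ) C := by
  refine ⟨fun c => ?_⟩
  have hm : (orbitProd (Polynomial.mapRingHom σ) p (X - Polynomial.C c)).Monic := by
    refine monic_prod_of_monic _ _ fun j _ => ?_
    have h : ∀ j, ((Polynomial.mapRingHom σ) ^ j) (X - Polynomial.C c) =
        X - Polynomial.C ((σ ^ j) c) := by
      intro j
      induction j with
      | zero => rfl
      | succ j ih =>
        rw [ringHom_pow_succ_apply, ih, ringHom_pow_succ_apply]
        simp
    rw [h]
    exact monic_X_sub_C _
  have hσ' : (Polynomial.mapRingHom σ) ^ p = 1 := by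
    have h : ∀ (j : ℕ) (F : C[X]) (i : ℕ),
        (((Polynomial.mapRingHom σ) ^ j) F).coeff i = (σ ^ j) (F.coeff i) := by
      intro j F i
      induction j with
      | zero => rfl
      | succ j ih =>
        rw [ringHom_pow_succ_apply, ringHom_pow_succ_apply, ← ih]
        simp
    refine RingHom.ext fun F => Polynomial.ext fun i => ?_
    rw [h, hσ]
    rfl
  have hfix := map_orbitProd hσ' (X - Polynomial.C c)
  set Q := orbitProd (Polynomial.mapRingHom σ) p (X - Polynomial.C c) with hQ
  have hl : Q ∈ Polynomial.lifts (algebraMap (fixedSubring σ) C) := by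
    rw [Polynomial.lifts_iff_coeff_lifts]
    intro i
    refine ⟨⟨Q.coeff i, ?_⟩, rfl⟩
    have := congrArg (fun F => coeff F i) hfix
    simpa using this
  obtain ⟨F, hF, -, hFm⟩ := Polynomial.lifts_and_natDegree_eq_and_monic hl hm
  refine ⟨F, hFm, ?_⟩
  rw [← Polynomial.eval_map, hF]
  obtain ⟨G, hG⟩ := dvd_orbitProd (Polynomial.mapRingHom σ) hp (X - Polynomial.C c)
  rw [hQ, hG]
  simp

/-- A subring that is a module retract of a noetherian ring is noetherian. -/
theorem isNoetherianRing_of_retraction [IsNoetherianRing C] {B : Subring C} (P : C →+ C)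
    (hP : ∀ c, P c ∈ B) (hmul : ∀ b ∈ B, ∀ c, P (b * c) = b * P c) (hone : P 1 = 1) :
    IsNoetherianRing B := by
  have hP1 : ∀ b (hb : b ∈ B), (⟨P b, hP b⟩ : B) = ⟨b, hb⟩ := fun b hb => Subtype.ext (by
    have := hmul b hb 1
    rwa [mul_one, hone, mul_one] at this)
  -- The retraction maps JC into J and fixes B, so JC ∩ B = J. Ideals of B thus embed in those of C,
  -- preserving order.
  have key : ∀ (J : Ideal B) (b : B), (b : C) ∈ J.map B.subtype → b ∈ J := by
    intro J b hb
    have h : ∀ c ∈ J.map B.subtype, ∀ d, (⟨P (d * c), hP _⟩ : B) ∈ J := by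
      intro c hc
      refine Submodule.span_induction (p := fun c _ => ∀ d, (⟨P (d * c), hP _⟩ : B) ∈ J)
        ?_ ?_ ?_ ?_ hc
      · rintro _ ⟨a, ha, rfl⟩ d
        have : (⟨P (d * B.subtype a), hP _⟩ : B) = a * ⟨P d, hP d⟩ := Subtype.ext (by
          rw [mul_comm]
          exact hmul a a.2 d)
        rw [this]
        exact J.mul_mem_right _ ha
      · intro d
        have : (⟨P (d * 0), hP _⟩ : B) = 0 := Subtype.ext (by
          simp)
        rw [this]
        exact J.zero_mem
      · intro x y _ _ hx hy d
        have : (⟨P (d * (x + y)), hP _⟩ : B) = ⟨P (d * x), hP _⟩ + ⟨P (d * y), hP _⟩ :=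
          Subtype.ext (by
            simp [mul_add])
        rw [this]
        exact J.add_mem (hx d) (hy d)
      · intro x y _ hy d
        have := hy (d * x)
        rwa [mul_assoc] at this
    have := h b hb 1
    rw [one_mul] at this
    rwa [hP1 b b.2] at this
  have hmono : StrictMono (fun J : Ideal B => J.map B.subtype) := by
    refine Monotone.strictMono_of_injective (fun _ _ h => Ideal.map_mono h) fun J K hJK => ?_
    have hJK' : J.map B.subtype = K.map B.subtype := hJK
    ext b
    exact ⟨fun hb => key K b (hJK' ▸ Ideal.mem_map_of_mem _ hb),
      fun hb => key J b (hJK' ▸ Ideal.mem_map_of_mem _ hb)⟩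
  rw [isNoetherianRing_iff, isNoetherian_iff']
  exact hmono.wellFoundedGT

end FixedSubring

/-! ### Kummer data: splitting and invariant elements. -/

section KummerDatum

open Polynomial

/-- An action `σ` of `ℤ/p` on `S` near a point `m` with `σ(s) = θ s` and `I(S) ⊆ (e)`, together with a
unit `μ` such that the action extends to the Kummer cover `S[T] / (T ^ p - μ)` by `σ(T) = θ T`. -/
structure KummerDatum (p : ℕ) {S : Type u} [CommRing S] (σ : S →+* S) (m : Ideal S)
    (e s θ μ : S) : Prop where
  pow_eq_one : σ ^ p = 1
  isMaximal : m.IsMaximal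
  natCast_mem : (p : S) ∈ m
  e_mem : e ∈ m
  e_ne_zero : e ≠ 0
  s_ne_zero : s ≠ 0
  isUnit_theta : IsUnit θ
  map_s : σ s = θ * s
  dvd_sub : ∀ f, e ∣ σ f - f
  mem_of_sub_eq : ∀ f g, σ f - f = e * g → g ∈ m
  exists_isUnit : ∀ j, 0 < j → j < p → ∃ u, IsUnit u ∧ (σ ^ j) s - s = e * s * u
  isUnit_mu : IsUnit μ
  mu_sub_one_mem : μ - 1 ∈ m
  map_mu : σ μ = θ ^ p * μ

namespace KummerDatum

variable {S : Type u} [CommRing S] {p : ℕ} {σ : S →+* S} {m : Ideal S} {e s θ μ : S}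
  (h : KummerDatum p σ m e s θ μ)
include h

theorem sub_mem (f : S) : σ f - f ∈ m := by
  obtain ⟨g, hg⟩ := h.dvd_sub f
  rw [hg]
  exact m.mul_mem_right _ h.e_mem

theorem exists_theta_eq [IsDomain S] (hp : 1 < p) : ∃ u, IsUnit u ∧ θ = 1 + e * u := by
  obtain ⟨u, hu, h1⟩ := h.exists_isUnit 1 one_pos hp
  refine ⟨u, hu, mul_right_cancel₀ h.s_ne_zero ?_⟩
  rw [pow_one, h.map_s] at h1
  linear_combination h1

theorem pow_apply_s (j : ℕ) : (σ ^ j) s = (∏ i ∈ Finset.range j, (σ ^ i) θ) * s := by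
  induction j with
  | zero => simp
  | succ j ih =>
    rw [ringHom_pow_succ_apply', h.map_s, map_mul, ih, Finset.prod_range_succ]
    ring

/-- The norm of θ is σ^p(s)/s. This is what gives the extension of σ to the Kummer cover order
dividing p. -/
theorem prod_theta [IsDomain S] : ∏ i ∈ Finset.range p, (σ ^ i) θ = 1 := by
  have := h.pow_apply_s p
  rw [h.pow_eq_one] at this
  refine mul_right_cancel₀ h.s_ne_zero ?_
  rw [← this, one_mul]
  rfl

/-- On S T^k the extended action is x ↦ θ^k σ(x), so the steps of the retraction from x T^k stay in
S T^k and become a recursion in S. The last clause records it for cotangent computations. -/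
theorem exists_splitting [IsDomain S] (hp : 1 < p) : ∃ P : KummerCover p μ →+ KummerCover p μ,
    (∀ c, P c ∈ KummerCover.fixed σ θ h.map_mu) ∧
    (∀ b ∈ KummerCover.fixed σ θ h.map_mu, ∀ c, P (b * c) = b * P c) ∧ P 1 = 1 ∧
    ∀ (k : ℕ), k < p → ∀ (R : ℕ → S → Prop) (x : S), R 0 x →
      (∀ j x x', j + 1 < p → R j x →
        (∀ u, (σ ^ (j + 1)) s - s = e * s * u →
          u * θ ^ (p - 1 - j) * (e * x') = -(1 + e * u) * (θ ^ k * σ x - θ ^ (p - 1 - j) * x)) →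
        R (j + 1) x') →
      ∃ y, R (p - 1) y ∧ P (AdjoinRoot.of _ x * AdjoinRoot.root _ ^ k) =
        AdjoinRoot.of _ y * AdjoinRoot.root _ ^ k := by
  have hp0 : p ≠ 0 := by omega
  have hpow := pow_apply_of_apply (AdjoinRoot.of (X ^ p - C μ : S[X])) σ
    (KummerCover.twist σ θ h.map_mu) KummerCover.twist_of
  obtain ⟨u₁, hu₁, hθ⟩ := h.exists_theta_eq hp
  obtain ⟨P, hP, hmul, hone, hind⟩ := exists_invariant_splitting hp (KummerCover.twist σ θ h.map_mu)
    (KummerCover.twist_pow_eq_one h.pow_eq_one h.prod_theta) (e := AdjoinRoot.of _ e)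
    (s := AdjoinRoot.of _ s) (θ := AdjoinRoot.of _ θ)
    (KummerCover.of_mem_nonZeroDivisors hp0 (mem_nonZeroDivisors_of_ne_zero h.e_ne_zero))
    (KummerCover.of_mem_nonZeroDivisors hp0 (mem_nonZeroDivisors_of_ne_zero h.s_ne_zero))
    (h.isUnit_theta.map _) (by rw [KummerCover.twist_of, h.map_s, map_mul])
    (KummerCover.dvd_twist_sub h.dvd_sub ⟨u₁, by rw [hθ]; ring⟩)
    (fun j hj hjp => by
      obtain ⟨u, hu, heq⟩ := h.exists_isUnit j hj hjp
      exact ⟨AdjoinRoot.of _ u, hu.map _, by rw [hpow, ← map_sub, heq, map_mul, map_mul]⟩)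
  refine ⟨P, hP, fun b hb c => hmul b c hb, hone, fun k hk R x hx hstep => ?_⟩
  obtain ⟨y, hy, hPy⟩ := hind
    (fun j c => ∃ y, c = AdjoinRoot.of _ y * AdjoinRoot.root _ ^ k ∧ R j y)
    (AdjoinRoot.of _ x * AdjoinRoot.root _ ^ k) ⟨x, rfl, hx⟩ (by
      rintro j _ c' hj ⟨y, rfl, hy⟩ hc'
      obtain ⟨u, hu, heq⟩ := h.exists_isUnit (j + 1) j.succ_pos hj
      have h1 := hc' (AdjoinRoot.of _ u) (by rw [hpow, ← map_sub, heq, map_mul, map_mul])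
      rw [KummerCover.twist_of_mul_root_pow] at h1
      have hd : u * θ ^ (p - 1 - j) * e ≠ 0 :=
        mul_ne_zero (mul_ne_zero hu.ne_zero (h.isUnit_theta.pow _).ne_zero) h.e_ne_zero
      -- The step equation puts a multiple of the new element by a nonzero divisor of S into S T^k;
      -- hence the element itself lies there.
      obtain ⟨y', rfl, hy'⟩ := KummerCover.exists_eq_of_mul_root_pow (c := c')
        (g := -(1 + e * u) * (θ ^ k * σ y - θ ^ (p - 1 - j) * y)) hp0
        (mem_nonZeroDivisors_of_ne_zero hd) hk (by
          simp only [map_mul, map_neg, map_add, map_one, map_sub, map_pow] at h1 ⊢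
          linear_combination h1)
      refine ⟨y', rfl, hstep j y y' hj hy fun v hv => ?_⟩
      have : v = u := by
        refine mul_left_cancel₀ (mul_ne_zero h.e_ne_zero h.s_ne_zero) ?_
        rw [← hv, ← heq]
      rw [this, ← hy']
      ring)
  exact ⟨y, hPy, hy⟩

theorem isNoetherianRing_fixed [IsDomain S] [IsNoetherianRing S] (hp : 1 < p) :
    IsNoetherianRing (KummerCover.fixed σ θ h.map_mu) := by
  obtain ⟨P, hP, hmul, hone, -⟩ := h.exists_splitting hp
  have : Module.Finite S (KummerCover p μ) := KummerCover.finite (by omega)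
  have : IsNoetherianRing (KummerCover p μ) := IsNoetherianRing.of_finite S _
  exact isNoetherianRing_of_retraction P hP hmul hone

theorem natCast_notMem {i : ℕ} (hp : p.Prime) (hi : 0 < i) (hip : i < p) : (i : S) ∉ m := by
  intro hmem
  have hcop : Nat.Coprime i p := (Nat.coprime_of_lt_prime hi.ne' hip hp).symm
  refine h.isMaximal.ne_top ((Ideal.eq_top_iff_one m).mpr ?_)
  have h1 := congrArg (Int.cast (R := S)) (Nat.gcd_eq_gcd_ab i p)
  rw [hcop.gcd_eq_one] at h1
  push_cast at h1
  rw [h1]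
  exact m.add_mem (m.mul_mem_right _ hmem) (m.mul_mem_right _ h.natCast_mem)

/-- Inserting θ^i = 1 + e(i u + …) into the relation gives I(f)/e = -σ(f)(i u + …). This lies in m,
but the second factor does not, as 0 < i < p; so σ(f), and with it f, lies in m. Invariants of
nonzero degree thus vanish at the point, which is why μ_p fixes it. -/
theorem mem_of_map_mul_eq [IsDomain S] (hp : p.Prime) {i : ℕ} (hi : 0 < i) (hip : i < p) {f : S}
    (hf : σ f * θ ^ i = f) : f ∈ m := by
  obtain ⟨u, hu, hθ⟩ := h.exists_theta_eq hp.one_lt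
  obtain ⟨w, hw⟩ : ∃ w, θ ^ i = 1 + e * (i * u + e * w) := by
    have := h.e_mem
    clear hf hip hi
    induction i with
    | zero => exact ⟨0, by simp⟩
    | succ i ih =>
      obtain ⟨w, hw⟩ := ih
      refine ⟨w + u * (i * u + e * w), ?_⟩
      rw [pow_succ, hw, hθ]
      push_cast
      ring
  have hm := h.isMaximal.isPrime
  have h1 : -(σ f * (i * u + e * w)) ∈ m := by
    refine h.mem_of_sub_eq f _ ?_
    rw [hw] at hf
    linear_combination hf
  rw [neg_mem_iff] at h1
  have h2 : (i : S) * u + e * w ∉ m := by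
    intro h2
    have h3 := (Ideal.add_mem_iff_left m (m.mul_mem_right w h.e_mem)).mp h2
    rcases hm.mem_or_mem h3 with h3 | h3
    · exact h.natCast_notMem hp hi hip h3
    · exact hm.ne_top (m.eq_top_of_isUnit_mem h3 hu)
  have h3 := (hm.mem_or_mem h1).resolve_right h2
  have h4 := h.sub_mem f
  have := m.sub_mem h3 h4
  rwa [sub_sub_cancel] at this

/-- The coefficients of an invariant element. -/
theorem exists_eq_sum_of_mem_fixed (hp : p ≠ 0) {b : KummerCover p μ}
    (hb : b ∈ KummerCover.fixed σ θ h.map_mu) : ∃ f : ℕ → S,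
      (∀ i < p, σ (f i) * θ ^ i = f i) ∧
      b = ∑ i ∈ Finset.range p, AdjoinRoot.of _ (f i) * AdjoinRoot.root _ ^ i := by
  obtain ⟨f, rfl⟩ := KummerCover.exists_eq_sum hp b
  rw [KummerCover.mem_fixed, KummerCover.twist_sum] at hb
  exact ⟨f, fun i hi => KummerCover.coeff_unique hp (f := fun i => σ (f i) * θ ^ i) hb hi, rfl⟩

/-- The point of the invariants of the Kummer cover over `m` with `T = 1`. -/
noncomputable def point : Ideal (KummerCover.fixed σ θ h.map_mu) :=
  (RingHom.ker (KummerCover.residueHom (p := p) m h.mu_sub_one_mem)).comap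
    (KummerCover.fixed σ θ h.map_mu).subtype

theorem mem_point {b : KummerCover.fixed σ θ h.map_mu} :
    b ∈ h.point ↔ KummerCover.residueHom m h.mu_sub_one_mem (b : KummerCover p μ) = 0 := Iff.rfl

end KummerDatum

end KummerDatum

/-! ### The point of the quotient of the Kummer cover. -/

section KummerDatumPoint

open Polynomial

namespace KummerDatum

variable {S : Type u} [CommRing S] {p : ℕ} {σ : S →+* S} {m : Ideal S} {e s θ μ : S}
  (h : KummerDatum p σ m e s θ μ)

/-- The inclusion of the invariants of the base in the invariants of the Kummer cover. -/
noncomputable def ofFixed : fixedSubring σ →+* KummerCover.fixed σ θ h.map_mu :=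
  ((AdjoinRoot.of (X ^ p - C μ : S[X])).comp (fixedSubring σ).subtype).codRestrict _ fun f => by
    rw [KummerCover.mem_fixed, RingHom.comp_apply, KummerCover.twist_of]
    exact congrArg _ f.2

theorem coe_ofFixed (f : fixedSubring σ) :
    ((h.ofFixed f : KummerCover.fixed σ θ h.map_mu) : KummerCover p μ) = AdjoinRoot.of _ (f : S) :=
  rfl

include h

/-- Homogeneous elements of positive degree vanish at the point. -/
theorem residueHom_homogeneous [IsDomain S] (hp : p.Prime) {i : ℕ} (hi : 0 < i) (hip : i < p)
    {f : S} (hf : σ f * θ ^ i = f) : KummerCover.residueHom m h.mu_sub_one_mem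
      (AdjoinRoot.of (X ^ p - C μ : S[X]) f * AdjoinRoot.root _ ^ i) = 0 := by
  rw [KummerCover.residueHom_of_mul_root_pow]
  exact Ideal.Quotient.eq_zero_iff_mem.mpr (h.mem_of_map_mul_eq hp hi hip hf)

theorem coeff_mem_of_mem_point [IsDomain S] (hp : p.Prime) {f : ℕ → S}
    (hf : ∀ i < p, σ (f i) * θ ^ i = f i)
    (hb : KummerCover.residueHom m h.mu_sub_one_mem (∑ i ∈ Finset.range p,
      AdjoinRoot.of (X ^ p - C μ : S[X]) (f i) * AdjoinRoot.root _ ^ i) = 0) {i : ℕ} (hi : i < p) :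
    f i ∈ m := by
  rcases Nat.eq_zero_or_pos i with rfl | hi0
  · rw [map_sum, Finset.sum_eq_single 0, KummerCover.residueHom_of_mul_root_pow] at hb
    · exact Ideal.Quotient.eq_zero_iff_mem.mp hb
    · intro i hi hi0
      rw [Finset.mem_range] at hi
      exact h.residueHom_homogeneous hp (Nat.pos_of_ne_zero hi0) hi (hf i hi)
    · simp [hp.ne_zero]
  · exact h.mem_of_map_mul_eq hp hi0 hi (hf i hi)

theorem proj_mem_point [IsDomain S] (hp : p.Prime) [NeZero p] (r : ZMod p) {k : ZMod p} (hk : k ≠ 0)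
    (b : KummerCover.fixed σ θ h.map_mu) : (KummerCover.fixedWeights r).proj k b ∈ h.point := by
  rw [mem_point, KummerCover.coe_fixedWeights_proj]
  obtain ⟨f, hf, hbf⟩ := h.exists_eq_sum_of_mem_fixed hp.ne_zero b.2
  rw [hbf, map_sum, map_sum]
  refine Finset.sum_eq_zero fun i hi => ?_
  rw [Finset.mem_range] at hi
  rw [KummerCover.proj_of_mul_root_pow]
  split_ifs with hik
  · refine h.residueHom_homogeneous hp (Nat.pos_of_ne_zero ?_) hi (hf i hi)
    rintro rfl
    exact hk (by rw [← hik, Nat.cast_zero, zero_mul])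
  · exact map_zero _

/-- Homogeneous invariant elements. -/
theorem homogeneous_mem_fixed {i : ℕ} {f : S} (hf : σ f * θ ^ i = f) :
    AdjoinRoot.of (X ^ p - C μ : S[X]) f * AdjoinRoot.root _ ^ i ∈ KummerCover.fixed σ θ h.map_mu := by
  rw [KummerCover.mem_fixed, KummerCover.twist_of_mul_root_pow, hf]

/-- The p-th power of a homogeneous invariant has degree zero. Hence the invariants of the cover are
integral over those of S, with one prime above the fixed point. -/
theorem exists_homogeneous_pow_eq {i : ℕ} {f : S} (hf : σ f * θ ^ i = f) :
    ∃ a : fixedSubring σ, (⟨_, h.homogeneous_mem_fixed hf⟩ : KummerCover.fixed σ θ h.map_mu) ^ p =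
      h.ofFixed a ∧ (a : S) = f ^ p * μ ^ i := by
  have hθ := h.isUnit_theta
  refine ⟨⟨f ^ p * μ ^ i, ?_⟩, Subtype.ext ?_, rfl⟩
  · change σ (f ^ p * μ ^ i) = f ^ p * μ ^ i
    conv_rhs => rw [← hf]
    rw [map_mul, map_pow, map_pow, h.map_mu]
    ring
  · rw [SubmonoidClass.coe_pow, coe_ofFixed, mul_pow, ← pow_mul, mul_comm i p, pow_mul,
      KummerCover.root_pow, map_mul, map_pow, map_pow]

theorem isIntegral_ofFixed (hp : p ≠ 0) : h.ofFixed.IsIntegral := by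
  intro b
  obtain ⟨f, hf, hbf⟩ := h.exists_eq_sum_of_mem_fixed hp b.2
  have hb : b = ∑ i : Fin p, (⟨_, h.homogeneous_mem_fixed (hf i i.2)⟩ :
      KummerCover.fixed σ θ h.map_mu) := Subtype.ext (by
    rw [AddSubmonoidClass.coe_finsetSum, hbf, Finset.sum_range])
  rw [hb]
  let := h.ofFixed.toAlgebra
  refine IsIntegral.sum _ fun i _ => IsIntegral.of_pow (Nat.pos_of_ne_zero hp) ?_
  obtain ⟨a, ha, -⟩ := h.exists_homogeneous_pow_eq (hf i i.2)
  rw [ha]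
  exact isIntegral_algebraMap

theorem comap_ofFixed_point : h.point.comap h.ofFixed = m.comap (fixedSubring σ).subtype := by
  ext f
  rw [Ideal.mem_comap, mem_point, coe_ofFixed, KummerCover.residueHom_of,
    Ideal.Quotient.eq_zero_iff_mem]
  rfl

theorem point_isMaximal (hp : p ≠ 0) : h.point.IsMaximal := by
  have hm := h.isMaximal
  have h1 : (m.comap (fixedSubring σ).subtype).IsMaximal := by
    have := isIntegral_fixedSubring (Nat.pos_of_ne_zero hp) h.pow_eq_one
    exact Ideal.isMaximal_comap_of_isIntegral_of_isMaximal (R := fixedSubring σ) m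
  have hprime : h.point.IsPrime := by
    have : (RingHom.ker (KummerCover.residueHom (p := p) m h.mu_sub_one_mem)).IsPrime :=
      RingHom.ker_isPrime _
    exact Ideal.comap_isPrime _ _
  let := h.ofFixed.toAlgebra
  have : Algebra.IsIntegral (fixedSubring σ) (KummerCover.fixed σ θ h.map_mu) :=
    ⟨h.isIntegral_ofFixed hp⟩
  refine Ideal.isMaximal_of_isIntegral_of_isMaximal_comap (R := fixedSubring σ) h.point ?_
  change (h.point.comap h.ofFixed).IsMaximal
  rwa [h.comap_ofFixed_point]

/-- The homogeneous components of an element vanishing at the point have coefficients in m, so their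
p-th powers are invariants of S lying in m, hence in q. -/
theorem point_le [IsDomain S] (hp : p.Prime) {q : Ideal (KummerCover.fixed σ θ h.map_mu)}
    [hq : q.IsPrime] (hqm : m.comap (fixedSubring σ).subtype ≤ q.comap h.ofFixed) :
    h.point ≤ q := by
  intro b hb
  rw [mem_point] at hb
  obtain ⟨f, hf, hbf⟩ := h.exists_eq_sum_of_mem_fixed hp.ne_zero b.2
  have hb' : b = ∑ i : Fin p, (⟨_, h.homogeneous_mem_fixed (hf i i.2)⟩ :
      KummerCover.fixed σ θ h.map_mu) := Subtype.ext (by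
    rw [AddSubmonoidClass.coe_finsetSum, hbf, Finset.sum_range])
  rw [hbf] at hb
  rw [hb']
  refine Ideal.sum_mem _ fun i _ => hq.mem_of_pow_mem p ?_
  obtain ⟨a, ha, ha'⟩ := h.exists_homogeneous_pow_eq (hf i i.2)
  rw [ha]
  refine hqm ?_
  change (a : S) ∈ m
  rw [ha']
  exact m.mul_mem_right _ (m.pow_mem_of_mem (h.coeff_mem_of_mem_point hp hf hb i.2) _ hp.pos)

/-- The point is the only one over its image in the quotient. -/
theorem eq_point [IsDomain S] (hp : p.Prime) {q : Ideal (KummerCover.fixed σ θ h.map_mu)}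
    [hq : q.IsPrime] (hqm : m.comap (fixedSubring σ).subtype ≤ q.comap h.ofFixed) :
    q = h.point :=
  ((h.point_isMaximal hp.ne_zero).eq_of_le hq.ne_top (h.point_le hp hqm)).symm

/-- A neighborhood of the point contains the preimage of a neighborhood in the quotient. -/
theorem exists_notMem_of_isOpen [IsDomain S] (hp : p.Prime)
    {V : Set (PrimeSpectrum (KummerCover.fixed σ θ h.map_mu))} (hV : IsOpen V)
    (hq : ⟨h.point, (h.point_isMaximal hp.ne_zero).isPrime⟩ ∈ V) :
    ∃ a : fixedSubring σ, (a : S) ∉ m ∧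
      ∀ q : PrimeSpectrum (KummerCover.fixed σ θ h.map_mu), h.ofFixed a ∉ q.asIdeal → q ∈ V := by
  have hm := h.isMaximal.isPrime
  -- Integral maps are closed. As the point is its entire fibre, the closed image of the complement
  -- of V misses its image.
  have hcl : IsClosed (PrimeSpectrum.comap h.ofFixed '' Vᶜ) :=
    (PrimeSpectrum.isClosedMap_comap_of_isIntegral _ (h.isIntegral_ofFixed hp.ne_zero)) _
      hV.isClosed_compl
  obtain ⟨J, hJ⟩ := (PrimeSpectrum.isClosed_iff_zeroLocus_ideal _).mp hcl
  have hnot : (⟨m.comap (fixedSubring σ).subtype, Ideal.comap_isPrime _ _⟩ :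
      PrimeSpectrum (fixedSubring σ)) ∉ PrimeSpectrum.comap h.ofFixed '' Vᶜ := by
    rintro ⟨q, hqV, hq'⟩
    have hqm : q.asIdeal.comap h.ofFixed = m.comap (fixedSubring σ).subtype :=
      congrArg PrimeSpectrum.asIdeal hq'
    have := h.eq_point hp hqm.ge
    exact hqV (by convert hq)
  rw [hJ, PrimeSpectrum.mem_zeroLocus, Set.not_subset] at hnot
  obtain ⟨a, haJ, ha⟩ := hnot
  refine ⟨a, ha, fun q hqa => ?_⟩
  by_contra hqV
  have : PrimeSpectrum.comap h.ofFixed q ∈ PrimeSpectrum.zeroLocus (J : Set (fixedSubring σ)) := by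
    rw [← hJ]
    exact ⟨q, hqV, rfl⟩
  exact hqa (this haJ)

end KummerDatum

end KummerDatumPoint

/-! ### Regularity of the quotient of the Kummer cover. -/

section KummerDatumRegular

open Polynomial

namespace KummerDatum

variable {S : Type u} [CommRing S] {p : ℕ} {σ : S →+* S} {m : Ideal S} {e s θ μ : S}
  (h : KummerDatum p σ m e s θ μ)
include h

/-- Heights are compared at the point T = 1 of the cover: it is flat over S and integral over its
invariants. -/
theorem height_le_height_point [IsDomain S] [IsNoetherianRing S] (hp : p.Prime) :
    have := (h.point_isMaximal hp.ne_zero).isPrime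
    have := h.isMaximal.isPrime
    m.height ≤ h.point.height := by
  intro _ hm
  have : Module.Finite S (KummerCover p μ) := KummerCover.finite hp.ne_zero
  have : Module.Free S (KummerCover p μ) := KummerCover.free hp.ne_zero
  have : IsNoetherianRing (KummerCover p μ) := IsNoetherianRing.of_finite S _
  have : Algebra.IsIntegral (KummerCover.fixed σ θ h.map_mu) (KummerCover p μ) :=
    isIntegral_fixedSubring hp.pos (KummerCover.twist_pow_eq_one h.pow_eq_one h.prod_theta)
  have : (RingHom.ker (KummerCover.residueHom (p := p) m h.mu_sub_one_mem)).IsPrime :=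
    RingHom.ker_isPrime _
  have h1 := height_comap_le_height_of_flat (A := S)
    (RingHom.ker (KummerCover.residueHom (p := p) m h.mu_sub_one_mem))
  have h2 := height_le_height_comap_of_isIntegral (A := KummerCover.fixed σ θ h.map_mu)
    (RingHom.ker (KummerCover.residueHom (p := p) m h.mu_sub_one_mem))
  have h3 : (RingHom.ker (KummerCover.residueHom (p := p) m h.mu_sub_one_mem)).comap
      (algebraMap S (KummerCover p μ)) = m := by
    ext f
    rw [Ideal.mem_comap, RingHom.mem_ker]
    refine Iff.trans (Eq.congr_left ?_) Ideal.Quotient.eq_zero_iff_mem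
    exact KummerCover.residueHom_of f
  simp only [h3] at h1
  exact h1.trans h2

/-- The coefficients of b lie in m, hence after clearing denominators in the ideal of the y_i. This
expresses b through the t_i = y_i T^(k_i) with coefficients in the cover, and the retraction
replaces these by invariant ones. -/
theorem exists_mul_mem_span_homogeneous [IsDomain S] (hp : p.Prime) {n : ℕ}
    {k : Fin n → ℕ} {y : Fin n → S} (hy : ∀ i, σ (y i) * θ ^ k i = y i)
    (R : Type*) [CommRing R] [IsLocalRing R] [Algebra S R] [hm : m.IsPrime]
    [IsLocalization.AtPrime R m]
    (hyR : Ideal.span (Set.range fun i => algebraMap S R (y i)) = maximalIdeal R)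
    {b : KummerCover.fixed σ θ h.map_mu} (hb : b ∈ h.point) :
    ∃ a : fixedSubring σ, (a : S) ∉ m ∧ h.ofFixed a * b ∈ Ideal.span (Set.range fun i =>
      (⟨_, h.homogeneous_mem_fixed (hy i)⟩ : KummerCover.fixed σ θ h.map_mu)) := by
  obtain ⟨f, hf, hbf⟩ := h.exists_eq_sum_of_mem_fixed hp.ne_zero b.2
  rw [mem_point, hbf] at hb
  have hfm := fun i hi => h.coeff_mem_of_mem_point hp hf hb (i := i) hi
  have h1 : ∀ i : Fin p, ∃ g : S, g ∉ m ∧ g * f i ∈ Ideal.span (Set.range y) := by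
    intro i
    have h2 : algebraMap S R (f i) ∈ maximalIdeal R :=
      (IsLocalization.AtPrime.to_map_mem_maximal_iff R m (f i)).mpr (hfm i i.2)
    have h3 : maximalIdeal R = (Ideal.span (Set.range y)).map (algebraMap S R) := by
      rw [← hyR, Ideal.map_span, ← Set.range_comp]
      rfl
    rw [h3, IsLocalization.algebraMap_mem_map_algebraMap_iff m.primeCompl] at h2
    obtain ⟨g, hg, hgf⟩ := h2
    exact ⟨g, hg, hgf⟩
  choose g hg hgf using h1
  -- A common denominator, made invariant by the norm and still nonzero at the fixed point.
  let G : S := orbitProd σ p (∏ i, g i)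
  have hG : G ∉ m := by
    refine orbitProd_notMem h.sub_mem ?_
    rw [hm.prod_mem_iff]
    rintro ⟨i, -, hi⟩
    exact hg i hi
  have hGf : ∀ i : Fin p, G * f i ∈ Ideal.span (Set.range y) := by
    intro i
    obtain ⟨d, hd⟩ : g i ∣ G :=
      (Finset.dvd_prod_of_mem g (Finset.mem_univ i)).trans (dvd_orbitProd σ hp.pos _)
    rw [hd, mul_right_comm]
    exact Ideal.mul_mem_right _ _ (hgf i)
  refine ⟨⟨G, map_orbitProd h.pow_eq_one _⟩, hG, ?_⟩
  obtain ⟨P, hP, hmul, hone, -⟩ := h.exists_splitting hp.one_lt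
  set t : Fin n → KummerCover.fixed σ θ h.map_mu := fun i => ⟨_, h.homogeneous_mem_fixed (hy i)⟩
    with ht
  have hroot := KummerCover.isUnit_root (p := p) hp.ne_zero h.isUnit_mu
  -- T is a unit, so the y_i lie in the ideal of the t_i upstairs.
  have h4 : (Ideal.span (Set.range y)).map (AdjoinRoot.of (X ^ p - C μ : S[X])) ≤
      Ideal.span (Set.range fun i => (t i : KummerCover p μ)) := by
    rw [Ideal.map_span, Ideal.span_le]
    rintro _ ⟨_, ⟨i, rfl⟩, rfl⟩
    have h5 : (t i : KummerCover p μ) ∈ Ideal.span (Set.range fun i => (t i : KummerCover p μ)) :=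
      Ideal.subset_span ⟨i, rfl⟩
    exact (Ideal.mul_unit_mem_iff_mem _ (hroot.pow (k i))).mp h5
  have h6 : AdjoinRoot.of _ G * (b : KummerCover p μ) ∈
      Ideal.span (Set.range fun i => (t i : KummerCover p μ)) := by
    rw [hbf, Finset.mul_sum]
    refine Ideal.sum_mem _ fun i hi => ?_
    rw [← mul_assoc, ← map_mul]
    exact Ideal.mul_mem_right _ _ (h4 (Ideal.mem_map_of_mem _
      (hGf ⟨i, Finset.mem_range.mp hi⟩)))
  obtain ⟨c, hc⟩ := Ideal.mem_span_range_iff_exists_fun.mp h6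
  have h7 : P (AdjoinRoot.of _ G * (b : KummerCover p μ)) =
      AdjoinRoot.of _ G * (b : KummerCover p μ) := by
    have hmem := (h.ofFixed ⟨G, map_orbitProd h.pow_eq_one _⟩ * b).2
    have := hmul _ hmem 1
    rwa [mul_one, hone, mul_one] at this
  have h8 : h.ofFixed ⟨G, map_orbitProd h.pow_eq_one _⟩ * b =
      ∑ i, (⟨P (c i), hP _⟩ : KummerCover.fixed σ θ h.map_mu) * t i := by
    refine Subtype.ext ?_
    rw [Subring.coe_mul, coe_ofFixed, ← h7, ← hc, map_sum, AddSubmonoidClass.coe_finsetSum]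
    refine Finset.sum_congr rfl fun i _ => ?_
    rw [Subring.coe_mul, mul_comm, hmul _ (t i).2, mul_comm]
  rw [h8]
  exact Ideal.sum_mem _ fun i _ => Ideal.mul_mem_left _ _ (Ideal.subset_span ⟨i, rfl⟩)

/-- The quotient of the Kummer cover is regular at the point. -/
theorem isRegularLocalRing_point [IsDomain S] [IsNoetherianRing S] (hp : p.Prime) {n : ℕ}
    {k : Fin n → ℕ} {y : Fin n → S} (hy : ∀ i, σ (y i) * θ ^ k i = y i)
    (R : Type*) [CommRing R] [IsLocalRing R] [Algebra S R] [hm : m.IsPrime]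
    [IsLocalization.AtPrime R m]
    (hyR : Ideal.span (Set.range fun i => algebraMap S R (y i)) = maximalIdeal R)
    (hn : (n : WithBot ℕ∞) ≤ ringKrullDim R) [hq : h.point.IsPrime] :
    IsRegularLocalRing (Localization.AtPrime h.point) ∧
      IsCoordinates (Localization.AtPrime h.point) (fun i => algebraMap
        (KummerCover.fixed σ θ h.map_mu) _ ⟨_, h.homogeneous_mem_fixed (hy i)⟩) := by
  have := h.isNoetherianRing_fixed hp.one_lt
  have hnoeth : IsNoetherianRing (Localization.AtPrime h.point) :=
    IsLocalization.isNoetherianRing h.point.primeCompl _ inferInstance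
  refine isRegularLocalRing_and_isCoordinates _ ?_ ?_
  · apply le_antisymm
    · rw [Ideal.span_le]
      rintro _ ⟨i, rfl⟩
      refine (IsLocalization.AtPrime.to_map_mem_maximal_iff _ h.point _).mpr ?_
      rw [mem_point]
      change KummerCover.residueHom m h.mu_sub_one_mem (AdjoinRoot.of _ (y i) * _ ^ k i) = 0
      rw [KummerCover.residueHom_of_mul_root_pow, Ideal.Quotient.eq_zero_iff_mem,
        ← IsLocalization.AtPrime.to_map_mem_maximal_iff R m, ← hyR]
      exact Ideal.subset_span ⟨i, rfl⟩
    · rw [← Localization.AtPrime.map_eq_maximalIdeal, Ideal.map_le_iff_le_comap]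
      intro b hb
      obtain ⟨a, ha, hab⟩ := h.exists_mul_mem_span_homogeneous hp hy R hyR hb
      have h1 := Ideal.mem_map_of_mem
        (algebraMap (KummerCover.fixed σ θ h.map_mu) (Localization.AtPrime h.point)) hab
      rw [Ideal.map_span, ← Set.range_comp, map_mul] at h1
      have h2 : h.ofFixed a ∈ h.point.primeCompl := by
        intro h2
        have h3 : a ∈ h.point.comap h.ofFixed := h2
        rw [h.comap_ofFixed_point] at h3
        exact ha h3
      exact (Ideal.unit_mul_mem_iff_mem _
        (IsLocalization.map_units (Localization.AtPrime h.point) ⟨_, h2⟩)).mp h1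
  · rw [IsLocalization.AtPrime.ringKrullDim_eq_height h.point]
    refine hn.trans ?_
    rw [IsLocalization.AtPrime.ringKrullDim_eq_height m R]
    exact WithBot.coe_le_coe.mpr (h.height_le_height_point hp)

end KummerDatum

end KummerDatumRegular

/-! ### Homogeneous lifts of eigenvectors. -/

section KummerDatumEigen

namespace KummerDatum

variable {S : Type u} [CommRing S] {p : ℕ} {σ : S →+* S} {m : Ideal S} {e s θ μ : S}
  (h : KummerDatum p σ m e s θ μ)
include h

/-- Eigenvectors in the cotangent space lift to homogeneous invariants of the Kummer cover. -/
theorem exists_homogeneous_lift [IsDomain S] (hp : p.Prime) {R : Type*} [CommRing R] [IsLocalRing R]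
    [IsDomain R] [CharP (ResidueField R) p] [Algebra S R]
    (hinj : Function.Injective (algebraMap S R)) (hmR : ∀ f, f ∈ m → algebraMap S R f ∈ maximalIdeal R)
    {τ : R →+* R} (hτ : ∀ f, τ (algebraMap S R f) = algebraMap S R (σ f)) (hτp : τ ^ p = 1)
    (hdvd : ∀ f, ∃ z ∈ maximalIdeal R, τ f - f = algebraMap S R e * z)
    {φ : CotangentSpace R →ₗ[ResidueField R] CotangentSpace R}
    (hφ : ∀ y z : maximalIdeal R, τ y - y = algebraMap S R e * z →
      φ ((maximalIdeal R).toCotangent y) = (maximalIdeal R).toCotangent z)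
    {u₁ : R} (hu₁ : IsUnit u₁) (hθ : algebraMap S R θ = 1 + algebraMap S R e * u₁) {k : ℕ} (hk : k < p) {x : S}
    (hx : algebraMap S R x ∈ maximalIdeal R)
    (hφx : φ ((maximalIdeal R).toCotangent ⟨_, hx⟩) =
      -((k * u₁) • (maximalIdeal R).toCotangent ⟨_, hx⟩)) :
    ∃ y, σ y * θ ^ k = y ∧ ∃ hy : algebraMap S R y ∈ maximalIdeal R,
      (maximalIdeal R).toCotangent ⟨_, hy⟩ =
        (-1 : R) ^ (p - 1) • (maximalIdeal R).toCotangent ⟨_, hx⟩ := by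
  obtain ⟨P, hP, -, -, hind⟩ := h.exists_splitting hp.one_lt
  have he := hmR e h.e_mem
  have he0 : algebraMap S R e ≠ 0 := by
    rw [Ne, map_eq_zero_iff _ hinj]
    exact h.e_ne_zero
  have hs0 : algebraMap S R s ≠ 0 := by
    rw [Ne, map_eq_zero_iff _ hinj]
    exact h.s_ne_zero
  have hss : τ (algebraMap S R s) - algebraMap S R s =
      algebraMap S R e * algebraMap S R s * u₁ := by
    rw [hτ, h.map_s, map_mul, hθ]
    ring
  have hres : ∀ f, τ f - f ∈ maximalIdeal R := by
    intro f
    obtain ⟨z, -, hz⟩ := hdvd f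
    rw [hz]
    exact Ideal.mul_mem_right _ _ he
  have hzero : ∀ z ∈ maximalIdeal R, ∀ v : CotangentSpace R, z • v = 0 := by
    intro z hz v
    rw [← algebraMap_smul (ResidueField R) z v]
    have : algebraMap R (ResidueField R) z = 0 := (residue_eq_zero_iff z).mpr hz
    rw [this, zero_smul]
  have hφR : ∀ (r : R) (v : CotangentSpace R), φ (r • v) = r • φ v := by
    intro r v
    rw [← algebraMap_smul (ResidueField R) r v, map_smul, algebraMap_smul]
  -- On the class of x, φ + (k - (p - 1 - j)) u₁ acts as (j + 1) u₁, since the twist by T^k cancels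
  -- the eigenvalue -k u₁. Dividing by (j + 1) u₁ leaves a sign at each step.
  obtain ⟨y, ⟨hy, hyx⟩, hPy⟩ := hind k hk (fun j x' => ∃ hx' : algebraMap S R x' ∈ maximalIdeal R,
      (maximalIdeal R).toCotangent ⟨_, hx'⟩ =
        (-1 : R) ^ j • (maximalIdeal R).toCotangent ⟨_, hx⟩) x ⟨hx, by simp⟩ (by
    rintro j z z' hj ⟨hz, hzx⟩ hstep
    obtain ⟨w, hw, hws⟩ := h.exists_isUnit (j + 1) j.succ_pos hj
    have h1 := congrArg (algebraMap S R) (hstep w hws)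
    obtain ⟨ε, hε, hεs⟩ := exists_pow_map_sub_eq τ hp hτp he0 hu₁ hss hres he
      (fun f => by
        obtain ⟨z, -, hz⟩ := hdvd f
        exact ⟨z, hz⟩) (j + 1)
    have hwR : algebraMap S R w = u₁ * ((j + 1 : ℕ) + ε) := by
      refine mul_left_cancel₀ (mul_ne_zero he0 hs0) ?_
      rw [← hεs, pow_apply_of_apply (algebraMap S R) σ τ hτ, ← map_sub, hws, map_mul, map_mul]
    obtain ⟨hz', hcls⟩ := toCotangent_splitting_step τ (u := algebraMap S R w)
      (x' := algebraMap S R z') (k := k) (a := p - 1 - j) he he0 hθ hdvd hφ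
      (hw.map _) ⟨algebraMap S R z, hz⟩ (by
        rw [hτ]
        simp only [map_mul, map_neg, map_add, map_one, map_sub, map_pow] at h1 ⊢
        exact h1)
    refine ⟨hz', ?_⟩
    set v := (maximalIdeal R).toCotangent ⟨_, hx⟩ with hv
    have hcast : ((p - 1 - j : ℕ) : R) = p - (j + 1 : ℕ) := by
      rw [eq_sub_iff_add_eq, ← Nat.cast_add]
      congr 1
      omega
    have hpm : (p : R) ∈ maximalIdeal R := prime_mem_maximalIdeal
    have hunit := hw.map (algebraMap S R)
    rw [hzx, hφR, hφx] at hcls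
    have h2 : algebraMap S R w • ((-1 : R) ^ (j + 1) • v) =
        -((-1 : R) ^ j • -((k * u₁) • v) + ((k - (p - 1 - j : ℕ)) * u₁) • (-1 : R) ^ j • v) := by
      have h3 : algebraMap S R w • ((-1 : R) ^ (j + 1) • v) -
        -((-1 : R) ^ j • -((k * u₁) • v) + ((k - (p - 1 - j : ℕ)) * u₁) • (-1 : R) ^ j • v) =
        ((-1) ^ (j + 1) * (u₁ * ε + p * u₁)) • v := by
        rw [hwR, hcast]
        module
      rw [hzero _ (Ideal.mul_mem_left _ _ (Ideal.add_mem _ (Ideal.mul_mem_left _ _ hε)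
        (Ideal.mul_mem_right _ _ hpm))), sub_eq_zero] at h3
      exact h3
    rw [← h2] at hcls
    obtain ⟨w', hw'⟩ := hunit
    rw [← hw'] at hcls
    have h4 := congrArg (fun v => (↑w'⁻¹ : R) • v) hcls
    simpa only [smul_smul, Units.inv_mul, one_smul, ← mul_assoc, one_mul] using h4)
  refine ⟨y, ?_, hy, hyx⟩
  -- Invariance of y T^k, after cancelling the unit T^k, is the required relation for y.
  have h5 := hP (AdjoinRoot.of _ x * AdjoinRoot.root _ ^ k)
  rw [hPy, KummerCover.mem_fixed, KummerCover.twist_of_mul_root_pow] at h5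
  have hroot := (KummerCover.isUnit_root (p := p) hp.ne_zero h.isUnit_mu).pow k
  exact KummerCover.of_injective hp.ne_zero (hroot.mul_right_cancel h5)

end KummerDatum

end KummerDatumEigen

/-! ### Compatibility with invariant localization. -/

section KummerLocalization

open Polynomial

/-- If all points off `V(f)` are regular, then the localization away from `f` is regular. -/
theorem isRegularRing_of_isLocalization_away {B B' : Type*} [CommRing B] [CommRing B']
    [Algebra B B'] [IsNoetherianRing B] (f : B) [IsLocalization.Away f B']
    (hreg : ∀ q : PrimeSpectrum B, f ∉ q.asIdeal →
      IsRegularLocalRing (Localization.AtPrime q.asIdeal)) : IsRegularRing B' := by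
  have : IsNoetherianRing B' := IsLocalization.isNoetherianRing (Submonoid.powers f) B' inferInstance
  rw [isRegularRing_iff]
  intro q hq
  have hloc := IsLocalization.isLocalization_isLocalization_atPrime_isLocalization
    (Submonoid.powers f) (Localization.AtPrime q) q
  have hfq : f ∉ q.comap (algebraMap B B') := fun hf => hq.ne_top
    (q.eq_top_of_isUnit_mem hf (IsLocalization.Away.algebraMap_isUnit f))
  have := hreg ⟨q.comap (algebraMap B B'), Ideal.comap_isPrime _ _⟩ hfq
  exact IsRegularLocalRing.of_ringEquiv (IsLocalization.algEquiv
    (q.comap (algebraMap B B')).primeCompl (Localization.AtPrime (q.comap (algebraMap B B')))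
    (Localization.AtPrime q)).toRingEquiv

namespace KummerCover

variable {S S' : Type u} [CommRing S] [CommRing S'] {p : ℕ} {μ θ : S} {μ' θ' : S'}

/-- Base change of the Kummer cover. -/
noncomputable def baseChange (f : S →+* S') (hf : f μ = μ') :
    KummerCover p μ →+* KummerCover p μ' :=
  AdjoinRoot.lift ((AdjoinRoot.of _).comp f) (AdjoinRoot.root _) (by
    rw [eval₂_sub, eval₂_X_pow, eval₂_C, root_pow, RingHom.comp_apply, hf, sub_self])

variable {f : S →+* S'} {hf : f μ = μ'}

theorem baseChange_of (x : S) : baseChange (p := p) f hf (AdjoinRoot.of _ x) = AdjoinRoot.of _ (f x) := by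
  rw [baseChange, AdjoinRoot.lift_of, RingHom.comp_apply]

theorem baseChange_of_mul_root_pow (x : S) (i : ℕ) :
    baseChange (p := p) f hf (AdjoinRoot.of _ x * AdjoinRoot.root _ ^ i) =
      AdjoinRoot.of _ (f x) * AdjoinRoot.root _ ^ i := by
  rw [map_mul, map_pow, baseChange_of, baseChange, AdjoinRoot.lift_root]

theorem baseChange_injective (hp : p ≠ 0) (hinj : Function.Injective f) :
    Function.Injective (baseChange (p := p) f hf) := by
  rw [injective_iff_map_eq_zero]
  intro c hc
  obtain ⟨g, rfl⟩ := exists_eq_sum hp c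
  rw [map_sum] at hc
  simp only [baseChange_of_mul_root_pow] at hc
  have h0 := fun i hi => eq_zero_of_sum_eq_zero hp hc (i := i) hi
  refine Finset.sum_eq_zero fun i hi => ?_
  rw [(map_eq_zero_iff f hinj).mp (h0 i (Finset.mem_range.mp hi)), map_zero, zero_mul]

theorem twist_baseChange {σ : S →+* S} {σ' : S' →+* S'} (hσ : ∀ x, σ' (f x) = f (σ x))
    (hθ : f θ = θ') {hμ : σ μ = θ ^ p * μ} {hμ' : σ' μ' = θ' ^ p * μ'} (c : KummerCover p μ) :
    twist σ' θ' hμ' (baseChange f hf c) = baseChange f hf (twist σ θ hμ c) := by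
  induction c using induction with
  | h x i =>
    rw [baseChange_of_mul_root_pow, twist_of_mul_root_pow, twist_of_mul_root_pow,
      baseChange_of_mul_root_pow, hσ, ← hθ, map_mul f, map_pow f]
  | hadd c d hc hd => simp only [map_add, hc, hd]

end KummerCover

namespace KummerDatum

variable {S S' : Type u} [CommRing S] [CommRing S'] [Algebra S S'] {p : ℕ} {σ : S →+* S}
  {σ' : S' →+* S'} {m : Ideal S} {m' : Ideal S'} {e s θ μ : S} {e' s' θ' μ' : S'}

/-- Formation of the invariants of the Kummer cover commutes with invariant localization, hence
regularity spreads from a neighborhood of the point to the localization. -/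
theorem isRegularRing_fixed_of_isLocalization [IsDomain S] [IsNoetherianRing S] (hp : p.Prime)
    (h : KummerDatum p σ m e s θ μ) (h' : KummerDatum p σ' m' e' s' θ' μ')
    (hσ : ∀ x, σ' (algebraMap S S' x) = algebraMap S S' (σ x))
    (hθ : algebraMap S S' θ = θ') (hμ : algebraMap S S' μ = μ')
    (a : fixedSubring σ) [IsLocalization.Away (a : S) S'] (ha : (a : S) ≠ 0)
    (hreg : ∀ q : PrimeSpectrum (KummerCover.fixed σ θ h.map_mu), h.ofFixed a ∉ q.asIdeal →
      IsRegularLocalRing (Localization.AtPrime q.asIdeal)) :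
    IsRegularRing (KummerCover.fixed σ' θ' h'.map_mu) := by
  have hinj : Function.Injective (algebraMap S S') :=
    IsLocalization.injective S' (powers_le_nonZeroDivisors_of_noZeroDivisors ha)
  have hp0 := hp.ne_zero
  let ψ := KummerCover.baseChange (p := p) (algebraMap S S') hμ
  have hψinj : Function.Injective ψ := KummerCover.baseChange_injective hp0 hinj
  have hψ : ∀ c, KummerCover.twist σ' θ' h'.map_mu (ψ c) = ψ (KummerCover.twist σ θ h.map_mu c) :=
    KummerCover.twist_baseChange hσ hθ
  let Ψ : KummerCover.fixed σ θ h.map_mu →+* KummerCover.fixed σ' θ' h'.map_mu :=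
    (ψ.comp (KummerCover.fixed σ θ h.map_mu).subtype).codRestrict _ fun b => by
      rw [KummerCover.mem_fixed, RingHom.comp_apply, hψ]
      exact congrArg ψ b.2
  have hΨ : ∀ b, ((Ψ b : KummerCover.fixed σ' θ' h'.map_mu) : KummerCover p μ') = ψ b := fun _ => rfl
  let := Ψ.toAlgebra
  have := h.isNoetherianRing_fixed hp.one_lt
  have hau : IsUnit (algebraMap S S' a) := IsLocalization.Away.algebraMap_isUnit (a : S)
  have hσa : σ' (algebraMap S S' a) = algebraMap S S' a := by
    rw [hσ]
    exact congrArg _ a.2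
  have hloc : IsLocalization.Away (h.ofFixed a) (KummerCover.fixed σ' θ' h'.map_mu) := by
    refine (isLocalization_iff_isLocalizationMap _ _).mpr ⟨?_, ?_, ?_⟩
    · rintro ⟨_, i, rfl⟩
      rw [map_pow]
      refine IsUnit.pow _ ?_
      obtain ⟨w, hw⟩ := hau
      have hwσ : σ' (↑w⁻¹ : S') = ↑w⁻¹ := by
        have h1 : (w : S') * σ' ↑w⁻¹ = 1 := by
          conv_lhs => rw [hw, ← hσa, ← hw, ← map_mul, Units.mul_inv, map_one]
        rw [← Units.inv_mul_cancel_left w (σ' _), h1, mul_one]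
      refine IsUnit.of_mul_eq_one ⟨AdjoinRoot.of _ (↑w⁻¹ : S'), ?_⟩ (Subtype.ext ?_)
      · rw [KummerCover.mem_fixed, KummerCover.twist_of, hwσ]
      · change ψ (AdjoinRoot.of _ (a : S)) * AdjoinRoot.of _ (↑w⁻¹ : S') = 1
        rw [KummerCover.baseChange_of, ← map_mul, ← hw, Units.mul_inv, map_one]
    -- A power of a clears the denominators of all p coefficients. The resulting element is
    -- invariant because a is and the base change is injective.
    · intro b
      obtain ⟨g, hg, hbg⟩ := h'.exists_eq_sum_of_mem_fixed hp0 b.2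
      obtain ⟨⟨d, N, hd⟩, hN⟩ := IsLocalization.exist_integer_multiples
        (Submonoid.powers (a : S)) (Finset.range p) g
      replace hd : (a : S) ^ N = d := hd
      have hN' : ∀ i, ∃ x : S, i < p → algebraMap S S' x = algebraMap S S' a ^ N * g i := by
        intro i
        by_cases hi : i < p
        · obtain ⟨x, hx⟩ := hN i (Finset.mem_range.mpr hi)
          refine ⟨x, fun _ => ?_⟩
          rw [← map_pow, hd, ← Algebra.smul_def]
          exact hx
        · exact ⟨0, fun h => absurd h hi⟩
      choose x hx using hN'
      let c : KummerCover p μ := ∑ i ∈ Finset.range p, AdjoinRoot.of _ (x i) * AdjoinRoot.root _ ^ i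
      have hψc : ψ c = b * ψ (AdjoinRoot.of _ (a : S)) ^ N := by
        change ψ (∑ i ∈ Finset.range p, _) = _
        rw [map_sum, hbg, Finset.sum_mul]
        refine Finset.sum_congr rfl fun i hi => ?_
        rw [KummerCover.baseChange_of_mul_root_pow, KummerCover.baseChange_of,
          hx i (Finset.mem_range.mp hi), map_mul, map_pow]
        ring
      have hc : c ∈ KummerCover.fixed σ θ h.map_mu := by
        rw [KummerCover.mem_fixed]
        refine hψinj ?_
        rw [← hψ, hψc, map_mul, map_pow, KummerCover.mem_fixed.mp b.2, hψ, KummerCover.twist_of]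
        congr 4
        exact a.2
      exact ⟨(⟨c, hc⟩, ⟨_, N, rfl⟩), Subtype.ext (by
        rw [Subring.coe_mul]
        change _ = ψ c
        rw [hψc, map_pow, SubmonoidClass.coe_pow]
        rfl)⟩
    · intro b b' hbb
      have : b = b' := Subtype.ext (hψinj (congrArg Subtype.val hbb))
      exact ⟨1, by rw [this]⟩
  exact isRegularRing_of_isLocalization_away (h.ofFixed a) hreg

end KummerDatum

end KummerLocalization

/-! ### Construction and descent of Kummer data. -/

section KummerDatumConstruction

/-- Let Λ_j be the product of τ^i(θ) for i < j. Then τ(Λ_j) θ = Λ_(j+1) and Λ_p = Λ_0 = 1, so the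
inverse of Λ_0 ⋯ Λ_(p-1) works. For θ = τ(s)/s it is s^p divided by the norm of s. -/
theorem exists_kummer_unit {R : Type*} [CommRing R] [IsLocalRing R] {p : ℕ} {τ : R →+* R} {θ : R}
    (hres : ∀ f, τ f - f ∈ maximalIdeal R) (hθ1 : θ - 1 ∈ maximalIdeal R)
    (hprod : ∏ i ∈ Finset.range p, (τ ^ i) θ = 1) :
    ∃ μ, IsUnit μ ∧ μ - 1 ∈ maximalIdeal R ∧ τ μ = θ ^ p * μ := by
  let Λ : ℕ → R := fun j => ∏ i ∈ Finset.range j, (τ ^ i) θ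
  have hΛ1 : ∀ j, residue R (Λ j) = 1 := by
    have h1 : ∀ i, residue R ((τ ^ i) θ) = 1 := by
      intro i
      induction i with
      | zero =>
        have := (residue_eq_zero_iff _).mpr hθ1
        rw [map_sub, map_one, sub_eq_zero] at this
        exact this
      | succ i ih =>
        have := (residue_eq_zero_iff _).mpr (hres ((τ ^ i) θ))
        rw [map_sub, sub_eq_zero, ih] at this
        rw [ringHom_pow_succ_apply, this]
    intro j
    rw [map_prod]
    exact Finset.prod_eq_one fun i _ => h1 i
  have hM1 : residue R (∏ j ∈ Finset.range p, Λ j) = 1 := by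
    rw [map_prod]
    exact Finset.prod_eq_one fun j _ => hΛ1 j
  have hM : IsUnit (∏ j ∈ Finset.range p, Λ j) := by
    rw [← residue_ne_zero_iff_isUnit, hM1]
    exact one_ne_zero
  have hstep : ∀ j, τ (Λ j) * θ = Λ (j + 1) := by
    intro j
    change τ (∏ i ∈ Finset.range j, (τ ^ i) θ) * θ = ∏ i ∈ Finset.range (j + 1), (τ ^ i) θ
    rw [Finset.prod_range_succ', map_prod]
    simp only [ringHom_pow_succ_apply]
    rfl
  have hτM : τ (∏ j ∈ Finset.range p, Λ j) * θ ^ p = ∏ j ∈ Finset.range p, Λ j := by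
    rw [map_prod]
    conv_lhs => rw [← Finset.card_range p, ← Finset.prod_const, Finset.card_range,
      ← Finset.prod_mul_distrib]
    simp only [hstep]
    have h0 : Λ 0 = 1 := Finset.prod_range_zero _
    have h1 := Finset.prod_range_succ Λ p
    rw [Finset.prod_range_succ', h0, mul_one] at h1
    rw [h1]
    change _ * ∏ i ∈ Finset.range p, (τ ^ i) θ = _
    rw [hprod, mul_one]
  obtain ⟨w, hw⟩ := hM
  rw [← hw] at hτM hM1
  have hinv : residue R (↑w⁻¹ : R) = 1 := by
    have := congrArg (residue R) (Units.mul_inv w)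
    rwa [map_mul, hM1, one_mul, map_one] at this
  refine ⟨↑w⁻¹, Units.isUnit _, ?_, ?_⟩
  · rw [← residue_eq_zero_iff, map_sub, hinv, map_one, sub_self]
  · have h1 : τ (w : R) * τ (↑w⁻¹ : R) = 1 := by rw [← map_mul, Units.mul_inv, map_one]
    have h2 : τ (w : R) * (θ ^ p * ↑w⁻¹) = 1 := by rw [← mul_assoc, hτM, Units.mul_inv]
    have h3 : IsUnit (τ (w : R)) := w.isUnit.map τ
    exact h3.mul_left_cancel (h1.trans h2.symm)

/-- The Kummer datum at a fixed point of the action. -/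
theorem exists_kummerDatum {R : Type u} [CommRing R] [IsLocalRing R] [IsDomain R] {p : ℕ}
    (hp : p.Prime) [CharP (ResidueField R) p] {τ : R →+* R} (hτ : τ ^ p = 1) {e s u₁ : R}
    (he : e ∈ maximalIdeal R) (he0 : e ≠ 0) (hs0 : s ≠ 0) (hu₁ : IsUnit u₁)
    (hs : τ s - s = e * s * u₁) (hdvd : ∀ f, ∃ z ∈ maximalIdeal R, τ f - f = e * z) :
    ∃ μ, KummerDatum p τ (maximalIdeal R) e s (1 + e * u₁) μ := by
  have hres : ∀ f, τ f - f ∈ maximalIdeal R := by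
    intro f
    obtain ⟨z, -, hz⟩ := hdvd f
    rw [hz]
    exact Ideal.mul_mem_right _ _ he
  have hdvd' : ∀ f, e ∣ τ f - f := fun f => by
    obtain ⟨z, -, hz⟩ := hdvd f
    exact ⟨z, hz⟩
  have hθ1 : (1 + e * u₁) - 1 ∈ maximalIdeal R := by
    rw [add_sub_cancel_left]
    exact Ideal.mul_mem_right _ _ he
  have hθ : IsUnit (1 + e * u₁) := by
    rw [← residue_ne_zero_iff_isUnit]
    have := (residue_eq_zero_iff _).mpr hθ1
    rw [map_sub, sub_eq_zero] at this
    rw [this, map_one]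
    exact one_ne_zero
  have hmap : τ s = (1 + e * u₁) * s := by linear_combination hs
  have hpow : ∀ j, (τ ^ j) s = (∏ i ∈ Finset.range j, (τ ^ i) (1 + e * u₁)) * s := by
    intro j
    induction j with
    | zero => rw [Finset.prod_range_zero, one_mul]; rfl
    | succ j ih =>
      rw [ringHom_pow_succ_apply', hmap, map_mul, ih, Finset.prod_range_succ]
      ring
  have hprod : ∏ i ∈ Finset.range p, (τ ^ i) (1 + e * u₁) = 1 := by
    refine mul_right_cancel₀ hs0 ?_
    rw [← hpow, hτ, one_mul]
    rfl
  obtain ⟨μ, hμ, hμ1, hτμ⟩ := exists_kummer_unit hres hθ1 hprod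
  refine ⟨μ, hτ, maximalIdeal.isMaximal R, prime_mem_maximalIdeal, he, he0, hs0, hθ, hmap, hdvd',
    fun f g hfg => ?_, fun j hj hjp => ?_, hμ, hμ1, hτμ⟩
  · obtain ⟨z, hz, hfz⟩ := hdvd f
    rwa [mul_left_cancel₀ he0 (hfg.symm.trans hfz)]
  · obtain ⟨z, hz, hjz⟩ := exists_pow_map_sub_eq τ hp hτ he0 hu₁ hs hres he hdvd' j
    exact ⟨_, hu₁.mul (isUnit_natCast_add hj hjp hz), hjz⟩

namespace KummerDatum

/-- Descent of a Kummer datum to a subring containing the necessary elements. -/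
theorem of_injective {S R : Type u} [CommRing S] [CommRing R] [IsDomain R] {p : ℕ}
    {σ : S →+* S} {τ : R →+* R}
    {m : Ideal S} {M : Ideal R} {f : S →+* R} (hinj : Function.Injective f)
    (hσ : ∀ x, τ (f x) = f (σ x)) (hm : m.IsMaximal) (hmM : ∀ x, x ∈ m ↔ f x ∈ M) {e s θ μ : S}
    (h : KummerDatum p τ M (f e) (f s) (f θ) (f μ)) (hdvd : ∀ x, e ∣ σ x - x) (hθ : IsUnit θ)
    (hμ : IsUnit μ) (hu : ∀ j, 0 < j → j < p → ∀ u, (τ ^ j) (f s) - f s = f e * f s * u →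
      ∃ w, IsUnit w ∧ f w = u) : KummerDatum p σ m e s θ μ where
  pow_eq_one := by
    refine RingHom.ext fun x => hinj ?_
    rw [← pow_apply_of_apply f σ τ hσ, h.pow_eq_one]
    rfl
  isMaximal := hm
  natCast_mem := by
    rw [hmM, map_natCast]
    exact h.natCast_mem
  e_mem := (hmM e).mpr h.e_mem
  e_ne_zero := fun h0 => h.e_ne_zero (by rw [h0, map_zero])
  s_ne_zero := fun h0 => h.s_ne_zero (by rw [h0, map_zero])
  isUnit_theta := hθ
  map_s := hinj (by rw [← hσ, h.map_s, map_mul])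
  dvd_sub := hdvd
  mem_of_sub_eq x y hxy := by
    rw [hmM]
    refine h.mem_of_sub_eq (f x) (f y) ?_
    rw [hσ, ← map_sub, hxy, map_mul]
  exists_isUnit j hj hjp := by
    obtain ⟨u, -, hus⟩ := h.exists_isUnit j hj hjp
    obtain ⟨w, hw, rfl⟩ := hu j hj hjp u hus
    refine ⟨w, hw, hinj ?_⟩
    rw [map_sub, ← pow_apply_of_apply f σ τ hσ, hus, map_mul, map_mul]
  isUnit_mu := hμ
  mu_sub_one_mem := by
    rw [hmM, map_sub, map_one]
    exact h.mu_sub_one_mem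
  map_mu := hinj (by rw [← hσ, h.map_mu, map_mul, map_pow])

variable {S : Type u} [CommRing S] {p : ℕ} {σ : S →+* S} {m : Ideal S} {e s θ μ : S}

theorem proj_zero_ofFixed [NeZero p] (h : KummerDatum p σ m e s θ μ) (r : ZMod p) (a : fixedSubring σ) :
    (KummerCover.fixedWeights r).proj 0 (h.ofFixed a) = h.ofFixed a :=
  Subtype.ext (KummerCover.proj_of r (a : S))

theorem exists_ofFixed_eq [NeZero p] (h : KummerDatum p σ m e s θ μ) (hp : p.Prime) {r : ZMod p} (hr : r ≠ 0)
    {b : KummerCover.fixed σ θ h.map_mu} (hb : (KummerCover.fixedWeights r).proj 0 b = b) :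
    ∃ a, h.ofFixed a = b := by
  obtain ⟨f, hf⟩ := KummerCover.proj_zero_mem_range hp hr (b : KummerCover p μ)
  have hbf : (b : KummerCover p μ) = AdjoinRoot.of _ f := by
    rw [← hf, ← KummerCover.coe_fixedWeights_proj, hb]
  refine ⟨⟨f, ?_⟩, Subtype.ext hbf.symm⟩
  have hb' := KummerCover.mem_fixed.mp b.2
  rw [hbf, KummerCover.twist_of] at hb'
  exact KummerCover.of_injective hp.ne_zero hb'

theorem ofFixed_injective (h : KummerDatum p σ m e s θ μ) (hp : p ≠ 0) :
    Function.Injective h.ofFixed := fun _ _ hab =>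
  Subtype.ext (KummerCover.of_injective hp (congrArg Subtype.val hab))

/-- The invariants of the action of `μ_p` are the invariants of the base. -/
noncomputable def fixedEquivInvariants [NeZero p] (h : KummerDatum p σ m e s θ μ) (hp : p.Prime) {r : ZMod p}
    (hr : r ≠ 0) : fixedSubring σ ≃+* (KummerCover.fixedWeights (hμ := h.map_mu) r).toMuAction.invariants :=
  RingEquiv.ofBijective (h.ofFixed.codRestrict _ fun a =>
    (KummerCover.fixedWeights r).mem_invariants_toMuAction.mpr (h.proj_zero_ofFixed r a))
  ⟨fun _ _ hab => h.ofFixed_injective hp.ne_zero (congrArg Subtype.val hab), fun b => by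
    obtain ⟨a, ha⟩ := h.exists_ofFixed_eq hp hr
      ((KummerCover.fixedWeights r).mem_invariants_toMuAction.mp b.2)
    exact ⟨a, Subtype.ext ha⟩⟩

end KummerDatum

end KummerDatumConstruction

/-! ### The action on functions over invariant opens. -/

section SectionAction

variable {G : Type} [Group G] {U Y : Scheme.{u}} {ρ : G →* Aut U} {π : U ⟶ Y}

/-- The action of a group on the functions on an invariant open subset. -/
noncomputable def sectionAction (hinv : ∀ g, (ρ g).hom ≫ π = π) (V : Y.Opens) :
    G →* (Γ(U, π ⁻¹ᵁ V) →+* Γ(U, π ⁻¹ᵁ V)) where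
  toFun g := ((ρ g⁻¹).hom.appLE (π ⁻¹ᵁ V) (π ⁻¹ᵁ V) (le_preimage_of_invariant hinv g⁻¹ V)).hom
  map_one' := by
    have h1 : (ρ (1 : G)⁻¹).hom = 𝟙 U := by rw [inv_one, map_one]; rfl
    ext f
    have h2 : ∀ (a : U ⟶ U) (ha : a = 𝟙 U) (hle : π ⁻¹ᵁ V ≤ a ⁻¹ᵁ (π ⁻¹ᵁ V)),
        a.appLE (π ⁻¹ᵁ V) (π ⁻¹ᵁ V) hle f = f := by
      rintro _ rfl hle
      rw [Scheme.Hom.appLE, Scheme.Hom.id_app]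
      exact congrArg (fun t : Γ(U, π ⁻¹ᵁ V) ⟶ Γ(U, π ⁻¹ᵁ V) => t.hom f) (U.presheaf.map_id _)
    exact h2 _ h1 _
  map_mul' g h := by
    have h1 : (ρ (g * h)⁻¹).hom = (ρ g⁻¹).hom ≫ (ρ h⁻¹).hom := by
      rw [mul_inv_rev, map_mul]; rfl
    ext f
    change _ = (ConcreteCategory.hom (((ρ h⁻¹).hom.appLE (π ⁻¹ᵁ V) (π ⁻¹ᵁ V) _) ≫
      ((ρ g⁻¹).hom.appLE (π ⁻¹ᵁ V) (π ⁻¹ᵁ V) _))) f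
    rw [Scheme.Hom.appLE_comp_appLE]
    simp only [h1]

theorem sectionAction_apply (hinv : ∀ g, (ρ g).hom ≫ π = π) (V : Y.Opens) (g : G)
    (f : Γ(U, π ⁻¹ᵁ V)) : sectionAction hinv V g f =
      (ρ g⁻¹).hom.appLE (π ⁻¹ᵁ V) (π ⁻¹ᵁ V) (le_preimage_of_invariant hinv g⁻¹ V) f := rfl

theorem sectionAction_res (hinv : ∀ g, (ρ g).hom ≫ π = π) {V V' : Y.Opens} (hV : V' ≤ V) (g : G)
    (f : Γ(U, π ⁻¹ᵁ V)) :
    sectionAction hinv V' g (U.presheaf.map (homOfLE (π.preimage_mono hV)).op f) =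
      U.presheaf.map (homOfLE (π.preimage_mono hV)).op (sectionAction hinv V g f) := by
  rw [sectionAction_apply, sectionAction_apply, ← CommRingCat.comp_apply, ← CommRingCat.comp_apply,
    Scheme.Hom.map_appLE, Scheme.Hom.appLE_map]

theorem germ_sectionAction (hinv : ∀ g, (ρ g).hom ≫ π = π) {V : Y.Opens} {P : U}
    (hP : ∀ g, (ρ g).hom P = P) (hPV : P ∈ π ⁻¹ᵁ V) (g : G) (f : Γ(U, π ⁻¹ᵁ V)) :
    stalkAction ρ P hP g (U.presheaf.germ _ P hPV f) =
      U.presheaf.germ _ P hPV (sectionAction hinv V g f) := by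
  have h1 : (ρ g⁻¹).hom P ∈ π ⁻¹ᵁ V := by rw [hP]; exact hPV
  change (ρ g⁻¹).hom.stalkMap P (U.presheaf.stalkSpecializes _ (U.presheaf.germ _ P hPV f)) = _
  rw [TopCat.Presheaf.germ_stalkSpecializes_apply, Scheme.Hom.germ_stalkMap_apply,
    sectionAction_apply, Scheme.Hom.appLE, CommRingCat.comp_apply, TopCat.Presheaf.germ_res_apply]

theorem sectionAction_app (hinv : ∀ g, (ρ g).hom ≫ π = π) (V : Y.Opens) (g : G) (f : Γ(Y, V)) :
    sectionAction hinv V g (π.app V f) = π.app V f := by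
  rw [sectionAction_apply, ← CommRingCat.comp_apply, Scheme.Hom.app_eq_appLE,
    Scheme.Hom.appLE_comp_appLE]
  simp only [hinv]

theorem IsGroupQuotient.exists_app_eq (hπ : IsGroupQuotient ρ π) {g : G}
    (hg : ∀ g', g' ∈ Subgroup.zpowers g) [Finite G] {V : Y.Opens} {f : Γ(U, π ⁻¹ᵁ V)}
    (hf : sectionAction hπ.invariant V g f = f) : ∃ f', π.app V f' = f := by
  refine hπ.mem_range_app V f fun g' => ?_
  obtain ⟨n, hn⟩ := mem_powers_iff_mem_zpowers.mpr (hg g'⁻¹)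
  have h1 : sectionAction hπ.invariant V g'⁻¹ f = f := by
    rw [← hn]
    change sectionAction hπ.invariant V (g ^ n) f = f
    rw [map_pow]
    clear hn
    induction n with
    | zero => rfl
    | succ n ih => rw [ringHom_pow_succ_apply, ih, hf]
  rw [sectionAction_apply] at h1
  simpa only [inv_inv] using h1

end SectionAction

/-! ### Invariant affine neighborhoods of a fixed point. -/

section AffineNeighborhood

variable {G : Type} [Group G] [Finite G] {U Y : Scheme.{u}} {ρ : G →* Aut U} {π : U ⟶ Y}

/-- The points whose whole fibre lies in W form an open set: its preimage is the finite intersection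
of the translates of W. -/
theorem IsGroupQuotient.exists_opens_preimage_le (hπ : IsGroupQuotient ρ π) {P : U}
    (hP : ∀ g, (ρ g).hom P = P) {W : U.Opens} (hPW : P ∈ W) :
    ∃ V : Y.Opens, π P ∈ V ∧ π ⁻¹ᵁ V ≤ W := by
  have hpre : π ⁻¹' {y | ∀ x, π x = y → x ∈ W} = ⋂ g, (ρ g).hom ⁻¹' (W : Set U) := by
    ext x
    simp only [Set.mem_preimage, Set.mem_ofPred_eq, Set.mem_iInter]
    constructor
    · intro h g
      refine h _ ?_
      rw [← Scheme.Hom.comp_apply, hπ.invariant]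
    · intro h x' hx'
      obtain ⟨g, rfl⟩ := hπ.orbit x x' hx'.symm
      exact h g
  have hopen : IsOpen {y : Y | ∀ x, π x = y → x ∈ W} := by
    rw [← hπ.isQuotientMap.isOpen_preimage, hpre]
    exact isOpen_iInter_of_finite fun g => W.2.preimage (ρ g).hom.continuous
  refine ⟨⟨_, hopen⟩, ?_, fun x hx => hx x rfl⟩
  intro x hx
  obtain ⟨g, rfl⟩ := hπ.orbit P x hx.symm
  rw [hP]
  exact hPW

/-- The map to the quotient is not assumed affine. The norm of a function f on an affine W around P
descends to a function a on an affine open of the quotient, and the preimage of D(a) is basic open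
in the affine D(f). -/
theorem IsGroupQuotient.exists_affine_of_mem (hπ : IsGroupQuotient ρ π) {g : G}
    (hg : ∀ g', g' ∈ Subgroup.zpowers g) {P : U} (hP : ∀ g, (ρ g).hom P = P) :
    ∃ V : Y.Opens, π P ∈ V ∧ IsAffineOpen V ∧ IsAffineOpen (π ⁻¹ᵁ V) := by
  obtain ⟨_, ⟨W, hW, rfl⟩, hPW, -⟩ :=
    U.isBasis_affineOpens.exists_subset_of_mem_open (Set.mem_univ P) isOpen_univ
  obtain ⟨V₁, hPV₁, hV₁⟩ := hπ.exists_opens_preimage_le hP hPW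
  obtain ⟨_, ⟨V₀, hV₀, rfl⟩, hPV₀, hV₀₁⟩ :=
    Y.isBasis_affineOpens.exists_subset_of_mem_open hPV₁ V₁.2
  replace hPV₀ : P ∈ π ⁻¹ᵁ V₀ := hPV₀
  have hle : π ⁻¹ᵁ V₀ ≤ W := (π.preimage_mono hV₀₁).trans hV₁
  obtain ⟨f, hf, hPf⟩ := hW.exists_basicOpen_le (V := π ⁻¹ᵁ V₀) ⟨P, hPV₀⟩ hPW
  let f₀ : Γ(U, π ⁻¹ᵁ V₀) := U.presheaf.map (homOfLE hle).op f
  let σ := sectionAction hπ.invariant V₀ g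
  have hσ : σ ^ Nat.card G = 1 := by
    rw [← map_pow, pow_card_eq_one', map_one]
  obtain ⟨a, ha⟩ := hπ.exists_app_eq hg (map_orbitProd hσ f₀)
  -- P is fixed, so every conjugate of f is a unit there.
  have hunit : IsUnit (U.presheaf.germ (π ⁻¹ᵁ V₀) P hPV₀ (orbitProd σ (Nat.card G) f₀)) := by
    have h0 : IsUnit (U.presheaf.germ (π ⁻¹ᵁ V₀) P hPV₀ f₀) := by
      change IsUnit (U.presheaf.germ (π ⁻¹ᵁ V₀) P hPV₀ (U.presheaf.map (homOfLE hle).op f))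
      rw [TopCat.Presheaf.germ_res_apply]
      exact (U.mem_basicOpen f P hPW).mp hPf
    rw [orbitProd, map_prod, IsUnit.prod_iff]
    intro j _
    have h1 : σ ^ j = sectionAction hπ.invariant V₀ (g ^ j) := (map_pow _ _ _).symm
    rw [h1, ← germ_sectionAction hπ.invariant hP hPV₀]
    exact h0.map _
  have hpre : π ⁻¹ᵁ Y.basicOpen a = U.basicOpen (orbitProd σ (Nat.card G) f₀) := by
    rw [Scheme.preimage_basicOpen, ha]
  refine ⟨Y.basicOpen a, ?_, hV₀.basicOpen a, ?_⟩
  · change P ∈ π ⁻¹ᵁ Y.basicOpen a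
    rw [hpre, U.mem_basicOpen _ P hPV₀]
    exact hunit
  · obtain ⟨d, hd⟩ := dvd_orbitProd σ (Nat.card_pos (α := G)) f₀
    have hle' : U.basicOpen (orbitProd σ (Nat.card G) f₀) ≤ U.basicOpen f := by
      rw [hd, Scheme.basicOpen_mul, Scheme.basicOpen_res]
      exact inf_le_left.trans inf_le_right
    have h2 : U.basicOpen (U.presheaf.map (homOfLE hf).op (orbitProd σ (Nat.card G) f₀)) =
        U.basicOpen (orbitProd σ (Nat.card G) f₀) := by
      rw [Scheme.basicOpen_res]
      exact inf_eq_right.mpr hle'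
    rw [hpre, ← h2]
    exact (hW.basicOpen f).basicOpen _

end AffineNeighborhood

/-! ### Spreading out from the local ring. -/

section SpreadingOut

variable {S : Type*} [CommRing S]

/-- The kernel of localization is finitely generated, so finitely many denominators and annihilators
suffice; the norm makes their product invariant. -/
theorem exists_fixed_denominator {R : Type*} [CommRing R] [Algebra S R] [IsNoetherianRing S] {p : ℕ}
    (hp : 0 < p) {σ : S →+* S} (hσ : σ ^ p = 1) {m : Ideal S} [hm : m.IsPrime]
    (hmσ : ∀ c, σ c - c ∈ m) [IsLocalization.AtPrime R m] (F : Finset R) :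
    ∃ a, σ a = a ∧ a ∉ m ∧ (∀ x, algebraMap S R x = 0 → a * x = 0) ∧
      ∀ r ∈ F, ∃ x, algebraMap S R a * r = algebraMap S R x := by
  classical
  obtain ⟨T, hT⟩ := IsNoetherian.noetherian (RingHom.ker (algebraMap S R))
  have h1 : ∀ t : S, ∃ g, g ∉ m ∧ (t ∈ T → g * t = 0) := by
    intro t
    by_cases ht : t ∈ T
    · have h2 : algebraMap S R t = algebraMap S R 0 := by
        rw [map_zero]
        exact (hT ▸ Ideal.subset_span ht : t ∈ RingHom.ker (algebraMap S R))
      obtain ⟨g, hg⟩ := (IsLocalization.eq_iff_exists m.primeCompl R).mp h2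
      exact ⟨g, g.2, fun _ => by rw [hg, mul_zero]⟩
    · exact ⟨1, fun h => hm.ne_top ((Ideal.eq_top_iff_one m).mpr h), fun h => absurd h ht⟩
  choose g hg hgt using h1
  obtain ⟨d, hd⟩ := IsLocalization.exist_integer_multiples_of_finset m.primeCompl F
  have hprod : (d : S) * ∏ t ∈ T, g t ∉ m := by
    intro h
    rcases hm.mem_or_mem h with h | h
    · exact d.2 h
    · rw [hm.prod_mem_iff] at h
      obtain ⟨t, -, ht⟩ := h
      exact hg t ht
  obtain ⟨w, hw⟩ := dvd_orbitProd σ hp ((d : S) * ∏ t ∈ T, g t)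
  refine ⟨orbitProd σ p ((d : S) * ∏ t ∈ T, g t), map_orbitProd hσ _, orbitProd_notMem hmσ hprod,
    ?_, ?_⟩
  · intro x hx
    have hx' : x ∈ Ideal.span (T : Set S) := by
      change x ∈ Submodule.span S (T : Set S)
      rw [hT]
      exact hx
    refine Submodule.span_induction
      (p := fun x _ => orbitProd σ p ((d : S) * ∏ t ∈ T, g t) * x = 0) ?_ ?_ ?_ ?_ hx'
    · intro t ht
      obtain ⟨v, hv⟩ := Finset.dvd_prod_of_mem g ht
      rw [hw, hv]
      linear_combination d * v * w * hgt t ht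
    · rw [mul_zero]
    · intro x y _ _ hx hy
      rw [mul_add, hx, hy, add_zero]
    · intro c x _ hx
      rw [smul_eq_mul, mul_left_comm, hx, mul_zero]
  · intro r hr
    obtain ⟨x, hx⟩ := hd r hr
    refine ⟨(∏ t ∈ T, g t) * w * x, ?_⟩
    have hx' : algebraMap S R x = algebraMap S R d * r := by
      rw [hx, ← Algebra.smul_def]
    rw [hw, map_mul, map_mul, map_mul, map_mul, hx']
    ring

variable {S' : Type*} [CommRing S'] [Algebra S S'] (a : S) [IsLocalization.Away a S']

theorem exists_mul_pow_eq (y : S') :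
    ∃ (x : S) (n : ℕ), y * algebraMap S S' a ^ n = algebraMap S S' x := by
  obtain ⟨⟨x, ⟨_, n, rfl⟩⟩, hx⟩ := IsLocalization.surj (Submonoid.powers a) y
  exact ⟨x, n, by rw [← map_pow]; exact hx⟩

theorem dvd_sub_of_isLocalization_away {σ : S →+* S} (ha : σ a = a) {σ' : S' →+* S'}
    (hσ : ∀ x, σ' (algebraMap S S' x) = algebraMap S S' (σ x)) {e : S'}
    (he : ∀ x, e ∣ algebraMap S S' (σ x - x)) (y : S') : e ∣ σ' y - y := by
  obtain ⟨x, n, hx⟩ := exists_mul_pow_eq a y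
  have hu : IsUnit (algebraMap S S' a ^ n) := (IsLocalization.Away.algebraMap_isUnit a).pow n
  have h1 : algebraMap S S' (σ x - x) = (σ' y - y) * algebraMap S S' a ^ n := by
    rw [map_sub, ← hσ, ← hx, map_mul, map_pow, hσ, ha, sub_mul]
  rw [← hu.dvd_mul_right, ← h1]
  exact he x

variable {R : Type*} [CommRing R] [Algebra S R] [Algebra S' R] [IsScalarTower S S' R]

theorem injective_of_isLocalization_away
    (h : ∀ x, algebraMap S R x = 0 → a * x = 0) : Function.Injective (algebraMap S' R) := by
  have hu : IsUnit (algebraMap S S' a) := IsLocalization.Away.algebraMap_isUnit a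
  rw [injective_iff_map_eq_zero]
  intro y hy
  obtain ⟨x, n, hx⟩ := exists_mul_pow_eq a y
  have h1 : algebraMap S R x = 0 := by
    rw [IsScalarTower.algebraMap_apply S S' R, ← hx, map_mul, hy, zero_mul]
  have h2 := congrArg (algebraMap S S') (h x h1)
  rw [map_mul, map_zero, ← hx, mul_left_comm, ← pow_succ'] at h2
  exact ((hu.pow (n + 1)).mul_left_eq_zero).mp h2

/-- After an invariant localization, finitely many elements of the local ring and the divisibility
of `σ f - f` by `e` spread out. -/
theorem exists_spreading [IsNoetherianRing S] {p : ℕ} (hp : 0 < p) {σ : S →+* S} (hσ : σ ^ p = 1)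
    {m : Ideal S} [hm : m.IsPrime] (hmσ : ∀ c, σ c - c ∈ m) [IsLocalization.AtPrime R m]
    {e : R} (he : ∀ x, e ∣ algebraMap S R (σ x - x)) (F : Finset R) :
    ∃ a, σ a = a ∧ a ∉ m ∧ ∀ (S' : Type u) [CommRing S'] [Algebra S S'] [Algebra S' R]
      [IsScalarTower S S' R] [IsLocalization.Away a S'] (σ' : S' →+* S'),
      (∀ x, σ' (algebraMap S S' x) = algebraMap S S' (σ x)) →
      Function.Injective (algebraMap S' R) ∧
      (∀ r ∈ F, ∃ x, algebraMap S' R x = r ∧ (IsUnit r → IsUnit x)) ∧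
      ∃ e', algebraMap S' R e' = e ∧ ∀ f, e' ∣ σ' f - f := by
  classical
  -- The ideal of all σ x - x has finitely many generators of this form, so divisibility by e
  -- involves only finitely many quotients.
  obtain ⟨T, hT, hTspan⟩ := Submodule.fg_span_iff_fg_span_finset_subset
    (Set.range fun x => σ x - x) |>.mp (IsNoetherian.noetherian (R := S)
      (Ideal.span (Set.range fun x => σ x - x)))
  have hTe : ∀ t : S, ∃ r, t ∈ T → algebraMap S R t = e * r := by
    intro t
    by_cases ht : t ∈ T
    · obtain ⟨x, rfl⟩ := hT ht
      obtain ⟨r, hr⟩ := he x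
      exact ⟨r, fun _ => hr⟩
    · exact ⟨0, fun h => absurd h ht⟩
  choose c hc using hTe
  -- The inverses of elements of F are lifted as well, so that units spread out to units.
  obtain ⟨a, ha, ham, hker, hF⟩ := exists_fixed_denominator hp hσ hmσ
    (insert e (F ∪ F.image Ring.inverse ∪ T.image c))
  refine ⟨a, ha, ham, fun S' _ _ _ _ _ σ' hσ' => ?_⟩
  have hinj := injective_of_isLocalization_away (S' := S') a hker
  have hu : IsUnit (algebraMap S S' a) := IsLocalization.Away.algebraMap_isUnit a
  have hlift : ∀ r ∈ insert e (F ∪ F.image Ring.inverse ∪ T.image c), ∃ x, algebraMap S' R x = r := by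
    intro r hr
    obtain ⟨x, hx⟩ := hF r hr
    obtain ⟨w, hw⟩ := hu
    refine ⟨algebraMap S S' x * ↑w⁻¹, ?_⟩
    have h1 : algebraMap S R a = algebraMap S' R w := by
      rw [hw, ← IsScalarTower.algebraMap_apply]
    rw [map_mul, ← IsScalarTower.algebraMap_apply, ← hx, h1, mul_right_comm, ← map_mul,
      Units.mul_inv, map_one, one_mul]
  refine ⟨hinj, fun r hr => ?_, ?_⟩
  · obtain ⟨x, hx⟩ := hlift r (Finset.mem_insert_of_mem (Finset.mem_union_left _
      (Finset.mem_union_left _ hr)))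
    obtain ⟨y, hy⟩ := hlift (Ring.inverse r) (Finset.mem_insert_of_mem (Finset.mem_union_left _
      (Finset.mem_union_right _ (Finset.mem_image_of_mem _ hr))))
    refine ⟨x, hx, fun hru => IsUnit.of_mul_eq_one y (hinj ?_)⟩
    rw [map_mul, hx, hy, map_one, Ring.mul_inverse_cancel r hru]
  · obtain ⟨e', he'⟩ := hlift e (Finset.mem_insert_self _ _)
    refine ⟨e', he', dvd_sub_of_isLocalization_away a ha hσ' fun x => ?_⟩
    have hx : σ x - x ∈ Submodule.span S (T : Set S) := by
      rw [← hTspan]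
      exact Submodule.subset_span ⟨x, rfl⟩
    refine Submodule.span_induction (p := fun x _ => e' ∣ algebraMap S S' x) ?_ ?_ ?_ ?_ hx
    · intro t ht
      obtain ⟨d, hd⟩ := hlift (c t) (Finset.mem_insert_of_mem (Finset.mem_union_right _
        (Finset.mem_image_of_mem _ ht)))
      refine ⟨d, hinj ?_⟩
      rw [← IsScalarTower.algebraMap_apply, hc t ht, map_mul, he', hd]
    · rw [map_zero]
      exact dvd_zero _
    · intro x y _ _ hx hy
      rw [map_add]
      exact dvd_add hx hy
    · intro b x _ hx
      rw [smul_eq_mul, map_mul]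
      exact hx.mul_left _

end SpreadingOut

/-! ### Charts around the fixed point. -/

section Charts

variable {G : Type} [Group G] {U Y : Scheme.{u}} {ρ : G →* Aut U} {π : U ⟶ Y}

/-- An affine open `V` of the quotient with affine preimage, whose functions embed in the local ring
at `P`, contain the finite set `F` and its inverses, and on which `σ f - f` is divisible by `e`. -/
structure IsChart (hinv : ∀ g, (ρ g).hom ≫ π = π) (g : G) (P : U) (e : U.presheaf.stalk P)
    (F : Finset (U.presheaf.stalk P)) (V : Y.Opens) : Prop where
  mem : P ∈ π ⁻¹ᵁ V
  isAffineOpen : IsAffineOpen V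
  isAffineOpen_preimage : IsAffineOpen (π ⁻¹ᵁ V)
  injective : Function.Injective (U.presheaf.germ (π ⁻¹ᵁ V) P mem)
  exists_lift : ∀ r ∈ F, ∃ x, U.presheaf.germ (π ⁻¹ᵁ V) P mem x = r ∧ (IsUnit r → IsUnit x)
  exists_dvd : ∃ e', U.presheaf.germ (π ⁻¹ᵁ V) P mem e' = e ∧
    ∀ f, e' ∣ sectionAction hinv V g f - f

variable {hinv : ∀ g, (ρ g).hom ≫ π = π} {g : G} {P : U} {e : U.presheaf.stalk P}
  {F : Finset (U.presheaf.stalk P)} {V : Y.Opens}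

/-- The prime ideal of `P` in the functions on an affine open subset. -/
theorem AlgebraicGeometry.IsAffineOpen.mem_primeIdealOf_iff {W : U.Opens} (hW : IsAffineOpen W) (hP : P ∈ W)
    (f : Γ(U, W)) : f ∈ (hW.primeIdealOf ⟨P, hP⟩).asIdeal ↔
      U.presheaf.germ W P hP f ∈ maximalIdeal (U.presheaf.stalk P) := by
  let := (U.presheaf.germ W P hP).hom.toAlgebra
  have : IsLocalization.AtPrime (U.presheaf.stalk P) (hW.primeIdealOf ⟨P, hP⟩).asIdeal :=
    hW.isLocalization_stalk ⟨P, hP⟩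
  exact (IsLocalization.AtPrime.to_map_mem_maximal_iff (U.presheaf.stalk P) _ f).symm

theorem isLocalization_away_preimage_basicOpen (hV : IsAffineOpen (π ⁻¹ᵁ V)) (a : Γ(Y, V)) :
    letI := (U.presheaf.map (homOfLE (π.preimage_mono (Y.basicOpen_le a))).op).hom.toAlgebra
    IsLocalization.Away (π.app V a) Γ(U, π ⁻¹ᵁ Y.basicOpen a) :=
  hV.isLocalization_of_eq_basicOpen _ (homOfLE (π.preimage_mono (Y.basicOpen_le a)))
    (Scheme.preimage_basicOpen π a)

theorem mem_preimage_basicOpen_iff (hPV : P ∈ π ⁻¹ᵁ V) (a : Γ(Y, V)) :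
    P ∈ π ⁻¹ᵁ Y.basicOpen a ↔ IsUnit (U.presheaf.germ (π ⁻¹ᵁ V) P hPV (π.app V a)) := by
  rw [Scheme.preimage_basicOpen, U.mem_basicOpen _ P hPV]

/-- Charts can be shrunk. -/
theorem IsChart.basicOpen (h : IsChart hinv g P e F V) (a : Γ(Y, V))
    (ha : P ∈ π ⁻¹ᵁ Y.basicOpen a) : IsChart hinv g P e F (Y.basicOpen a) := by
  have hV := h.isAffineOpen_preimage
  let res := U.presheaf.map (homOfLE (π.preimage_mono (Y.basicOpen_le a))).op
  have hres : ∀ f, U.presheaf.germ _ P ha (res f) = U.presheaf.germ _ P h.mem f :=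
    fun f => TopCat.Presheaf.germ_res_apply _ _ _ _ _
  let := res.hom.toAlgebra
  let := (U.presheaf.germ (π ⁻¹ᵁ V) P h.mem).hom.toAlgebra
  let := (U.presheaf.germ (π ⁻¹ᵁ Y.basicOpen a) P ha).hom.toAlgebra
  have : IsScalarTower Γ(U, π ⁻¹ᵁ V) Γ(U, π ⁻¹ᵁ Y.basicOpen a) (U.presheaf.stalk P) :=
    IsScalarTower.of_algebraMap_eq fun f => (hres f).symm
  have : IsLocalization.Away (π.app V a) Γ(U, π ⁻¹ᵁ Y.basicOpen a) :=
    isLocalization_away_preimage_basicOpen hV a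
  refine ⟨ha, h.isAffineOpen.basicOpen a, ?_, ?_, ?_, ?_⟩
  · rw [Scheme.preimage_basicOpen]
    exact hV.basicOpen _
  · refine injective_of_isLocalization_away (S' := Γ(U, π ⁻¹ᵁ Y.basicOpen a)) (π.app V a)
      fun x hx => ?_
    have h0 : x = 0 := h.injective (hx.trans (map_zero _).symm)
    rw [h0, mul_zero]
  · intro r hr
    obtain ⟨x, hx, hu⟩ := h.exists_lift r hr
    exact ⟨res x, (hres x).trans hx, fun hru => (hu hru).map _⟩
  · obtain ⟨e', he', hdvd⟩ := h.exists_dvd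
    refine ⟨res e', (hres e').trans he', dvd_sub_of_isLocalization_away (π.app V a)
      (sectionAction_app hinv V g a) (fun x => sectionAction_res hinv (Y.basicOpen_le a) g x)
      fun x => ?_⟩
    exact map_dvd res.hom (hdvd x)

/-- Charts exist. -/
theorem IsGroupQuotient.exists_isChart [Finite G] (hπ : IsGroupQuotient ρ π) [IsLocallyNoetherian U]
    (hg : ∀ g', g' ∈ Subgroup.zpowers g) (hP : ∀ g, (ρ g).hom P = P)
    (hres : ∀ f, stalkAction ρ P hP g f - f ∈ maximalIdeal (U.presheaf.stalk P))
    (he : ∀ f, e ∣ stalkAction ρ P hP g f - f) (F : Finset (U.presheaf.stalk P)) :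
    ∃ V, IsChart hπ.invariant g P e F V := by
  obtain ⟨V, hPV, hVaff, hV⟩ := hπ.exists_affine_of_mem hg hP
  replace hPV : P ∈ π ⁻¹ᵁ V := hPV
  let σ := sectionAction hπ.invariant V g
  have hσ : σ ^ Nat.card G = 1 := by
    rw [← map_pow, pow_card_eq_one', map_one]
  have hnoeth : IsNoetherianRing Γ(U, π ⁻¹ᵁ V) :=
    IsLocallyNoetherian.component_noetherian ⟨_, hV⟩
  let := (U.presheaf.germ (π ⁻¹ᵁ V) P hPV).hom.toAlgebra
  have hloc : IsLocalization.AtPrime (U.presheaf.stalk P) (hV.primeIdealOf ⟨P, hPV⟩).asIdeal :=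
    hV.isLocalization_stalk ⟨P, hPV⟩
  have hgerm := germ_sectionAction hπ.invariant hP hPV g
  obtain ⟨b, hb, hbm, hspread⟩ := exists_spreading (R := U.presheaf.stalk P)
    (Nat.card_pos (α := G)) hσ (m := (hV.primeIdealOf ⟨P, hPV⟩).asIdeal) (e := e)
    (fun c => by
      rw [IsAffineOpen.mem_primeIdealOf_iff, map_sub, ← hgerm]
      exact hres _)
    (fun x => by
      rw [map_sub]
      change e ∣ U.presheaf.germ (π ⁻¹ᵁ V) P hPV (σ x) - U.presheaf.germ (π ⁻¹ᵁ V) P hPV x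
      rw [← hgerm]
      exact he _) F
  obtain ⟨a, rfl⟩ := hπ.exists_app_eq hg hb
  have ha : P ∈ π ⁻¹ᵁ Y.basicOpen a := by
    rw [mem_preimage_basicOpen_iff hPV]
    rwa [IsAffineOpen.mem_primeIdealOf_iff, mem_maximalIdeal, mem_nonunits_iff, not_not] at hbm
  let res := U.presheaf.map (homOfLE (π.preimage_mono (Y.basicOpen_le a))).op
  have hres : ∀ f, U.presheaf.germ _ P ha (res f) = U.presheaf.germ _ P hPV f :=
    fun f => TopCat.Presheaf.germ_res_apply _ _ _ _ _
  let := res.hom.toAlgebra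
  let := (U.presheaf.germ (π ⁻¹ᵁ Y.basicOpen a) P ha).hom.toAlgebra
  have : IsScalarTower Γ(U, π ⁻¹ᵁ V) Γ(U, π ⁻¹ᵁ Y.basicOpen a) (U.presheaf.stalk P) :=
    IsScalarTower.of_algebraMap_eq fun f => (hres f).symm
  have : IsLocalization.Away (π.app V a) Γ(U, π ⁻¹ᵁ Y.basicOpen a) :=
    isLocalization_away_preimage_basicOpen hV a
  obtain ⟨hinj, hF, he'⟩ := hspread Γ(U, π ⁻¹ᵁ Y.basicOpen a)
    (sectionAction hπ.invariant (Y.basicOpen a) g)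
    (fun x => sectionAction_res hπ.invariant (Y.basicOpen_le a) g x)
  refine ⟨Y.basicOpen a, ha, hVaff.basicOpen a, ?_, hinj, hF, he'⟩
  rw [Scheme.preimage_basicOpen]
  exact hV.basicOpen _

end Charts

/-! ### Regularity of affine opens. -/

section RegularAffine

variable {X : Scheme.{u}} {W : X.Opens}

theorem AlgebraicGeometry.IsAffineOpen.isRegularLocalRing_localization (hW : IsAffineOpen W) (x : W) :
    IsRegularLocalRing (Localization.AtPrime (hW.primeIdealOf x).asIdeal) ↔
      IsRegularLocalRing (X.presheaf.stalk (x : X)) := by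
  have := hW.isLocalization_stalk x
  let ψ := IsLocalization.algEquiv (hW.primeIdealOf x).asIdeal.primeCompl
    (Localization.AtPrime (hW.primeIdealOf x).asIdeal) (X.presheaf.stalk (x : X))
  exact ⟨fun h => h.of_ringEquiv ψ.toRingEquiv, fun h => h.of_ringEquiv ψ.symm.toRingEquiv⟩

theorem IsRegularScheme.isRegularRing (hX : IsRegularScheme X) (hW : IsAffineOpen W) :
    IsRegularRing Γ(X, W) := by
  have := hX.isLocallyNoetherian
  have : IsNoetherianRing Γ(X, W) := IsLocallyNoetherian.component_noetherian ⟨_, hW⟩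
  rw [isRegularRing_iff]
  intro q hq
  have h1 : hW.primeIdealOf (hW.isoSpec.inv ⟨q, hq⟩) = ⟨q, hq⟩ := by
    let x : Spec Γ(X, W) := ⟨q, hq⟩
    refine (Scheme.Hom.comp_apply hW.isoSpec.inv hW.isoSpec.hom x).symm.trans ?_
    rw [Iso.inv_hom_id]
    rfl
  have h2 := (IsAffineOpen.isRegularLocalRing_localization hW (hW.isoSpec.inv ⟨q, hq⟩)).mpr
    (hX.isRegularLocalRing_stalk _)
  have h3 : ∀ y : PrimeSpectrum Γ(X, W), y = ⟨q, hq⟩ →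
      IsRegularLocalRing (Localization.AtPrime y.asIdeal) →
      IsRegularLocalRing (Localization.AtPrime q) := by
    rintro _ rfl h
    exact h
  exact h3 _ h1 h2

theorem AlgebraicGeometry.IsAffineOpen.isRegularScheme (hW : IsAffineOpen W) (hreg : IsRegularRing Γ(X, W)) :
    IsRegularScheme (W : Scheme.{u}) where
  isLocallyNoetherian := isLocallyNoetherian_of_isOpenImmersion hW.isoSpec.hom
  isRegularLocalRing_stalk x := by
    have h1 := (IsAffineOpen.isRegularLocalRing_localization hW x).mp
      (hreg.isRegularLocalRing_localization _)
    exact h1.of_ringEquiv (W.stalkIso x).commRingCatIsoToRingEquiv.symm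

end RegularAffine

/-! ### The regular case in a chart. -/

section ChartRings

variable {G : Type} [Group G] {U Y : Scheme.{u}} {ρ : G →* Aut U} {π : U ⟶ Y}

theorem mem_primeIdealOf_iff_app_mem {V : Y.Opens}
    (hV : IsAffineOpen V) {P : U} (hP : P ∈ π ⁻¹ᵁ V) (f : Γ(Y, V)) :
    f ∈ (hV.primeIdealOf ⟨π P, hP⟩).asIdeal ↔
      U.presheaf.germ (π ⁻¹ᵁ V) P hP (π.app V f) ∈ maximalIdeal (U.presheaf.stalk P) := by
  have hP' : π P ∈ V := hP
  rw [IsAffineOpen.mem_primeIdealOf_iff hV hP', ← Scheme.Hom.germ_stalkMap_apply π V P hP']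
  rw [mem_maximalIdeal, mem_maximalIdeal, mem_nonunits_iff, mem_nonunits_iff,
    isUnit_map_iff (π.stalkMap P).hom]

/-- The functions on an affine open of the quotient are the invariants upstairs. -/
noncomputable def IsGroupQuotient.fixedEquiv [Finite G] (hπ : IsGroupQuotient ρ π) {g : G}
    (hg : ∀ g', g' ∈ Subgroup.zpowers g) (V : Y.Opens) :
    Γ(Y, V) ≃+* fixedSubring (sectionAction hπ.invariant V g) :=
  RingEquiv.ofBijective ((π.app V).hom.codRestrict _ fun f => sectionAction_app hπ.invariant V g f)
    ⟨fun _ _ hab => hπ.injective_app V (congrArg Subtype.val hab), fun b => by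
      obtain ⟨a, ha⟩ := hπ.exists_app_eq hg b.2
      exact ⟨a, Subtype.ext ha⟩⟩

variable {g : G} {P : U} {e : U.presheaf.stalk P} {F : Finset (U.presheaf.stalk P)} {V : Y.Opens}

theorem IsChart.isDomain {hinv : ∀ g, (ρ g).hom ≫ π = π} (h : IsChart hinv g P e F V)
    [IsDomain (U.presheaf.stalk P)] : IsDomain Γ(U, π ⁻¹ᵁ V) :=
  h.injective.isDomain (U.presheaf.germ (π ⁻¹ᵁ V) P h.mem).hom

/-- If the inertia differences are all divisible by those of one element, the quotient is
regular. -/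
theorem IsGroupQuotient.isRegularNear [Finite G] (hG : 1 < Nat.card G) (hU : IsRegularScheme U)
    (hπ : IsGroupQuotient ρ π)
    (hg : ∀ g', g' ∈ Subgroup.zpowers g) (hP : ∀ g, (ρ g).hom P = P)
    (hres : ∀ f, stalkAction ρ P hP g f - f ∈ maximalIdeal (U.presheaf.stalk P)) (he0 : e ≠ 0)
    (he : ∀ f, e ∣ stalkAction ρ P hP g f - f) {y : U.presheaf.stalk P}
    (hy : ∀ j, 0 < j → j < Nat.card G →
      ∃ w, IsUnit w ∧ (stalkAction ρ P hP g ^ j) y - y = e * w) : IsRegularNear Y (π P) := by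
  classical
  have := hU.isLocallyNoetherian
  have := hU.isRegularLocalRing_stalk P
  have : IsDomain (U.presheaf.stalk P) := IsRegularLocalRing.isDomain _
  choose! w hw hyw using hy
  -- The chart contains y and the unit factors of its differences, so that σ^j y - y is still e
  -- times a unit there.
  obtain ⟨V, hV⟩ := hπ.exists_isChart hg hP hres he (insert y ((Finset.range (Nat.card G)).image w))
  have := hV.isDomain
  have hinj := hV.injective
  have := hU.isRegularRing hV.isAffineOpen_preimage
  obtain ⟨y', hy', -⟩ := hV.exists_lift y (Finset.mem_insert_self _ _)
  obtain ⟨e', he', hdvd⟩ := hV.exists_dvd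
  have hpow := pow_apply_of_apply (U.presheaf.germ (π ⁻¹ᵁ V) P hV.mem).hom _ _
    (germ_sectionAction hπ.invariant hP hV.mem g)
  have hyj : ∀ j, 0 < j → j < Nat.card G →
      ∃ w', IsUnit w' ∧ (sectionAction hπ.invariant V g ^ j) y' - y' = e' * w' := by
    intro j hj hjp
    obtain ⟨w', hw', hw'u⟩ := hV.exists_lift (w j) (Finset.mem_insert_of_mem
      (Finset.mem_image_of_mem _ (Finset.mem_range.mpr hjp)))
    refine ⟨w', hw'u (hw j hj hjp), hinj ?_⟩
    have h1 := hyw j hj hjp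
    have h2 := hpow j y'
    change (stalkAction ρ P hP g ^ j) (U.presheaf.germ (π ⁻¹ᵁ V) P hV.mem y') =
      U.presheaf.germ (π ⁻¹ᵁ V) P hV.mem ((sectionAction hπ.invariant V g ^ j) y') at h2
    rw [map_sub, map_mul, ← h2, hy', he', hw', h1]
  have he'0 : e' ≠ 0 := by
    rintro rfl
    exact he0 (by rw [← he', map_zero])
  let := (π.app V).hom.toAlgebra
  have hσ : sectionAction hπ.invariant V g ^ Nat.card G = 1 := by
    rw [← map_pow, pow_card_eq_one', map_one]
  have hreg : IsRegularRing Γ(Y, V) := by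
    refine isRegularRing_of_dvd hG (sectionAction hπ.invariant V g) hσ (y := y') ?_ ?_
      (hπ.injective_app V) (fun f => sectionAction_app hπ.invariant V g f)
      (fun f hf => hπ.exists_app_eq hg hf)
    · intro j hj hjp
      obtain ⟨w', hw', hyw'⟩ := hyj j hj hjp
      rw [hyw']
      exact mul_ne_zero he'0 hw'.ne_zero
    · intro j hj hjp f
      obtain ⟨w', hw', hyw'⟩ := hyj j hj hjp
      rw [hyw', hw'.mul_right_dvd]
      exact hdvd f
  exact ⟨V, hV.mem, IsAffineOpen.isRegularScheme hV.isAffineOpen hreg⟩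

end ChartRings

/-! ### The μ_p-presentation in a chart. -/

section MuQuotient

variable {p : ℕ} {U Y : Scheme.{u}} {ρ : Multiplicative (ZMod p) →* Aut U} {π : U ⟶ Y}

theorem mem_zpowers_ofAdd_one (g : Multiplicative (ZMod p)) :
    g ∈ Subgroup.zpowers (Multiplicative.ofAdd (1 : ZMod p)) := by
  obtain ⟨z, hz⟩ := ZMod.intCast_surjective (Multiplicative.toAdd g)
  refine ⟨z, ?_⟩
  change Multiplicative.ofAdd (z • (1 : ZMod p)) = g
  rw [zsmul_one, hz]
  rfl

theorem natCard_multiplicative_zmod : Nat.card (Multiplicative (ZMod p)) = p :=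
  (Nat.card_congr Multiplicative.toAdd).trans (Nat.card_zmod p)

/-- Checked on the functions of an invariant affine neighborhood, of which the stalk is a
localization. -/
theorem IsGroupQuotient.stalkAction_pow_eq_one [NeZero p] (hπ : IsGroupQuotient ρ π) {P : U}
    (hP : ∀ g, (ρ g).hom P = P) : stalkAction ρ P hP (Multiplicative.ofAdd 1) ^ p = 1 := by
  obtain ⟨V, hPV, -, hV⟩ := hπ.exists_affine_of_mem mem_zpowers_ofAdd_one hP
  replace hPV : P ∈ π ⁻¹ᵁ V := hPV
  let := (U.presheaf.germ (π ⁻¹ᵁ V) P hPV).hom.toAlgebra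
  have hloc : IsLocalization.AtPrime (U.presheaf.stalk P) (hV.primeIdealOf ⟨P, hPV⟩).asIdeal :=
    hV.isLocalization_stalk ⟨P, hPV⟩
  refine IsLocalization.ringHom_ext (hV.primeIdealOf ⟨P, hPV⟩).asIdeal.primeCompl
    (RingHom.ext fun f => ?_)
  have h1 := pow_apply_of_apply (U.presheaf.germ (π ⁻¹ᵁ V) P hPV).hom _ _
    (germ_sectionAction hπ.invariant hP hPV (Multiplicative.ofAdd 1)) p f
  refine h1.trans ?_
  rw [← map_pow, ← ofAdd_nsmul, nsmul_one, ZMod.natCast_self, ofAdd_zero, map_one]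
  rfl

variable {P : U} {e s θ μ : U.presheaf.stalk P} {F : Finset (U.presheaf.stalk P)} {V : Y.Opens}

/-- The maximal ideal of the fixed point in a chart. -/
noncomputable def IsChart.ideal {hinv : ∀ g, (ρ g).hom ≫ π = π} {g}
    (h : IsChart hinv g P e F V) : Ideal Γ(U, π ⁻¹ᵁ V) :=
  (h.isAffineOpen_preimage.primeIdealOf ⟨P, h.mem⟩).asIdeal

theorem IsChart.mem_ideal_iff {hinv : ∀ g, (ρ g).hom ≫ π = π} {g} (h : IsChart hinv g P e F V)
    (f : Γ(U, π ⁻¹ᵁ V)) :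
    f ∈ h.ideal ↔ U.presheaf.germ _ P h.mem f ∈ maximalIdeal (U.presheaf.stalk P) :=
  h.isAffineOpen_preimage.mem_primeIdealOf_iff h.mem f

theorem IsChart.kummerDatum {hinv : ∀ g, (ρ g).hom ≫ π = π} {g}
    (hP : ∀ g, (ρ g).hom P = P)
    (hPclosed : IsClosed ({P} : Set U)) [IsDomain (U.presheaf.stalk P)]
    (hV : IsChart hinv g P e F V)
    (h : KummerDatum p (stalkAction ρ P hP g) (maximalIdeal (U.presheaf.stalk P)) e s θ μ)
    (hθ : θ ∈ F) (hμ : μ ∈ F) (hw : ∀ j, 0 < j → j < p → ∃ w ∈ F, IsUnit w ∧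
      (stalkAction ρ P hP g ^ j) s - s = e * s * w)
    {s' θ' μ' : Γ(U, π ⁻¹ᵁ V)} (hs' : U.presheaf.germ _ P hV.mem s' = s)
    (hθ' : U.presheaf.germ _ P hV.mem θ' = θ) (hμ' : U.presheaf.germ _ P hV.mem μ' = μ) :
    ∃ e', U.presheaf.germ _ P hV.mem e' = e ∧
      KummerDatum p (sectionAction hinv V g) hV.ideal e' s' θ' μ' := by
  obtain ⟨e', he', hdvd⟩ := hV.exists_dvd
  have hlift : ∀ r ∈ F, IsUnit r → ∀ x, U.presheaf.germ _ P hV.mem x = r → IsUnit x := by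
    intro r hr hru x hx
    obtain ⟨y, hy, hyu⟩ := hV.exists_lift r hr
    rw [hV.injective (hx.trans hy.symm)]
    exact hyu hru
  refine ⟨e', he', KummerDatum.of_injective (f := (U.presheaf.germ (π ⁻¹ᵁ V) P hV.mem).hom)
    (τ := stalkAction ρ P hP g) (M := maximalIdeal (U.presheaf.stalk P))
    hV.injective (germ_sectionAction hinv hP hV.mem g)
    (hV.isAffineOpen_preimage.primeIdealOf_isMaximal_of_isClosed _ hPclosed)
    (hV.isAffineOpen_preimage.mem_primeIdealOf_iff hV.mem) ?_ hdvd
    (hlift θ hθ h.isUnit_theta θ' hθ') (hlift μ hμ h.isUnit_mu μ' hμ') ?_⟩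
  · change KummerDatum p _ _ (U.presheaf.germ _ P hV.mem e') (U.presheaf.germ _ P hV.mem s')
      (U.presheaf.germ _ P hV.mem θ') (U.presheaf.germ _ P hV.mem μ')
    rw [he', hs', hθ', hμ']
    exact h
  · intro j hj hjp u hu
    change (stalkAction ρ P hP g ^ j) (U.presheaf.germ _ P hV.mem s') - U.presheaf.germ _ P hV.mem s' =
      U.presheaf.germ _ P hV.mem e' * U.presheaf.germ _ P hV.mem s' * u at hu
    rw [he', hs'] at hu
    obtain ⟨w, hwF, hwu, hws⟩ := hw j hj hjp
    have huw : u = w := mul_left_cancel₀ (mul_ne_zero h.e_ne_zero h.s_ne_zero) (hu.symm.trans hws)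
    obtain ⟨x, hx, hxu⟩ := hV.exists_lift w hwF
    exact ⟨x, hxu hwu, hx.trans huw.symm⟩

/-- A presentation of an affine neighborhood as a quotient by `μ_p`. -/
theorem AlgebraicGeometry.IsAffineOpen.hasMuQuotientSingularity (hV : IsAffineOpen V) {y : Y}
    (hy : y ∈ V) {B : Type u} [CommRing B] [IsNoetherianRing B] {α : MuAction p B}
    (E : Γ(Y, V) ≃+* α.invariants) {q : Ideal B} (hq : q.IsMaximal)
    (hE : ∀ f, (E f : B) ∈ q ↔ f ∈ (hV.primeIdealOf ⟨y, hy⟩).asIdeal) (hfix : α.Fixes q)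
    (hreg : have := hq.isPrime; IsRegularLocalRing (Localization.AtPrime q)) {n : ℕ}
    {b : Fin n → ZMod p} {t : Fin n → B} (ht : ∀ i, α.IsEigenfunction (b i) (t i))
    (hcoord : have := hq.isPrime
      IsCoordinates (Localization.AtPrime q) (fun i => algebraMap B _ (t i)))
    (htail : (∃ O : Set (PrimeSpectrum B), IsOpen O ∧ ⟨q, hq.isPrime⟩ ∈ O ∧
        ∀ x ∈ O, IsRegularLocalRing (Localization.AtPrime x.asIdeal)) → IsRegularRing B) :
    HasMuQuotientSingularity p Y y b := by
  have hqp := hq.isPrime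
  have h1 : PrimeSpectrum.comap E.toRingHom (PrimeSpectrum.comap
      α.invariants.val.toRingHom ⟨q, hqp⟩) = hV.primeIdealOf ⟨y, hy⟩ :=
    PrimeSpectrum.ext (Ideal.ext hE)
  let ι : Spec (CommRingCat.of α.invariants) ≅ (V : Scheme.{u}) :=
    Scheme.Spec.mapIso E.toCommRingCatIso.op ≪≫ hV.isoSpec.symm
  refine ⟨V, hy, B, inferInstance, α, ι, ⟨q, hqp⟩, t, inferInstance, hq, hfix, ?_, hreg, ht, hcoord,
    htail⟩
  change hV.isoSpec.inv (PrimeSpectrum.comap E.toRingHom (PrimeSpectrum.comap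
      α.invariants.val.toRingHom ⟨q, hqp⟩)) = _
  rw [h1]
  refine (Scheme.Hom.comp_apply hV.isoSpec.hom hV.isoSpec.inv (⟨y, hy⟩ : V)).symm.trans ?_
  rw [Iso.hom_inv_id]
  rfl

theorem KummerDatum.exists_muAction [NeZero p] {S : Type u} [CommRing S] [IsDomain S] {σ : S →+* S}
    {m : Ideal S} {e s θ μ : S} (h : KummerDatum p σ m e s θ μ) (hp : p.Prime) {r : ZMod p}
    (hr : r ≠ 0) : ∃ (α : MuAction p (KummerCover.fixed σ θ h.map_mu))
      (E : fixedSubring σ ≃+* α.invariants),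
      (∀ f, (E f : KummerCover.fixed σ θ h.map_mu) ∈ h.point ↔ (f : S) ∈ m) ∧
      α.Fixes h.point ∧ ∀ (i : ℕ) (f : S) (hf : σ f * θ ^ i = f),
        α.IsEigenfunction ((i : ZMod p) * r) ⟨_, h.homogeneous_mem_fixed hf⟩ := by
  refine ⟨(KummerCover.fixedWeights r).toMuAction, h.fixedEquivInvariants hp hr, fun f => ?_,
    (KummerCover.fixedWeights r).fixes_toMuAction fun k hk b => h.proj_mem_point hp r hk b,
    fun i f hf => ?_⟩
  · exact SetLike.ext_iff.mp h.comap_ofFixed_point f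
  · refine (KummerCover.fixedWeights r).isEigenfunction_toMuAction (Subtype.ext ?_)
    rw [KummerCover.coe_fixedWeights_proj]
    exact (KummerCover.proj_of_mul_root_pow _ _ _ _).trans (if_pos rfl)

/-- The quotient of the Kummer cover of a chart presents the quotient singularity. -/
theorem IsChart.hasMuQuotientSingularity [NeZero p] (hp : p.Prime) (hU : IsRegularScheme U)
    (hπ : IsGroupQuotient ρ π) (hP : ∀ g, (ρ g).hom P = P)
    [CharP (ResidueField (U.presheaf.stalk P)) p]
    {u₁ : U.presheaf.stalk P} (hu₁ : IsUnit u₁) (hdvd : ∀ f, ∃ z ∈ maximalIdeal (U.presheaf.stalk P),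
      stalkAction ρ P hP (Multiplicative.ofAdd 1) f - f = e * z)
    {φ : CotangentSpace (U.presheaf.stalk P) →ₗ[ResidueField (U.presheaf.stalk P)]
      CotangentSpace (U.presheaf.stalk P)}
    (hφ : ∀ y z : maximalIdeal (U.presheaf.stalk P),
      stalkAction ρ P hP (Multiplicative.ofAdd 1) y - y = e * z →
      φ ((maximalIdeal (U.presheaf.stalk P)).toCotangent y) =
        (maximalIdeal (U.presheaf.stalk P)).toCotangent z)
    {n : ℕ} (v : Module.Basis (Fin n) (ResidueField (U.presheaf.stalk P))
      (CotangentSpace (U.presheaf.stalk P))) {k : Fin n → ℕ} (hk : ∀ i, k i < p)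
    (hv : ∀ i, φ (v i) = -(((k i : U.presheaf.stalk P) * u₁) • v i)) {r : ZMod p} (hr : r ≠ 0)
    (hV : IsChart hπ.invariant (Multiplicative.ofAdd 1) P e F V)
    {x : Fin n → maximalIdeal (U.presheaf.stalk P)}
    (hx : ∀ i, (maximalIdeal (U.presheaf.stalk P)).toCotangent (x i) = v i)
    (hxF : ∀ i, (x i : U.presheaf.stalk P) ∈ F)
    {e' s' θ' μ' : Γ(U, π ⁻¹ᵁ V)} (he' : U.presheaf.germ _ P hV.mem e' = e)
    (hθ' : U.presheaf.germ _ P hV.mem θ' = 1 + e * u₁)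
    (h : KummerDatum p (sectionAction hπ.invariant V (Multiplicative.ofAdd 1)) hV.ideal e' s' θ' μ')
    (htail : (∃ O : Set (PrimeSpectrum (KummerCover.fixed _ θ' h.map_mu)), IsOpen O ∧
      ⟨h.point, (h.point_isMaximal hp.ne_zero).isPrime⟩ ∈ O ∧
        ∀ x ∈ O, IsRegularLocalRing (Localization.AtPrime x.asIdeal)) →
      IsRegularRing (KummerCover.fixed _ θ' h.map_mu)) :
    HasMuQuotientSingularity p Y (π P) (fun i => (k i : ZMod p) * r) := by
  have := hU.isLocallyNoetherian
  have := hU.isRegularLocalRing_stalk P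
  have : IsDomain (U.presheaf.stalk P) := IsRegularLocalRing.isDomain _
  have := hV.isDomain
  have : IsNoetherianRing Γ(U, π ⁻¹ᵁ V) :=
    IsLocallyNoetherian.component_noetherian ⟨_, hV.isAffineOpen_preimage⟩
  let := (U.presheaf.germ (π ⁻¹ᵁ V) P hV.mem).hom.toAlgebra
  have hmem := hV.isAffineOpen_preimage.mem_primeIdealOf_iff hV.mem
  have hprime : hV.ideal.IsPrime := h.isMaximal.isPrime
  have hloc : IsLocalization.AtPrime (U.presheaf.stalk P) hV.ideal :=
    hV.isAffineOpen_preimage.isLocalization_stalk ⟨P, hV.mem⟩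
  choose x' hx' _ using fun i => hV.exists_lift _ (hxF i)
  have hxmem : ∀ i, algebraMap Γ(U, π ⁻¹ᵁ V) (U.presheaf.stalk P) (x' i) ∈
      maximalIdeal (U.presheaf.stalk P) := fun i => by
    change U.presheaf.germ _ P hV.mem (x' i) ∈ _
    rw [hx']
    exact (x i).2
  have hxv : ∀ i, (maximalIdeal (U.presheaf.stalk P)).toCotangent ⟨_, hxmem i⟩ = v i := by
    intro i
    rw [← hx i]
    exact congrArg _ (Subtype.ext (hx' i))
  choose y hyfix hymem hyv using fun i => h.exists_homogeneous_lift hp (R := U.presheaf.stalk P)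
    hV.injective (fun f hf => (hmem f).mp hf)
    (τ := stalkAction ρ P hP (Multiplicative.ofAdd 1))
    (germ_sectionAction hπ.invariant hP hV.mem _) (hπ.stalkAction_pow_eq_one hP)
    (fun f => by
      change ∃ z ∈ _, _ = U.presheaf.germ _ P hV.mem e' * z
      rw [he']
      exact hdvd f)
    (φ := φ) (fun y z hyz => by
      refine hφ y z ?_
      rw [← he']
      exact hyz)
    hu₁ (by
      change U.presheaf.germ _ P hV.mem θ' = 1 + U.presheaf.germ _ P hV.mem e' * u₁
      rw [he', hθ']) (hk i) (x := x' i) (hxmem i) (by rw [hxv, hv])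
  have hcoord : IsCoordinates (U.presheaf.stalk P)
      (fun i => algebraMap Γ(U, π ⁻¹ᵁ V) (U.presheaf.stalk P) (y i)) := by
    -- The lifts reproduce the eigenbasis up to the sign (-1)^(p-1) from the p - 1 steps.
    refine ⟨hymem, v.isUnitSMul (w := fun _ => (-1) ^ (p - 1)) fun _ => isUnit_one.neg.pow _,
      fun i => ?_⟩
    rw [Module.Basis.isUnitSMul_apply, hyv, hxv, ← algebraMap_smul
      (ResidueField (U.presheaf.stalk P)) ((-1 : U.presheaf.stalk P) ^ (p - 1)) (v i), map_pow,
      map_neg, map_one]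
  have hq := (h.point_isMaximal hp.ne_zero)
  have hqp := hq.isPrime
  obtain ⟨hreg, hcoordB⟩ := h.isRegularLocalRing_point hp hyfix (U.presheaf.stalk P) hcoord.span_eq
    hcoord.natCast_eq_ringKrullDim.le
  have := h.isNoetherianRing_fixed hp.one_lt
  obtain ⟨α, E, hE, hfix, heigen⟩ := h.exists_muAction hp hr
  have hE' : ∀ f, (((hπ.fixedEquiv mem_zpowers_ofAdd_one V).trans E f : α.invariants) :
      KummerCover.fixed _ θ' h.map_mu) ∈ h.point ↔
        f ∈ (hV.isAffineOpen.primeIdealOf ⟨π P, hV.mem⟩).asIdeal := by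
    intro f
    refine (hE (hπ.fixedEquiv mem_zpowers_ofAdd_one V f)).trans ?_
    exact (hmem (π.app V f)).trans (mem_primeIdealOf_iff_app_mem hV.isAffineOpen hV.mem f).symm
  exact hV.isAffineOpen.hasMuQuotientSingularity hV.mem
    ((hπ.fixedEquiv mem_zpowers_ofAdd_one V).trans E) hq hE' hfix hreg
    (fun i => heigen (k i) (y i) (hyfix i)) hcoordB htail

end MuQuotient

/-! ### Weights and the choice of the chart. -/

section MuQuotientExistence

variable {p : ℕ} {U Y : Scheme.{u}} {ρ : Multiplicative (ZMod p) →* Aut U} {π : U ⟶ Y} {P : U}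

/-- If some b_j is nonzero, d = b_j/k_j lies in the prime field. If all vanish, so do all k_i modulo
p, and any r ≠ 0 will do. -/
theorem exists_weight_of_natCast_eq {p : ℕ} (hp : p.Prime) {K ι : Type*} [Field K] [CharP K p]
    {d : K} (hd : d ≠ 0) {b : ι → ZMod p} {k : ι → ℕ} (h : ∀ i, ((b i).cast : K) = d * k i) :
    ∃ r : ZMod p, r ≠ 0 ∧ ∀ i, b i = k i * r := by
  have : Fact p.Prime := ⟨hp⟩
  let f := ZMod.castHom (dvd_refl p) K
  have hf : ∀ i, f (b i) = d * f (k i) := fun i => by rw [map_natCast]; exact h i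
  by_cases h0 : ∃ i, b i ≠ 0
  · obtain ⟨j, hj⟩ := h0
    have hfj : f (b j) ≠ 0 := (map_ne_zero f).mpr hj
    rw [hf] at hfj
    have hkj : (k j : ZMod p) ≠ 0 := (map_ne_zero f).mp (right_ne_zero_of_mul hfj)
    have hd : d = f (b j / k j) := by
      rw [map_div₀, hf j, mul_div_cancel_right₀ _ (right_ne_zero_of_mul hfj)]
    refine ⟨b j / k j, div_ne_zero hj hkj, fun i => f.injective ?_⟩
    rw [hf i, hd, map_mul, mul_comm]
  · push Not at h0
    refine ⟨1, one_ne_zero, fun i => f.injective ?_⟩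
    have h1 := hf i
    rw [h0 i, map_zero, eq_comm, mul_eq_zero] at h1
    rw [h0 i, map_zero, mul_one, h1.resolve_left hd]

/-- Any chart gives a presentation; the care goes into the demand that Q be regular if it is so near
q. A chart with regular B is used if one exists. If none does, any chart works, since regularity
near the point would produce a smaller chart with regular B. -/
theorem IsGroupQuotient.hasMuQuotientSingularity (hp : p.Prime) (hU : IsRegularScheme U)
    (hπ : IsGroupQuotient ρ π) (hPclosed : IsClosed ({P} : Set U)) (hP : ∀ g, (ρ g).hom P = P)
    [CharP (ResidueField (U.presheaf.stalk P)) p]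
    {e s u₁ : U.presheaf.stalk P} (he : e ∈ maximalIdeal (U.presheaf.stalk P)) (he0 : e ≠ 0)
    (hs0 : s ≠ 0) (hu₁ : IsUnit u₁)
    (hs : stalkAction ρ P hP (Multiplicative.ofAdd 1) s - s = e * s * u₁)
    (hdvd : ∀ f, ∃ z ∈ maximalIdeal (U.presheaf.stalk P),
      stalkAction ρ P hP (Multiplicative.ofAdd 1) f - f = e * z)
    {φ : CotangentSpace (U.presheaf.stalk P) →ₗ[ResidueField (U.presheaf.stalk P)]
      CotangentSpace (U.presheaf.stalk P)}
    (hφ : ∀ y z : maximalIdeal (U.presheaf.stalk P),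
      stalkAction ρ P hP (Multiplicative.ofAdd 1) y - y = e * z →
      φ ((maximalIdeal (U.presheaf.stalk P)).toCotangent y) =
        (maximalIdeal (U.presheaf.stalk P)).toCotangent z)
    {n : ℕ} (v : Module.Basis (Fin n) (ResidueField (U.presheaf.stalk P))
      (CotangentSpace (U.presheaf.stalk P))) {k : Fin n → ℕ} (hk : ∀ i, k i < p)
    (hv : ∀ i, φ (v i) = -(((k i : U.presheaf.stalk P) * u₁) • v i)) {r : ZMod p} (hr : r ≠ 0) :
    HasMuQuotientSingularity p Y (π P) (fun i => (k i : ZMod p) * r) := by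
  classical
  have : NeZero p := ⟨hp.ne_zero⟩
  have := hU.isLocallyNoetherian
  have := hU.isRegularLocalRing_stalk P
  have : IsDomain (U.presheaf.stalk P) := IsRegularLocalRing.isDomain _
  obtain ⟨μ, h⟩ := exists_kummerDatum hp (hπ.stalkAction_pow_eq_one hP) he he0 hs0 hu₁ hs hdvd
  choose! w hw hws using h.exists_isUnit
  choose x hx using fun i => (maximalIdeal (U.presheaf.stalk P)).toCotangent_surjective (v i)
  let F : Finset (U.presheaf.stalk P) := insert s (insert (1 + e * u₁) (insert μ
    (Finset.univ.image (fun i => (x i : U.presheaf.stalk P)) ∪ (Finset.range p).image w)))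
  have hsF : s ∈ F := by simp [F]
  have hθF : 1 + e * u₁ ∈ F := by simp [F]
  have hμF : μ ∈ F := by simp [F]
  have hxF : ∀ i, (x i : U.presheaf.stalk P) ∈ F := fun i => by simp [F]
  have hwF : ∀ j, 0 < j → j < p → ∃ w ∈ F, IsUnit w ∧
      (stalkAction ρ P hP (Multiplicative.ofAdd 1) ^ j) s - s = e * s * w := by
    intro j hj hjp
    refine ⟨w j, ?_, hw j hj hjp, hws j hj hjp⟩
    have : w j ∈ (Finset.range p).image w := Finset.mem_image_of_mem _ (Finset.mem_range.mpr hjp)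
    simp only [F, Finset.mem_insert, Finset.mem_union]
    tauto
  by_cases hgood : ∃ (V : Y.Opens) (hV : IsChart hπ.invariant (Multiplicative.ofAdd 1) P e F V)
      (e' s' θ' μ' : Γ(U, π ⁻¹ᵁ V)) (_ : U.presheaf.germ _ P hV.mem e' = e)
      (_ : U.presheaf.germ _ P hV.mem θ' = 1 + e * u₁)
      (h' : KummerDatum p (sectionAction hπ.invariant V (Multiplicative.ofAdd 1)) hV.ideal
        e' s' θ' μ'), IsRegularRing (KummerCover.fixed _ θ' h'.map_mu)
  · obtain ⟨V, hV, e', s', θ', μ', he', hθ', h', hreg⟩ := hgood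
    exact hV.hasMuQuotientSingularity hp hU hπ hP hu₁ hdvd hφ v hk hv hr hx hxF he' hθ' h'
      fun _ => hreg
  · obtain ⟨V, hV⟩ := hπ.exists_isChart (e := e) mem_zpowers_ofAdd_one hP h.sub_mem h.dvd_sub F
    obtain ⟨s', hs', -⟩ := hV.exists_lift s hsF
    obtain ⟨θ', hθ', -⟩ := hV.exists_lift _ hθF
    obtain ⟨μ', hμ', -⟩ := hV.exists_lift μ hμF
    obtain ⟨e', he', h'⟩ := hV.kummerDatum hP hPclosed h hθF hμF hwF hs' hθ' hμ'
    refine hV.hasMuQuotientSingularity hp hU hπ hP hu₁ hdvd hφ v hk hv hr hx hxF he' hθ' h'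
      fun hO => absurd ?_ hgood
    obtain ⟨O, hO, hqO, hreg⟩ := hO
    have := hV.isDomain
    have : IsNoetherianRing Γ(U, π ⁻¹ᵁ V) :=
      IsLocallyNoetherian.component_noetherian ⟨_, hV.isAffineOpen_preimage⟩
    -- The regular neighborhood contains the preimage of a basic open D(a) of the quotient, to which
    -- the chart is shrunk.
    obtain ⟨a, ham, haO⟩ := h'.exists_notMem_of_isOpen hp hO hqO
    obtain ⟨a', ha'⟩ := hπ.exists_app_eq mem_zpowers_ofAdd_one a.2
    have hPa : P ∈ π ⁻¹ᵁ Y.basicOpen a' := by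
      rw [mem_preimage_basicOpen_iff hV.mem, ha']
      by_contra hu
      exact ham ((hV.mem_ideal_iff _).mpr ((mem_maximalIdeal _).mpr hu))
    have hV' := hV.basicOpen a' hPa
    let res := U.presheaf.map (homOfLE (π.preimage_mono (Y.basicOpen_le a'))).op
    have hres : ∀ f, U.presheaf.germ _ P hV'.mem (res f) = U.presheaf.germ _ P hV.mem f :=
      fun f => TopCat.Presheaf.germ_res_apply _ _ _ _ _
    obtain ⟨e'', he'', h''⟩ := hV'.kummerDatum hP hPclosed h hθF hμF hwF
      ((hres s').trans hs') ((hres θ').trans hθ') ((hres μ').trans hμ')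
    let := res.hom.toAlgebra
    have hloc : IsLocalization.Away (a : Γ(U, π ⁻¹ᵁ V)) Γ(U, π ⁻¹ᵁ Y.basicOpen a') := by
      rw [← ha']
      exact isLocalization_away_preimage_basicOpen hV.isAffineOpen_preimage a'
    have ha0 : (a : Γ(U, π ⁻¹ᵁ V)) ≠ 0 := fun h0 => ham (h0 ▸ hV.ideal.zero_mem)
    exact ⟨Y.basicOpen a', hV', e'', res s', res θ', res μ', he'', (hres θ').trans hθ', h'',
      h'.isRegularRing_fixed_of_isLocalization hp h''
        (fun f => sectionAction_res hπ.invariant (Y.basicOpen_le a') _ f) rfl rfl a ha0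
        fun q hq => hreg q (haO q hq)⟩

end MuQuotientExistence

/-! ### The two cases combined. -/

theorem theorem3p2 {p : ℕ} (hp : p.Prime) {U : Scheme.{u}} (hU : IsRegularScheme U)
    -- an action of `G = ℤ/p`, with generator `σ`, on `U`, and the quotient `Y = U/G`
    (ρ : Multiplicative (ZMod p) →* Aut U) {Y : Scheme.{u}} (π : U ⟶ Y)
    (hπ : IsGroupQuotient ρ π)
    -- a closed point fixed by `G` (so that `G` acts trivially on its residue field)
    (P : U) (hPclosed : IsClosed ({P} : Set U)) (hP : ∀ g, (ρ g).hom P = P)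
    (hPres : ∀ g f, stalkAction ρ P hP g f - f ∈ maximalIdeal (U.presheaf.stalk P))
    (hperfect : PerfectField (ResidueField (U.presheaf.stalk P)))
    (hchar : CharP (ResidueField (U.presheaf.stalk P)) p)
    -- `I(f) = σ(f) - f` on the local ring at `P`
    (I : U.presheaf.stalk P → U.presheaf.stalk P)
    (hI : ∀ f, I f = stalkAction ρ P hP (Multiplicative.ofAdd 1) f - f)
    (e s : U.presheaf.stalk P) (he : e ∈ maximalIdeal (U.presheaf.stalk P)) (he0 : e ≠ 0)
    (hs : s ∈ maximalIdeal (U.presheaf.stalk P)) (hs0 : s ≠ 0)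
    {n : ℕ} (x : Fin n → U.presheaf.stalk P) (hx : IsCoordinates (U.presheaf.stalk P) x)
    (hIs : ∃ w : U.presheaf.stalk P, IsUnit w ∧ I s = e * s * w)
    (hIx : ∀ i, I (x i) ∈ Ideal.span {e})
    (hpe : ∃ a ∈ maximalIdeal (U.presheaf.stalk P), (p : U.presheaf.stalk P) = e ^ (p - 1) * a) :
    (IsRegularNear Y (π P) ∨ ∃ b : Fin n → ZMod p, HasMuQuotientSingularity p Y (π P) b) ∧
    -- some `I(x i) / e` is nonzero at `P`
    ((∃ i, ∃ a, IsUnit a ∧ I (x i) = e * a) → IsRegularNear Y (π P)) ∧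
    -- otherwise
    ((¬ ∃ i, ∃ a, IsUnit a ∧ I (x i) = e * a) →
      (∀ y ∈ maximalIdeal (U.presheaf.stalk P),
        ∃ z ∈ maximalIdeal (U.presheaf.stalk P), I y = e * z) ∧
      ∃ φ : CotangentSpace (U.presheaf.stalk P) →ₗ[ResidueField (U.presheaf.stalk P)]
          CotangentSpace (U.presheaf.stalk P),
        (∀ y z : maximalIdeal (U.presheaf.stalk P), I y = e * z →
          φ ((maximalIdeal (U.presheaf.stalk P)).toCotangent y) =
            (maximalIdeal (U.presheaf.stalk P)).toCotangent z) ∧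
        (∃ c : ResidueField (U.presheaf.stalk P), c ≠ 0 ∧
          ∃ b : Fin n → ZMod p, IsDiagonalizableWith p (c • φ) b) ∧
        ∀ c : ResidueField (U.presheaf.stalk P), c ≠ 0 →
          ∀ b : Fin n → ZMod p, IsDiagonalizableWith p (c • φ) b →
            HasMuQuotientSingularity p Y (π P) b) := by
  classical
  let τ := stalkAction ρ P hP (Multiplicative.ofAdd 1)
  have : NeZero p := ⟨hp.ne_zero⟩
  have := hU.isLocallyNoetherian
  have := hU.isRegularLocalRing_stalk P
  have : IsDomain (U.presheaf.stalk P) := IsRegularLocalRing.isDomain _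
  have hres : ∀ f, τ f - f ∈ maximalIdeal (U.presheaf.stalk P) := hPres _
  have hτ : τ ^ p = 1 := hπ.stalkAction_pow_eq_one hP
  have hspan := hx.span_eq
  have hdvd : ∀ f, e ∣ τ f - f := dvd_sub_of_dvd_generators τ hp hres hspan fun i => by
    rw [← hI, ← Ideal.mem_span_singleton]
    exact hIx i
  obtain ⟨u₁, hu₁, hs₁⟩ := hIs
  rw [hI] at hs₁
  have hregular : (∃ i, ∃ a, IsUnit a ∧ I (x i) = e * a) → IsRegularNear Y (π P) := by
    rintro ⟨i, a, ha, hia⟩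
    rw [hI] at hia
    have hcard : Nat.card (Multiplicative (ZMod p)) = p := natCard_multiplicative_zmod
    refine hπ.isRegularNear (by rw [hcard]; exact hp.one_lt) hU mem_zpowers_ofAdd_one hP hres he0 hdvd
      (y := x i) fun j hj hjp => ?_
    rw [hcard] at hjp
    obtain ⟨z, hz, hjz⟩ := exists_pow_sub_eq τ hres (exists_map_mul_eq τ
      (exists_map_eq_mul_one_add τ hp hτ hres he0 (hdvd e)) (exists_isUnit_map_eq_mul τ ha hres))
      hia j
    exact ⟨a * (j + z), ha.mul (isUnit_natCast_add hj hjp hz), by rw [← mul_assoc]; exact hjz⟩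
  have hsingular : (¬ ∃ i, ∃ a, IsUnit a ∧ I (x i) = e * a) →
      (∀ y ∈ maximalIdeal (U.presheaf.stalk P),
        ∃ z ∈ maximalIdeal (U.presheaf.stalk P), I y = e * z) ∧
      ∃ φ : CotangentSpace (U.presheaf.stalk P) →ₗ[ResidueField (U.presheaf.stalk P)]
          CotangentSpace (U.presheaf.stalk P),
        (∀ y z : maximalIdeal (U.presheaf.stalk P), I y = e * z →
          φ ((maximalIdeal (U.presheaf.stalk P)).toCotangent y) =
            (maximalIdeal (U.presheaf.stalk P)).toCotangent z) ∧
        (∃ c : ResidueField (U.presheaf.stalk P), c ≠ 0 ∧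
          ∃ b : Fin n → ZMod p, IsDiagonalizableWith p (c • φ) b) ∧
        ∀ c : ResidueField (U.presheaf.stalk P), c ≠ 0 →
          ∀ b : Fin n → ZMod p, IsDiagonalizableWith p (c • φ) b →
            HasMuQuotientSingularity p Y (π P) b := by
    intro hno
    have hxz : ∀ i, ∃ z ∈ maximalIdeal (U.presheaf.stalk P), τ (x i) - x i = e * z := by
      intro i
      obtain ⟨z, hz⟩ := hdvd (x i)
      refine ⟨z, ?_, hz⟩
      by_contra hzm
      rw [mem_maximalIdeal, mem_nonunits_iff, not_not] at hzm
      exact hno ⟨i, z, hzm, (hI _).trans hz⟩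
    have hdvd' := exists_mem_sub_eq_mul τ hp hspan he hdvd hxz
    obtain ⟨φ, hφ⟩ := exists_cotangent_endomorphism τ he0 hres hdvd'
    have hu0 : residue (U.presheaf.stalk P) u₁ ≠ 0 :=
      (residue_ne_zero_iff_isUnit u₁).mpr hu₁
    have hpoly := aeval_prod_cotangent_endomorphism_eq_zero τ hp hτ he he0 hs0 hu₁ hs₁ hdvd' hφ
    rw [prod_X_add_eq_prod_image hu0] at hpoly
    refine ⟨fun y _ => by rw [hI]; exact hdvd' y, φ, fun y z hyz => hφ y z (by rw [← hyz, hI]), ?_, ?_⟩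
    · obtain ⟨-, v₀, -⟩ := hx
      have hn : Module.finrank (ResidueField (U.presheaf.stalk P))
          (CotangentSpace (U.presheaf.stalk P)) = n := by
        rw [Module.finrank_eq_card_basis v₀, Fintype.card_fin]
      obtain ⟨v, hv⟩ := exists_eigenbasis hn φ _ hpoly
      have hv' : ∀ i, ∃ k : ℕ, φ (v i) = -((k : ResidueField (U.presheaf.stalk P)) *
          residue _ u₁) • v i := by
        intro i
        obtain ⟨a, ha, hva⟩ := hv i
        obtain ⟨k, -, rfl⟩ := Finset.mem_image.mp ha
        exact ⟨k, hva⟩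
      choose k hk using hv'
      -- Scaling by -1/u₁ turns the eigenvalues -k u₁ into k.
      refine ⟨-(residue _ u₁)⁻¹, neg_ne_zero.mpr (inv_ne_zero hu0), fun i => k i, v, fun i => ?_⟩
      rw [LinearMap.smul_apply, hk, smul_smul, ZMod.cast_natCast (dvd_refl p)]
      congr 1
      field_simp
    · rintro c hc b ⟨v, hv⟩
      have hφv : ∀ i, φ (v i) = (c⁻¹ * (b i).cast) • v i := by
        intro i
        rw [mul_smul, ← hv, LinearMap.smul_apply, inv_smul_smul₀ hc]
      have hroot := fun i => exists_root_of_apply_eq_smul φ _ hpoly (v.ne_zero i) (hφv i)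
      have hk : ∀ i, ∃ k : ℕ, k < p ∧
          -((k : ResidueField (U.presheaf.stalk P)) * residue _ u₁) = c⁻¹ * (b i).cast := by
        intro i
        obtain ⟨k, hk, hkb⟩ := Finset.mem_image.mp (hroot i)
        exact ⟨k, Finset.mem_range.mp hk, hkb⟩
      choose k hkp hkb using hk
      -- For arbitrary c, comparing b_i/c with -k_i u₁ gives b_i = -c u₁ k_i in the residue field;
      -- the constant is then replaced by some r ∈ 𝔽_p, the weight of T.
      obtain ⟨r, hr, hbr⟩ := exists_weight_of_natCast_eq hp
        (d := -(c * residue (U.presheaf.stalk P) u₁)) (neg_ne_zero.mpr (mul_ne_zero hc hu0))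
        (b := b) (k := k) fun i => by
          have h1 := congrArg (fun t => c * t) (hkb i)
          simp only [mul_inv_cancel_left₀ hc] at h1
          rw [← h1]
          ring
      have hb : b = fun i => (k i : ZMod p) * r := funext hbr
      rw [hb]
      refine hπ.hasMuQuotientSingularity hp hU hPclosed hP he he0 hs0 hu₁ hs₁ hdvd' hφ v hkp
        (fun i => ?_) hr
      rw [hφv, ← hkb, neg_smul, ← algebraMap_smul (ResidueField (U.presheaf.stalk P))
        ((k i : U.presheaf.stalk P) * u₁) (v i), map_mul, map_natCast]
      rfl
  refine ⟨?_, hregular, hsingular⟩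
  by_cases hcase : ∃ i, ∃ a, IsUnit a ∧ I (x i) = e * a
  · exact Or.inl (hregular hcase)
  · obtain ⟨-, φ, -, ⟨c, hc, b, hb⟩, hall⟩ := hsingular hcase
    exact Or.inr ⟨b, hall c hc b hb⟩
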